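/- **Conventions.** Let $X$ be a complete metric space with its Borel $\sigma$-algebra, $\mathrm{LIP}(f)$ the global Lipschitz constant of $f$, $\mathrm{Lip}(X)$ the space of real-valued Lipschitz functions, $\mathrm{Lip}_b(X)$ that of the bounded ones, and $D^k(X)=\mathrm{Lip}_b(X)\times\mathrm{Lip}(X)^k$. The pointwise Lipschitz constant of a map $\phi$ is $\operatorname{Lip}\phi(x)=\limsup_{y\to x}\frac{d(\phi(y),\phi(x))}{d(y,x)}$ (and $0$ if $x$ is isolated). A *metric $k$-current* is a multilinear functional $T\colon D^k(X)\to\mathbb R$ such that * (locality) $T(f,\pi_1,\dots,\pi_k)=0$ if some $\pi_i$ is constant on a neighbourhood of $\{f\ne0\}$; * (joint continuity) $T(f,\pi^n_1,\dots,\pi^n_k)\to T(f,\pi_1,\dots,\pi_k)$ whenever $\pi_i^n\to\pi_i$ pointwise for every $i$ and $\sup_{i,n}\mathrm{LIP}(\pi_i^n)<\infty$; * (finite mass) there is a finite Borel measure $\mu\ge0$ with $|T(f,\pi_1,\dots,\pi_k)|\le\prod_{i=1}^k\mathrm{LIP}(\pi_i)\int|f|\,d\mu$ for all $(f,\pi)\in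 D^k(X)$. The minimal such $\mu$ is denoted $\|T\|$, and $\mathbb M(T)=\|T\|(X)$. For fixed $\pi$, the functional $T(\cdot,\pi)$ is extended by continuity from $\mathrm{Lip}_b(X)$ to $L^1(\|T\|)$. We say that $T$ has bounded support if $\|T\|$ is concentrated on a bounded set (for separable $X$ this means that the closed support of $\|T\|$ is bounded). For $k\ge1$ let $\partial T(f,\pi_1,\dots,\pi_{k-1})=T(1,f,\pi_1,\dots,\pi_{k-1})$; $T$ is *normal*, written $T\in\mathbf N_k(X)$, if $T$ is a metric $k$-current and $\partial T$ is a metric $(k-1)$-current. For a Lipschitz map $\phi$ let $\phi_\#T(f,\pi)=T(f\circ\phi,\pi_1\circ\phi,\dots,\pi_k\circ\phi)$. **Proposition.** Let $(\mathbb B,\|\cdot\|)$ be a real Banach space, $k\ge1$, let $T\in\mathbf N_k(\mathbb B)$ have bounded support, let $\phi,\psi\colon\mathbb B\to\mathbb B$ be Lipschitz, and let $h(t,x)=t\phi(x)+(1-t)\psi(x)$. For $j\in\{k-1,k\}$, a metric $j$-current $S$ and $(f,\pi)\in D^{j+1}(\mathbb B)$ put $$H(S)(f,\pi)=\sum_{i=1}^{j+1}(-1)^{i+1}\int_0^1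 S\Big(f\circ h(t,\cdot)\,\frac{\partial(\pi_i\circ h)}{\partial t}(t,\cdot),\ \hat\pi_i\circ h(t,\cdot)\Big)\,dt,$$ where $\hat\pi_i=(\pi_1,\dots,\pi_{i-1},\pi_{i+1},\dots,\pi_{j+1})$ and the $t$-derivative is taken to be $0$ where it does not exist. Then $H(T)$ and $H(\partial T)$ are well defined (for each $t\in[0,1]$ the first arguments are $\|S\|$-integrable, and the integrands are integrable in $t$, for $S=T$ and $S=\partial T$), and 1. $\displaystyle \mathbb M(H(T))\le(k+1)\int\|\phi(x)-\psi(x)\|\,\max\{\operatorname{Lip}\psi(x),\operatorname{Lip}\phi(x)\}^k\,d\|T\|(x)$; 2. $H(T)\in\mathbf N_{k+1}(\mathbb B)$; 3. $\phi_\#T-\psi_\#T=\partial H(T)+H(\partial T)$. -/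

import Mathlib

open MeasureTheory Filter Topology
open scoped NNReal ENNReal

noncomputable section

namespace MetricCurrents

/-- A map between metric spaces is Lipschitz. -/
def IsLip {X Y : Type*} [PseudoEMetricSpace X] [PseudoEMetricSpace Y] (φ : X → Y) : Prop :=
  ∃ K : ℝ≥0, LipschitzWith K φ

/-- The global Lipschitz constant `LIP(f) = sup_{x ≠ y} d(f x, f y) / d(x, y)`. -/
def lipConst {X Y : Type*} [PseudoEMetricSpace X] [PseudoEMetricSpace Y] (f : X → Y) : ℝ≥0∞ :=
  ⨆ (x : X) (y : X) (_ : x ≠ y), edist (f x) (f y) / edist x y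

/-- The pointwise Lipschitz constant `Lip f(x) = limsup_{y → x, y ≠ x} d(f y, f x) / d(y, x)`.
At an isolated point the limsup is along the trivial filter and equals `0`. -/
def pointLip {X Y : Type*} [PseudoEMetricSpace X] [PseudoEMetricSpace Y]
    (f : X → Y) (x : X) : ℝ≥0∞ :=
  limsup (fun y => edist (f y) (f x) / edist y x) (𝓝[≠] x)

/-- `Lip(X)`, the vector space of real valued Lipschitz functions. -/
def Lip (X : Type*) [MetricSpace X] : Submodule ℝ (X → ℝ) where
  carrier := {f | IsLip f}
  add_mem' := by
    rintro f g ⟨K, hK⟩ ⟨L, hL⟩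
    exact ⟨K + L, hK.add hL⟩
  zero_mem' := ⟨0, LipschitzWith.const 0⟩
  smul_mem' := by
    rintro c f ⟨K, hK⟩
    refine ⟨‖c‖₊ * K, LipschitzWith.of_dist_le_mul fun x y => ?_⟩
    have h := mul_le_mul_of_nonneg_left (hK.dist_le_mul x y) (norm_nonneg c)
    simpa [Real.dist_eq, ← mul_sub, abs_mul, mul_assoc] using h

/-- `Lip_b(X)`, the vector space of bounded real valued Lipschitz functions. -/
def LipB (X : Type*) [MetricSpace X] : Submodule ℝ (X → ℝ) where
  carrier := {f | IsLip f ∧ ∃ C : ℝ, ∀ x, |f x| ≤ C}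
  add_mem' := by
    rintro f g ⟨hf, C, hC⟩ ⟨hg, D, hD⟩
    exact ⟨(Lip X).add_mem hf hg, C + D,
      fun x => (abs_add_le _ _).trans (add_le_add (hC x) (hD x))⟩
  zero_mem' := ⟨(Lip X).zero_mem, 0, by simp⟩
  smul_mem' := by
    rintro c f ⟨hf, C, hC⟩
    refine ⟨(Lip X).smul_mem c hf, |c| * C, fun x => ?_⟩
    have h := mul_le_mul_of_nonneg_left (hC x) (abs_nonneg c)
    simpa [abs_mul] using h

section Basic

variable {X Y : Type*} [MetricSpace X] [MetricSpace Y]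

/-- A bounded Lipschitz function, seen as a Lipschitz function. -/
def lipBToLip (f : LipB X) : Lip X := ⟨f.1, f.2.1⟩

/-- The constant function `1`. -/
def lipBOne : LipB X := ⟨fun _ => 1, ⟨0, LipschitzWith.const 1⟩, 1, by simp⟩

/-- The composition `p ∘ φ` of a Lipschitz function with a Lipschitz map. -/
def lipComp (p : Lip Y) (φ : X → Y) (hφ : IsLip φ) : Lip X :=
  ⟨fun x => p.1 (φ x), by
    obtain ⟨K, hK⟩ := p.2
    obtain ⟨L, hL⟩ := hφ
    exact ⟨K * L, hK.comp hL⟩⟩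

/-- The composition `f ∘ φ` of a bounded Lipschitz function with a Lipschitz map. -/
def lipBComp (f : LipB Y) (φ : X → Y) (hφ : IsLip φ) : LipB X :=
  ⟨fun x => f.1 (φ x), (lipComp (lipBToLip f) φ hφ).2, by
    obtain ⟨C, hC⟩ := f.2.2
    exact ⟨C, fun x => hC (φ x)⟩⟩

end Basic

/-- Real valued functionals on `D^k(X) = Lip_b(X) × Lip(X)^k`. -/
abbrev MetricFunctional (X : Type*) [MetricSpace X] (k : ℕ) : Type _ :=
  LipB X → (Fin k → Lip X) → ℝ

section Currents

variable {X Y : Type*} [MetricSpace X] [MetricSpace Y] {k : ℕ}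

/-- The bound `|T(f, π)| ≤ ∏ᵢ LIP(πᵢ) ∫ |f| dμ` for all `(f, π) ∈ D^k(X)`. -/
def MassBound [MeasurableSpace X] (T : MetricFunctional X k) (μ : Measure X) : Prop :=
  ∀ (f : LipB X) (π : Fin k → Lip X),
    ENNReal.ofReal |T f π| ≤ (∏ i, lipConst (π i).1) * ∫⁻ x, ENNReal.ofReal |f.1 x| ∂μ

/-- Metric `k`-currents: multilinear functionals on `D^k(X)` that are local, jointly continuous
and of finite mass. -/
structure IsMetricCurrent [MeasurableSpace X] (T : MetricFunctional X k) : Prop where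
  linear_left : ∀ π : Fin k → Lip X, IsLinearMap ℝ fun f : LipB X => T f π
  linear_right : ∀ (f : LipB X) (π : Fin k → Lip X) (i : Fin k),
    IsLinearMap ℝ fun p : Lip X => T f (Function.update π i p)
  locality : ∀ (f : LipB X) (π : Fin k → Lip X) (i : Fin k),
    (∃ U ∈ 𝓝ˢ {x | f.1 x ≠ 0}, ∃ c : ℝ, ∀ x ∈ U, (π i).1 x = c) → T f π = 0
  continuity : ∀ (f : LipB X) (π : Fin k → Lip X) (ρ : ℕ → Fin k → Lip X),
    (∃ C : ℝ≥0, ∀ n i, LipschitzWith C (ρ n i).1) →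
    (∀ i x, Tendsto (fun n => (ρ n i).1 x) atTop (𝓝 ((π i).1 x))) →
    Tendsto (fun n => T f (ρ n)) atTop (𝓝 (T f π))
  finite_mass : ∃ μ : Measure X, IsFiniteMeasure μ ∧ MassBound T μ

/-- The mass measure `‖T‖`: the minimal finite Borel measure with the mass bound, as the infimum
of all of them in the lattice of measures. -/
def massMeasure [MeasurableSpace X] (T : MetricFunctional X k) : Measure X :=
  sInf {μ : Measure X | IsFiniteMeasure μ ∧ MassBound T μ}

/-- The mass `M(T) = ‖T‖(X)`. -/
def mass [MeasurableSpace X] (T : MetricFunctional X k) : ℝ≥0∞ :=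
  massMeasure T Set.univ

/-- `T` has bounded support: `‖T‖` is concentrated on a bounded set. Whenever `‖T‖` is concentrated
on its closed support (always so in a separable space), this says that the closed support of `‖T‖`
is bounded. -/
def HasBoundedSupport [MeasurableSpace X] (T : MetricFunctional X k) : Prop :=
  ∃ C : Set X, Bornology.IsBounded C ∧ massMeasure T Cᶜ = 0

/-- The boundary `∂T(f, π₁, …, π_k) = T(1, f, π₁, …, π_k)`. -/
def boundary (T : MetricFunctional X (k + 1)) : MetricFunctional X k :=
  fun f π => T lipBOne (Fin.cons (lipBToLip f) π)

/-- Normal currents: metric currents whose boundary is a metric current. -/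
def IsNormalCurrent [MeasurableSpace X] (T : MetricFunctional X (k + 1)) : Prop :=
  IsMetricCurrent T ∧ IsMetricCurrent (boundary T)

/-- The pushforward `φ_# T(f, π) = T(f ∘ φ, π ∘ φ)` along a Lipschitz map. -/
def pushforward (φ : X → Y) (hφ : IsLip φ) (T : MetricFunctional X k) : MetricFunctional Y k :=
  fun f π => T (lipBComp f φ hφ) fun i => lipComp (π i) φ hφ

/-- The extension of `T(·, π)` from `Lip_b(X)` to `‖T‖`-integrable functions `g` by `L¹(‖T‖)`
continuity: the limit of `T(f, π)` as `f ∈ Lip_b(X)` tends to `g` in `L¹(‖T‖)`. -/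
def extend [MeasurableSpace X] (T : MetricFunctional X k) (g : X → ℝ) (π : Fin k → Lip X) : ℝ :=
  limUnder
    (comap (fun f : LipB X => ∫⁻ x, ENNReal.ofReal |f.1 x - g x| ∂(massMeasure T)) (𝓝 0))
    fun f => T f π

end Currents

section Homotopy

variable {B : Type*} [NormedAddCommGroup B] [NormedSpace ℝ B] {k : ℕ}

/-- The affine homotopy `h(t, x) = t φ(x) + (1 - t) ψ(x)`. -/
def affineHomotopy (φ ψ : B → B) (t : ℝ) (x : B) : B :=
  t • φ x + (1 - t) • ψ x

lemma isLip_affineHomotopy {φ ψ : B → B} (hφ : IsLip φ) (hψ : IsLip ψ) (t : ℝ) :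
    IsLip (affineHomotopy φ ψ t) := by
  obtain ⟨K, hK⟩ := hφ
  obtain ⟨L, hL⟩ := hψ
  exact ⟨_, ((lipschitzWith_smul t).comp hK).add ((lipschitzWith_smul (1 - t)).comp hL)⟩

/-- The function `x ↦ f(h(t, x)) · ∂(p ∘ h)/∂t (t, x)`. -/
def homotopyWeight (φ ψ : B → B) (f p : B → ℝ) (t : ℝ) (x : B) : ℝ :=
  f (affineHomotopy φ ψ t x) * deriv (fun s => p (affineHomotopy φ ψ s x)) t

/-- The value `T(f ∘ h ∂(πᵢ ∘ h)/∂t, π̂ᵢ ∘ h)` at time `t`, where `π̂ᵢ` is `π` without `πᵢ`. -/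
def homotopyTerm [MeasurableSpace B] (φ ψ : B → B) (hφ : IsLip φ) (hψ : IsLip ψ)
    (T : MetricFunctional B k) (f : LipB B) (π : Fin (k + 1) → Lip B) (i : Fin (k + 1))
    (t : ℝ) : ℝ :=
  extend T (homotopyWeight φ ψ f.1 (π i).1 t) fun j =>
    lipComp (π (i.succAbove j)) (affineHomotopy φ ψ t) (isLip_affineHomotopy hφ hψ t)

/-- The homotopy functional
`H(T)(f, π) = ∑ᵢ (-1)ⁱ ∫₀¹ T(f ∘ h ∂(πᵢ ∘ h)/∂t, π̂ᵢ ∘ h) dt`, with `i` running from `0` to `k`. -/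
def homotopyFunctional [MeasurableSpace B] (φ ψ : B → B) (hφ : IsLip φ) (hψ : IsLip ψ)
    (T : MetricFunctional B k) : MetricFunctional B (k + 1) :=
  fun f π => ∑ i : Fin (k + 1),
    (-1 : ℝ) ^ (i : ℕ) * ∫ t in (0 : ℝ)..1, homotopyTerm φ ψ hφ hψ T f π i t

/-- All integrals in the definition of `H(T)` converge: at every time the weight is
`‖T‖`-integrable, so that `T` can be evaluated on it, and the terms are integrable in time. -/
def HomotopyConverges [MeasurableSpace B] (φ ψ : B → B) (hφ : IsLip φ) (hψ : IsLip ψ)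
    (T : MetricFunctional B k) : Prop :=
  ∀ (f : LipB B) (π : Fin (k + 1) → Lip B) (i : Fin (k + 1)),
    (∀ t ∈ Set.Icc (0 : ℝ) 1,
      Integrable (homotopyWeight φ ψ f.1 (π i).1 t) (massMeasure T)) ∧
    IntervalIntegrable (homotopyTerm φ ψ hφ hψ T f π i) volume 0 1

end Homotopy

end MetricCurrents

end

set_option linter.unusedSectionVars false

noncomputable section

namespace MetricCurrents

/-! ### Lipschitz constants, density of `Lip_b` in `L¹`, extension of bounded functionals. -/

section LipschitzConstants

variable {X Y : Type*} [MetricSpace X] [PseudoEMetricSpace Y]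

/-! Differentiating t ↦ T(f ∘ h_t, π ∘ h_t) formally puts the time derivatives ∂_t(π_i ∘ h) into
differential slots, where they make no sense: in x they are merely measurable and locally bounded.
Normality is the remedy. The product rule gives the integration by parts T(f, σ, ρ) = ∂T(fσ, ρ) −
T(σ, f, ρ) (`IsNormalCurrent.apply_cons`), which moves σ into the first slot, where `L¹` convergence
suffices. It is applied to forward difference quotients σ in time. These are bounded by LIP(π_i)‖φ −
ψ‖, and by one-dimensional Rademacher in t and Fubini they converge, for almost every t, almost
everywhere in x. So the difference quotient of t ↦ T(f ∘ h_t, π ∘ h_t), telescoped slot by slot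
(`diffQuot_pushforwardAt`), converges to the integrand of ∂H(T) + H(∂T), while its integral over
[0,1] converges to φ_#T − ψ_#T (`homotopy_formula`). Bounded support enters because it makes ‖φ − ψ‖
essentially bounded, which supplies the domination.

This rests on classical properties of a metric current, derived here from the axioms after extending
T to integrable first arguments: the mass measure satisfies the mass bound (`massMeasure_mem`),
locality needs no neighbourhood (`extend_eq_zero`), T is alternating (`extend_eq_zero_of_eq`), the
product rule holds (`extend_leibniz`), and pointwise Lipschitz constants suffice in the mass bound
(`abs_extend_le_integral_pointLip`). The last three share one device: cut the space into countably
many Borel cells (`abs_le_integral_of_cells`), on each of which only the Lipschitz constants of the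
restrictions count.

The mass of H(T) is bounded by applying the pointwise estimate at each time, where Lip h_t ≤ max(Lip
φ, Lip ψ) by convexity, and integrating in t (`massBound_homotopyFunctional`).

The delicate axiom for H(T) is joint continuity, since pointwise convergence of π^n says nothing
about time derivatives. The homotopy formula does not presuppose it and shows that ∂H(T) = φ_#T −
ψ_#T − H(∂T) has finite mass. A local alternating functional with bounded support, product rule,
finite mass and finite boundary mass is continuous, again by integration by parts
(`tendsto_of_massBound_boundary`). -/

lemma lipConst_le {f : X → Y} {K : ℝ≥0} (h : LipschitzWith K f) : lipConst f ≤ K := by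
  refine iSup_le fun x => iSup_le fun y => iSup_le fun _ => ?_
  exact ENNReal.div_le_of_le_mul (h x y)

lemma lipConst_ne_top {f : X → Y} (h : IsLip f) : lipConst f ≠ ∞ := by
  obtain ⟨K, hK⟩ := h
  exact ne_top_of_le_ne_top ENNReal.coe_ne_top (lipConst_le hK)

lemma lipschitzWith_lipConst {f : X → Y} (h : IsLip f) :
    LipschitzWith (lipConst f).toNNReal f := by
  intro x y
  rw [ENNReal.coe_toNNReal (lipConst_ne_top h)]
  rcases eq_or_ne x y with rfl | hxy
  · simp
  · rw [← ENNReal.div_le_iff (by simpa using hxy) (edist_ne_top x y)]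
    exact le_iSup_of_le x (le_iSup_of_le y (le_iSup_of_le hxy le_rfl))

/-- The Lipschitz constant of a Lipschitz function, as a real number. -/
def lipReal (p : Lip X) : ℝ≥0 := (lipConst p.1).toNNReal

lemma coe_lipReal (p : Lip X) : (lipReal p : ℝ≥0∞) = lipConst p.1 :=
  ENNReal.coe_toNNReal (lipConst_ne_top p.2)

lemma lipschitzWith_lipReal (p : Lip X) : LipschitzWith (lipReal p) p.1 :=
  lipschitzWith_lipConst p.2

lemma lipReal_le {p : Lip X} {K : ℝ≥0} (h : LipschitzWith K p.1) : lipReal p ≤ K := by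
  rw [← ENNReal.coe_le_coe, coe_lipReal]
  exact lipConst_le h

end LipschitzConstants

section Density

variable {X : Type*} [MetricSpace X]

lemma Lip.continuous (p : Lip X) : Continuous p.1 := (lipschitzWith_lipReal p).continuous

lemma LipB.continuous (f : LipB X) : Continuous f.1 := Lip.continuous (lipBToLip f)

lemma LipB.exists_bound (f : LipB X) : ∃ C : ℝ, 0 ≤ C ∧ ∀ x, |f.1 x| ≤ C := by
  obtain ⟨C, hC⟩ := f.2.2
  exact ⟨max C 0, le_max_right _ _, fun x => (hC x).trans (le_max_left _ _)⟩

/-- A cut-off function that is `1` on `F` and vanishes away from the `δ`-neighbourhood of `F`. -/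
def cutoff (F : Set X) (δ : ℝ) (hδ : 0 < δ) : LipB X :=
  ⟨fun x => (thickenedIndicator hδ F x : ℝ),
    ⟨_, LipschitzWith.of_dist_le_mul fun x y =>
      (lipschitzWith_thickenedIndicator hδ F).dist_le_mul x y⟩, 1, fun x => by
        rw [abs_of_nonneg (NNReal.coe_nonneg _)]
        exact_mod_cast thickenedIndicator_le_one hδ F x⟩

lemma cutoff_nonneg (F : Set X) {δ : ℝ} (hδ : 0 < δ) (x : X) : 0 ≤ (cutoff F δ hδ).1 x :=
  NNReal.coe_nonneg _

lemma cutoff_le_one (F : Set X) {δ : ℝ} (hδ : 0 < δ) (x : X) : (cutoff F δ hδ).1 x ≤ 1 :=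
  by exact_mod_cast thickenedIndicator_le_one hδ F x

lemma cutoff_eq_one {F : Set X} {δ : ℝ} (hδ : 0 < δ) {x : X} (hx : x ∈ F) :
    (cutoff F δ hδ).1 x = 1 := by
  have := thickenedIndicator_one hδ F hx
  simp only [cutoff, this, NNReal.coe_one]

lemma cutoff_eq_zero {F : Set X} {δ : ℝ} (hδ : 0 < δ) {x : X} (hx : x ∉ Metric.thickening δ F) :
    (cutoff F δ hδ).1 x = 0 := by
  have := thickenedIndicator_zero hδ F hx
  simp only [cutoff, this, NNReal.coe_zero]

lemma tendsto_cutoff {F : Set X} (hF : IsClosed F) (x : X) :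
    Tendsto (fun n : ℕ => (cutoff F (1 / ((n : ℝ) + 1)) Nat.one_div_pos_of_nat).1 x) atTop
      (𝓝 (F.indicator (fun _ => (1 : ℝ)) x)) := by
  have h := thickenedIndicator_tendsto_indicator_closure
    (fun n : ℕ => Nat.one_div_pos_of_nat (α := ℝ) (n := n))
    tendsto_one_div_add_atTop_nhds_zero_nat F
  rw [hF.closure_eq, tendsto_pi_nhds] at h
  have h2 := (NNReal.continuous_coe.tendsto _).comp (h x)
  have h3 : ((F.indicator (fun _ => (1 : ℝ≥0)) x : ℝ≥0) : ℝ) =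
      F.indicator (fun _ => (1 : ℝ)) x := by
    by_cases hx : x ∈ F <;> simp [hx]
  rw [h3] at h2
  exact h2

variable [MeasurableSpace X] [BorelSpace X]

lemma LipB.integrable (f : LipB X) (μ : Measure X) [IsFiniteMeasure μ] : Integrable f.1 μ := by
  obtain ⟨C, _, hC⟩ := LipB.exists_bound f
  exact Integrable.of_bound (LipB.continuous f).aestronglyMeasurable C
    (ae_of_all _ fun x => by simpa using hC x)

/-- `Lip_b` is a vector space, so indicators suffice. Finite Borel measures on a metric space are
inner regular for closed sets, and cut-offs of shrinking width converge to the indicator of a closed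
set. -/
lemma exists_lipB_eLpNorm_le (μ : Measure X) [IsFiniteMeasure μ] {g : X → ℝ}
    (hg : Integrable g μ) {ε : ℝ≥0∞} (hε : ε ≠ 0) :
    ∃ f : LipB X, eLpNorm (g - f.1) 1 μ ≤ ε := by
  have key := MemLp.induction_dense (p := 1) (μ := μ) (by simp)
    (fun g : X → ℝ => g ∈ LipB X) ?_ (fun f g hf hg => (LipB X).add_mem hf hg)
    (fun f hf => (LipB.continuous ⟨f, hf⟩).aestronglyMeasurable) (memLp_one_iff_integrable.2 hg) hε
  · obtain ⟨f, hf, hf'⟩ := key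
    exact ⟨⟨f, hf'⟩, hf⟩
  intro c s hs _ ε hε
  obtain ⟨η, hη, hη'⟩ := exists_eLpNorm_indicator_le (μ := μ) (p := 1) (by simp) c
    (ENNReal.half_pos hε).ne'
  -- Closedness of F matters: the cut-offs converge to the indicator of the closure.
  obtain ⟨F, hFs, hF, hFd⟩ := hs.exists_isClosed_sdiff_lt (measure_ne_top μ s)
    (ENNReal.coe_pos.2 hη).ne'
  have hlim : Tendsto (fun n : ℕ => eLpNorm ((fun x => c * (cutoff F (1 / ((n : ℝ) + 1))
      Nat.one_div_pos_of_nat).1 x) - F.indicator fun _ => c) 1 μ) atTop (𝓝 0) := by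
    have := tendsto_lintegral_norm_of_dominated_convergence (μ := μ)
      (F := fun (n : ℕ) x => c * (cutoff F (1 / ((n : ℝ) + 1)) Nat.one_div_pos_of_nat).1 x)
      (f := F.indicator fun _ => c) (bound := fun _ => |c|)
      (fun n => (continuous_const.mul (LipB.continuous _)).aestronglyMeasurable)
      (integrable_const _).hasFiniteIntegral
      (fun n => ae_of_all _ fun x => ?_) ?_
    · simpa only [eLpNorm_one_eq_lintegral_enorm, ofReal_norm, Pi.sub_apply] using this
    · simp only [Real.norm_eq_abs, abs_mul, abs_of_nonneg (cutoff_nonneg F _ x)]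
      exact mul_le_of_le_one_right (abs_nonneg _) (cutoff_le_one F _ x)
    · refine ae_of_all _ fun x => ?_
      have := (tendsto_cutoff hF x).const_mul c
      convert this using 2
      by_cases hx : x ∈ F <;> simp [hx]
  obtain ⟨n, hn⟩ := (hlim.eventually_lt_const (ENNReal.half_pos hε)).exists
  refine ⟨c • (cutoff F (1 / ((n : ℝ) + 1)) Nat.one_div_pos_of_nat).1, ?_,
    (LipB X).smul_mem c (Subtype.mem _)⟩
  have hsplit : (c • (cutoff F (1 / ((n : ℝ) + 1)) Nat.one_div_pos_of_nat).1 -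
      s.indicator fun _ => c) = ((fun x => c * (cutoff F (1 / ((n : ℝ) + 1))
      Nat.one_div_pos_of_nat).1 x) - F.indicator fun _ => c) - (s \ F).indicator fun _ => c := by
    ext x
    by_cases hxF : x ∈ F
    · simp [hxF, hFs hxF]
    · by_cases hxs : x ∈ s <;> simp [hxF, hxs]
  rw [hsplit]
  refine (eLpNorm_sub_le ?_ ?_ le_rfl).trans ?_
  · exact ((continuous_const.mul (LipB.continuous _)).aestronglyMeasurable).sub
      (aestronglyMeasurable_const.indicator hF.measurableSet)
  · exact aestronglyMeasurable_const.indicator (hs.diff hF.measurableSet)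
  · exact (add_le_add hn.le (hη' _ hFd.le)).trans (ENNReal.add_halves ε).le

lemma exists_lipB_integral_le (μ : Measure X) [IsFiniteMeasure μ] {g : X → ℝ}
    (hg : Integrable g μ) {ε : ℝ} (hε : 0 < ε) :
    ∃ f : LipB X, ∫ x, |f.1 x - g x| ∂μ ≤ ε := by
  obtain ⟨f, hf⟩ := exists_lipB_eLpNorm_le μ hg (ε := ENNReal.ofReal ε) (by simpa using hε)
  refine ⟨f, ?_⟩
  rw [integral_congr_ae (ae_of_all _ fun x => abs_sub_comm _ _)]
  rw [eLpNorm_one_eq_lintegral_enorm, ← ofReal_integral_norm_eq_lintegral_enorm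
    (hg.sub (LipB.integrable f μ)), ENNReal.ofReal_le_ofReal_iff hε.le] at hf
  exact hf

end Density

section Extension

variable {X : Type*} [MetricSpace X] [MeasurableSpace X]

/-- The neighbourhoods of `g` in `L¹(μ)`, traced on the bounded Lipschitz functions. -/
def l1Filter (μ : Measure X) (g : X → ℝ) : Filter (LipB X) :=
  comap (fun f : LipB X => ∫⁻ x, ENNReal.ofReal |f.1 x - g x| ∂μ) (𝓝 0)

variable [BorelSpace X] {μ : Measure X} [IsFiniteMeasure μ]

lemma lintegral_ofReal_abs_eq {g : X → ℝ} (hg : Integrable g μ) :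
    ∫⁻ x, ENNReal.ofReal |g x| ∂μ = ENNReal.ofReal (∫ x, |g x| ∂μ) :=
  (ofReal_integral_eq_lintegral_ofReal hg.abs (ae_of_all _ fun _ => abs_nonneg _)).symm

lemma tendsto_l1Filter_iff {g : X → ℝ} (hg : Integrable g μ) :
    l1Filter μ g = comap (fun f : LipB X => ∫ x, |f.1 x - g x| ∂μ) (𝓝 0) := by
  have h1 : (fun f : LipB X => ∫⁻ x, ENNReal.ofReal |f.1 x - g x| ∂μ) =
      fun f : LipB X => ENNReal.ofReal (∫ x, |f.1 x - g x| ∂μ) :=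
    funext fun f => lintegral_ofReal_abs_eq ((LipB.integrable f μ).sub hg)
  rw [l1Filter, h1]
  apply le_antisymm
  · rw [← tendsto_iff_comap]
    have h2 := (ENNReal.tendsto_toReal ENNReal.zero_ne_top).comp
      (tendsto_comap (f := fun f : LipB X => ENNReal.ofReal (∫ x, |f.1 x - g x| ∂μ))
        (x := 𝓝 0))
    exact h2.congr fun f => ENNReal.toReal_ofReal (integral_nonneg fun _ => abs_nonneg _)
  · rw [← tendsto_iff_comap]
    have h2 := (ENNReal.tendsto_ofReal (a := 0) (tendsto_comap
      (f := fun f : LipB X => ∫ x, |f.1 x - g x| ∂μ) (x := 𝓝 0)))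
    simpa using h2

lemma l1Filter_neBot {g : X → ℝ} (hg : Integrable g μ) : (l1Filter μ g).NeBot := by
  rw [tendsto_l1Filter_iff hg, comap_neBot_iff]
  intro t ht
  obtain ⟨ε, hε, hεt⟩ := Metric.mem_nhds_iff.1 ht
  obtain ⟨f, hf⟩ := exists_lipB_integral_le μ hg (half_pos hε)
  refine ⟨f, hεt ?_⟩
  rw [Metric.mem_ball, Real.dist_eq, sub_zero,
    abs_of_nonneg (integral_nonneg fun _ => abs_nonneg _)]
  linarith

lemma tendsto_integral_l1Filter {g : X → ℝ} (hg : Integrable g μ) :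
    Tendsto (fun f : LipB X => ∫ x, |f.1 x - g x| ∂μ) (l1Filter μ g) (𝓝 0) := by
  rw [tendsto_l1Filter_iff hg]
  exact tendsto_comap

/-- A linear functional on bounded Lipschitz functions that is bounded in `L¹(μ)`. -/
structure IsL1Bounded (μ : Measure X) (K : ℝ) (F : LipB X → ℝ) : Prop where
  linear : IsLinearMap ℝ F
  nonneg : 0 ≤ K
  bound : ∀ f, |F f| ≤ K * ∫ x, |f.1 x| ∂μ

namespace IsL1Bounded

variable {K : ℝ} {F : LipB X → ℝ}

lemma abs_sub_le (hF : IsL1Bounded μ K F) (f f' : LipB X) :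
    |F f - F f'| ≤ K * ∫ x, |f.1 x - f'.1 x| ∂μ := by
  rw [← hF.linear.map_sub]
  exact hF.bound _

lemma integral_abs_sub_le {a b c : X → ℝ} (ha : Integrable a μ) (hb : Integrable b μ)
    (hc : Integrable c μ) :
    ∫ x, |a x - c x| ∂μ ≤ ∫ x, |a x - b x| ∂μ + ∫ x, |b x - c x| ∂μ := by
  have h := integral_add (ha.sub hb).abs (hb.sub hc).abs
  simp only [Pi.sub_apply] at h
  rw [← h]
  exact integral_mono (ha.sub hc).abs ((ha.sub hb).abs.add (hb.sub hc).abs)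
    fun x => _root_.abs_sub_le _ _ _

/-- The `L¹` bound makes F uniformly continuous, so the image of the neighbourhood filter is Cauchy
in ℝ. -/
lemma exists_tendsto (hF : IsL1Bounded μ K F) {g : X → ℝ} (hg : Integrable g μ) :
    ∃ a, Tendsto F (l1Filter μ g) (𝓝 a) := by
  have := l1Filter_neBot hg
  apply cauchy_map_iff_exists_tendsto.1
  rw [cauchy_map_iff]
  refine ⟨inferInstance, ?_⟩
  rw [Metric.uniformity_eq_comap_nhds_zero, tendsto_comap_iff]
  have h0 := tendsto_integral_l1Filter hg
  have h1 : Tendsto (fun q : LipB X × LipB X => K * (∫ x, |q.1.1 x - g x| ∂μ +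
      ∫ x, |q.2.1 x - g x| ∂μ)) (l1Filter μ g ×ˢ l1Filter μ g) (𝓝 0) := by
    have := ((h0.comp tendsto_fst).add (h0.comp tendsto_snd)).const_mul K
    simpa using this
  refine squeeze_zero (fun _ => dist_nonneg) (fun q => ?_) h1
  simp only [Real.dist_eq]
  refine (hF.abs_sub_le _ _).trans (mul_le_mul_of_nonneg_left ?_ hF.nonneg)
  refine (integral_abs_sub_le (LipB.integrable q.1 μ) hg (LipB.integrable q.2 μ)).trans ?_
  simp only [abs_sub_comm (g _), le_refl]

end IsL1Bounded

/-- The extension of a functional from bounded Lipschitz functions to `L¹(μ)`. -/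
def l1Extend (μ : Measure X) (F : LipB X → ℝ) (g : X → ℝ) : ℝ := limUnder (l1Filter μ g) F

namespace IsL1Bounded

variable {K : ℝ} {F : LipB X → ℝ} {g g' : X → ℝ}

lemma tendsto_l1Extend (hF : IsL1Bounded μ K F) (hg : Integrable g μ) :
    Tendsto F (l1Filter μ g) (𝓝 (l1Extend μ F g)) := by
  have := l1Filter_neBot hg
  obtain ⟨a, ha⟩ := hF.exists_tendsto hg
  rwa [l1Extend, ha.limUnder_eq]

lemma abs_sub_l1Extend_le (hF : IsL1Bounded μ K F) (hg : Integrable g μ) (f : LipB X) :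
    |F f - l1Extend μ F g| ≤ K * ∫ x, |f.1 x - g x| ∂μ := by
  have := l1Filter_neBot hg
  have h1 : Tendsto (fun f' => |F f - F f'|) (l1Filter μ g) (𝓝 |F f - l1Extend μ F g|) :=
    ((hF.tendsto_l1Extend hg).const_sub _).abs
  have h2 : Tendsto (fun f' : LipB X => K * (∫ x, |f.1 x - g x| ∂μ + ∫ x, |f'.1 x - g x| ∂μ))
      (l1Filter μ g) (𝓝 (K * (∫ x, |f.1 x - g x| ∂μ + 0))) :=
    ((tendsto_integral_l1Filter hg).const_add _).const_mul K
  rw [add_zero] at h2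
  refine le_of_tendsto_of_tendsto' h1 h2 fun f' => ?_
  refine (hF.abs_sub_le _ _).trans (mul_le_mul_of_nonneg_left ?_ hF.nonneg)
  refine (integral_abs_sub_le (LipB.integrable f μ) hg (LipB.integrable f' μ)).trans ?_
  simp only [abs_sub_comm (g _), le_refl]

lemma l1Extend_eq_of_bound (hF : IsL1Bounded μ K F) (hg : Integrable g μ) {a K' : ℝ}
    (h : ∀ f : LipB X, |F f - a| ≤ K' * ∫ x, |f.1 x - g x| ∂μ) : l1Extend μ F g = a := by
  have := l1Filter_neBot hg
  refine tendsto_nhds_unique (hF.tendsto_l1Extend hg) ?_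
  rw [tendsto_iff_dist_tendsto_zero]
  have := (tendsto_integral_l1Filter hg).const_mul K'
  rw [mul_zero] at this
  exact squeeze_zero (fun _ => dist_nonneg) (fun f => by simpa [Real.dist_eq] using h f) this

lemma l1Extend_coe (hF : IsL1Bounded μ K F) (f : LipB X) : l1Extend μ F f.1 = F f :=
  hF.l1Extend_eq_of_bound (LipB.integrable f μ) fun f' => hF.abs_sub_le f' f

lemma l1Extend_congr (hgg : g =ᵐ[μ] g') : l1Extend μ F g = l1Extend μ F g' := by
  have : l1Filter μ g = l1Filter μ g' := by
    unfold l1Filter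
    congr 1
    funext f
    refine lintegral_congr_ae ?_
    filter_upwards [hgg] with x hx
    rw [hx]
  rw [l1Extend, this, l1Extend]

lemma abs_l1Extend_le (hF : IsL1Bounded μ K F) (hg : Integrable g μ) :
    |l1Extend μ F g| ≤ K * ∫ x, |g x| ∂μ := by
  have h := hF.abs_sub_l1Extend_le hg 0
  simpa [hF.linear.map_zero] using h

lemma l1Extend_add (hF : IsL1Bounded μ K F) (hg : Integrable g μ) (hg' : Integrable g' μ) :
    l1Extend μ F (g + g') = l1Extend μ F g + l1Extend μ F g' := by
  refine tendsto_nhds_unique_of_frequently_eq (l := l1Filter μ g ×ˢ l1Filter μ g')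
    (f := fun q => F (q.1 + q.2)) (g := fun q => F q.1 + F q.2) ?_ ?_ ?_
  · refine (hF.tendsto_l1Extend (hg.add hg')).comp ?_
    rw [tendsto_l1Filter_iff (hg.add hg'), tendsto_comap_iff]
    have h := ((tendsto_integral_l1Filter hg).comp
      (tendsto_fst (f := l1Filter μ g) (g := l1Filter μ g'))).add
      ((tendsto_integral_l1Filter hg').comp tendsto_snd)
    rw [add_zero] at h
    refine squeeze_zero (fun _ => integral_nonneg fun _ => abs_nonneg _) (fun q => ?_) h
    simp only [Function.comp_apply]
    have h' := integral_add ((LipB.integrable q.1 μ).sub hg).abs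
      ((LipB.integrable q.2 μ).sub hg').abs
    simp only [Pi.sub_apply] at h'
    rw [← h']
    refine integral_mono ((LipB.integrable (q.1 + q.2) μ).sub (hg.add hg')).abs
      (((LipB.integrable q.1 μ).sub hg).abs.add ((LipB.integrable q.2 μ).sub hg').abs) fun x => ?_
    have : (q.1 + q.2).1 x - (g + g') x = (q.1.1 x - g x) + (q.2.1 x - g' x) := by
      simp; ring
    simp only [this]
    exact abs_add_le _ _
  · exact ((hF.tendsto_l1Extend hg).comp tendsto_fst).add
      ((hF.tendsto_l1Extend hg').comp tendsto_snd)
  · have := l1Filter_neBot hg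
    have := l1Filter_neBot hg'
    exact Frequently.of_forall fun q => hF.linear.map_add _ _

lemma l1Extend_smul (hF : IsL1Bounded μ K F) (hg : Integrable g μ) (c : ℝ) :
    l1Extend μ F (c • g) = c * l1Extend μ F g := by
  have := l1Filter_neBot hg
  refine tendsto_nhds_unique (f := fun q => F (c • q)) ?_
    (((hF.tendsto_l1Extend hg).const_mul c).congr fun q => (hF.linear.map_smul c q).symm)
  refine (hF.tendsto_l1Extend (hg.smul c)).comp ?_
  rw [tendsto_l1Filter_iff (hg.smul c), tendsto_comap_iff]
  have h := (tendsto_integral_l1Filter hg).const_mul |c|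
  rw [mul_zero] at h
  refine h.congr fun q => ?_
  simp only [Function.comp_apply]
  rw [← integral_const_mul]
  refine integral_congr_ae (ae_of_all _ fun x => ?_)
  simp [← mul_sub, abs_mul]

lemma l1Extend_sub (hF : IsL1Bounded μ K F) (hg : Integrable g μ) (hg' : Integrable g' μ) :
    l1Extend μ F (g - g') = l1Extend μ F g - l1Extend μ F g' := by
  have := hF.l1Extend_add hg (hg'.smul (-1 : ℝ))
  rw [hF.l1Extend_smul hg'] at this
  rw [show g - g' = g + (-1 : ℝ) • g' by ext; simp [sub_eq_add_neg], this]
  ring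

/-- The bound by a smaller measure passes to the extension. -/
lemma abs_l1Extend_le_of_le (hF : IsL1Bounded μ K F) (hg : Integrable g μ) {ν : Measure X}
    (hν : ν ≤ μ) {K' : ℝ} (h : ∀ f : LipB X, |F f| ≤ K' * ∫ x, |f.1 x| ∂ν) :
    |l1Extend μ F g| ≤ K' * ∫ x, |g x| ∂ν := by
  have := l1Filter_neBot hg
  have : IsFiniteMeasure ν := ⟨(hν Set.univ).trans_lt (measure_lt_top μ _)⟩
  have hgν : Integrable g ν := hg.mono_measure hν
  refine le_of_tendsto_of_tendsto' (hF.tendsto_l1Extend hg).abs (Tendsto.const_mul K' ?_) h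
  rw [tendsto_iff_dist_tendsto_zero]
  refine squeeze_zero (fun _ => dist_nonneg) (fun f => ?_) (tendsto_integral_l1Filter hg)
  rw [Real.dist_eq, ← integral_sub (LipB.integrable f ν).abs hgν.abs]
  refine (abs_integral_le_integral_abs).trans ?_
  refine (integral_mono ((LipB.integrable f ν).abs.sub hgν.abs).abs
    ((LipB.integrable f ν).sub hgν).abs
    fun x => abs_abs_sub_abs_le_abs_sub _ _).trans ?_
  exact integral_mono_measure hν (ae_of_all _ fun _ => abs_nonneg _)
    ((LipB.integrable f μ).sub hg).abs

end IsL1Bounded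

end Extension

end MetricCurrents

end

noncomputable section

namespace MetricCurrents

/-! ### Existence of the minimal mass measure. -/

section MinimalMeasure

variable {X : Type*} [MeasurableSpace X]

/-- All measures have densities with respect to the largest one, `u 0`. The limit has the infimum of
the densities, and monotone convergence from above applies because integrals against `u 0` are
finite. -/
lemma exists_limit_of_antitone {u : ℕ → Measure X} [∀ n, IsFiniteMeasure (u n)]
    (hu : Antitone u) :
    ∃ ν : Measure X, (∀ n, ν ≤ u n) ∧ ∀ g : X → ℝ≥0∞, Measurable g → ∫⁻ x, g x ∂(u 0) ≠ ∞ →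
      ∫⁻ x, g x ∂ν = ⨅ n, ∫⁻ x, g x ∂(u n) := by
  set d : ℕ → X → ℝ≥0∞ := fun n => (u n).rnDeriv (u 0)
  have hd : ∀ n, Measurable (d n) := fun n => Measure.measurable_rnDeriv _ _
  have hwd : ∀ n, (u 0).withDensity (d n) = u n := fun n =>
    Measure.withDensity_rnDeriv_eq _ _ (Measure.absolutelyContinuous_of_le (hu (Nat.zero_le n)))
  have hdm : ∀ n, d n.succ ≤ᵐ[u 0] d n := fun n => by
    refine ae_le_of_forall_setLIntegral_le_of_sigmaFinite (hd _) fun s hs _ => ?_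
    rw [← withDensity_apply _ hs, ← withDensity_apply _ hs, hwd, hwd]
    exact hu n.le_succ s
  have hD : Measurable fun x => ⨅ n, d n x := Measurable.iInf hd
  have key : ∀ g : X → ℝ≥0∞, Measurable g → ∫⁻ x, g x ∂(u 0) ≠ ∞ →
      ∫⁻ x, g x ∂((u 0).withDensity fun x => ⨅ n, d n x) = ⨅ n, ∫⁻ x, g x ∂(u n) := by
    intro g hg hfin
    have hgd : ∀ n, ∫⁻ x, g x ∂(u n) = ∫⁻ x, d n x * g x ∂(u 0) := fun n => by
      conv_lhs => rw [← hwd n]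
      exact lintegral_withDensity_eq_lintegral_mul _ (hd n) hg
    have hfin' : ∫⁻ x, d 0 x * g x ∂(u 0) ≠ ∞ := by rwa [← hgd]
    rw [lintegral_withDensity_eq_lintegral_mul _ hD hg]
    simp_rw [hgd]
    have h := lintegral_iInf_ae (μ := u 0) (f := fun n x => d n x * g x)
      (fun n => (hd n).mul hg) (fun n => (hdm n).mono fun x hx => mul_le_mul_left hx _) hfin'
    rw [← h]
    refine lintegral_congr_ae ?_
    filter_upwards [ae_lt_top hg hfin] with x hx
    exact ENNReal.iInf_mul fun h => absurd h hx.ne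
  refine ⟨_, fun n => ?_, key⟩
  refine Measure.le_iff.2 fun s hs => ?_
  rw [withDensity_apply _ hs, ← hwd n, withDensity_apply _ hs]
  exact lintegral_mono fun x => iInf_le _ n

lemma eq_of_le_of_univ_le {μ ν : Measure X} [IsFiniteMeasure ν] (h : μ ≤ ν)
    (huniv : ν Set.univ ≤ μ Set.univ) : μ = ν := by
  have : IsFiniteMeasure μ := ⟨(h Set.univ).trans_lt (measure_lt_top ν _)⟩
  refine Measure.ext fun s hs => le_antisymm (h s) ?_
  have h1 := measure_add_measure_compl (μ := μ) hs
  have h2 := measure_add_measure_compl (μ := ν) hs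
  have h3 : ν s + μ sᶜ ≤ μ s + μ sᶜ := by
    calc ν s + μ sᶜ ≤ ν s + ν sᶜ := by gcongr
      _ ≤ _ := by rw [h1, h2]; exact huniv
  exact (ENNReal.add_le_add_iff_right (measure_ne_top μ _)).1 h3

/-- A family of finite measures that is directed downwards and closed under decreasing limits
contains its infimum. -/
lemma sInf_mem_of_directed {S : Set (Measure X)} (hne : S.Nonempty)
    (hfin : ∀ μ ∈ S, IsFiniteMeasure μ)
    (hdir : ∀ μ ∈ S, ∀ ν ∈ S, ∃ ρ ∈ S, ρ ≤ μ ∧ ρ ≤ ν)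
    (hlim : ∀ (u : ℕ → Measure X) (ν : Measure X), (∀ n, u n ∈ S) → (∀ n, ν ≤ u n) →
      (∀ g : X → ℝ≥0∞, Measurable g → ∫⁻ x, g x ∂(u 0) ≠ ∞ →
        ∫⁻ x, g x ∂ν = ⨅ n, ∫⁻ x, g x ∂(u n)) → ν ∈ S) : sInf S ∈ S := by
  set m := sInf ((fun μ : Measure X => μ Set.univ) '' S) with hm
  -- Minimise the total mass over S; directedness turns the minimising sequence into a decreasing
  -- one.
  obtain ⟨v, -, hv, hvS⟩ := exists_seq_tendsto_sInf (hne.image fun μ : Measure X => μ Set.univ)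
    (OrderBot.bddBelow _)
  choose w hwS hwv using hvS
  choose! i hiS hil hir using hdir
  let u : ℕ → S := fun n => Nat.rec ⟨w 0, hwS 0⟩
    (fun n μ => ⟨i μ.1 (w (n + 1)), hiS _ μ.2 _ (hwS _)⟩) n
  have hu : Antitone fun n => (u n).1 :=
    antitone_nat_of_succ_le fun n => hil _ (u n).2 _ (hwS _)
  have huw : ∀ n, (u n).1 ≤ w n := fun n => by
    cases n with
    | zero => exact le_rfl
    | succ n => exact hir _ (u n).2 _ (hwS _)
  have : ∀ n, IsFiniteMeasure (u n).1 := fun n => hfin _ (u n).2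
  obtain ⟨ν, hνu, hν⟩ := exists_limit_of_antitone hu
  have hνS : ν ∈ S := hlim (fun n => (u n).1) ν (fun n => (u n).2) hνu hν
  have := hfin ν hνS
  have hνm : ν Set.univ ≤ m := by
    refine ge_of_tendsto' hv fun n => ?_
    rw [← hwv n]
    exact (hνu n _).trans (huw n _)
  -- A common lower bound of ν and μ in S lies below ν and has at least the minimal total mass, so
  -- it equals ν.
  have hmin : ∀ μ ∈ S, ν ≤ μ := by
    intro μ hμ
    have hρ := hiS ν hνS μ hμ
    have h1 := eq_of_le_of_univ_le (hil ν hνS μ hμ)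
      (hνm.trans (sInf_le (Set.mem_image_of_mem _ hρ)))
    rw [← h1]
    exact hir ν hνS μ hμ
  have : sInf S = ν := le_antisymm (sInf_le hνS) (le_sInf hmin)
  rwa [this]

end MinimalMeasure

section MassMeasure

variable {X : Type*} [MetricSpace X] [MeasurableSpace X] [BorelSpace X] {k : ℕ}
  {T : MetricFunctional X k} {μ ν : Measure X}

/-- The product of the Lipschitz constants of a tuple of functions. -/
def lipProd (π : Fin k → Lip X) : ℝ≥0 := ∏ i, lipReal (π i)

lemma massBound_apply_iff [IsFiniteMeasure μ] (f : LipB X) (π : Fin k → Lip X) (a : ℝ) :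
    ENNReal.ofReal |a| ≤ (∏ i, lipConst (π i).1) * ∫⁻ x, ENNReal.ofReal |f.1 x| ∂μ ↔
      |a| ≤ lipProd π * ∫ x, |f.1 x| ∂μ := by
  have h1 : (∏ i, lipConst (π i).1) = ENNReal.ofReal (lipProd π) := by
    rw [lipProd, ENNReal.ofReal_coe_nnreal, ENNReal.ofNNReal_finsetProd]
    exact Finset.prod_congr rfl fun i _ => (coe_lipReal _).symm
  rw [h1, lintegral_ofReal_abs_eq (LipB.integrable f μ), ← ENNReal.ofReal_mul (NNReal.coe_nonneg _),
    ENNReal.ofReal_le_ofReal_iff]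
  exact mul_nonneg (NNReal.coe_nonneg _) (integral_nonneg fun _ => abs_nonneg _)

lemma massBound_iff [IsFiniteMeasure μ] :
    MassBound T μ ↔ ∀ f π, |T f π| ≤ lipProd π * ∫ x, |f.1 x| ∂μ :=
  forall₂_congr fun f π => massBound_apply_iff f π (T f π)

lemma MassBound.isL1Bounded [IsFiniteMeasure μ] (h : MassBound T μ)
    (hlin : ∀ π : Fin k → Lip X, IsLinearMap ℝ fun f : LipB X => T f π) (π : Fin k → Lip X) :
    IsL1Bounded μ (lipProd π) fun f => T f π :=
  ⟨hlin π, NNReal.coe_nonneg _, fun f => massBound_iff.1 h f π⟩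

/-- By Hahn decomposition let `s` be a set on whose subsets ν ≤ μ, and glue ν on `s` to μ on the
complement. The glued measure is admissible because T(f, π) splits into its parts on `s` and `sᶜ`,
each estimated by its own measure. -/
lemma MassBound.exists_le_le [IsFiniteMeasure μ] [IsFiniteMeasure ν] (hμ : MassBound T μ)
    (hν : MassBound T ν) (hlin : ∀ π : Fin k → Lip X, IsLinearMap ℝ fun f : LipB X => T f π) :
    ∃ ρ : Measure X, (IsFiniteMeasure ρ ∧ MassBound T ρ) ∧ ρ ≤ μ ∧ ρ ≤ ν := by
  obtain ⟨s, hs, hs1, hs2⟩ := hahn_decomposition μ ν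
  have hres : ∀ {ρ σ : Measure X} {t : Set X}, MeasurableSet t →
      (∀ r, MeasurableSet r → r ⊆ t → ρ r ≤ σ r) → ρ.restrict t ≤ σ.restrict t := by
    intro ρ σ t ht h
    refine Measure.le_iff.2 fun r hr => ?_
    rw [Measure.restrict_apply hr, Measure.restrict_apply hr]
    exact h _ (hr.inter ht) Set.inter_subset_right
  refine ⟨ν.restrict s + μ.restrict sᶜ, ⟨inferInstance, ?_⟩, ?_, ?_⟩
  · rw [massBound_iff]
    intro f π
    -- Cutting f along `s` leaves `Lip_b`, so T is extended to L¹(μ + ν), where both estimates are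
    -- available.
    have hsum : MassBound T (μ + ν) := by
      rw [massBound_iff] at hμ ⊢
      intro f π
      refine (hμ f π).trans (mul_le_mul_of_nonneg_left ?_ (NNReal.coe_nonneg _))
      exact integral_mono_measure (Measure.le_add_right le_rfl)
        (ae_of_all _ fun _ => abs_nonneg _) (LipB.integrable f (μ + ν)).abs
    have hF := hsum.isL1Bounded hlin π
    have hf := LipB.integrable f (μ + ν)
    have hi : ∀ {t : Set X}, MeasurableSet t → Integrable (t.indicator f.1) (μ + ν) :=
      fun ht => hf.indicator ht
    have heq : T f π = l1Extend (μ + ν) (fun f => T f π) (s.indicator f.1) +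
        l1Extend (μ + ν) (fun f => T f π) (sᶜ.indicator f.1) := by
      rw [← hF.l1Extend_add (hi hs) (hi hs.compl), Set.indicator_self_add_compl, hF.l1Extend_coe]
    have hind : ∀ (t : Set X) (x : X), |t.indicator f.1 x| = t.indicator (fun x => |f.1 x|) x := by
      intro t x
      by_cases hx : x ∈ t <;> simp [hx]
    have h1 := hF.abs_l1Extend_le_of_le (hi hs) (ν := ν) (Measure.le_add_left le_rfl)
      (fun f => massBound_iff.1 hν f π)
    have h2 := hF.abs_l1Extend_le_of_le (hi hs.compl) (ν := μ) (Measure.le_add_right le_rfl)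
      (fun f => massBound_iff.1 hμ f π)
    simp only [hind] at h1 h2
    rw [integral_indicator hs] at h1
    rw [integral_indicator hs.compl] at h2
    rw [integral_add_measure (LipB.integrable f _).abs (LipB.integrable f _).abs, mul_add, heq]
    exact (abs_add_le _ _).trans (add_le_add h1 h2)
  · calc ν.restrict s + μ.restrict sᶜ ≤ μ.restrict s + μ.restrict sᶜ :=
          add_le_add_left (hres hs hs1) _
      _ = μ := Measure.restrict_add_restrict_compl hs
  · calc ν.restrict s + μ.restrict sᶜ ≤ ν.restrict s + ν.restrict sᶜ :=
          add_le_add_right (hres hs.compl hs2) _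
      _ = ν := Measure.restrict_add_restrict_compl hs

namespace IsMetricCurrent

/-- The mass measure is itself a finite measure with the mass bound. -/
lemma massMeasure_mem (hT : IsMetricCurrent T) :
    massMeasure T ∈ {μ : Measure X | IsFiniteMeasure μ ∧ MassBound T μ} := by
  refine sInf_mem_of_directed hT.finite_mass (fun μ hμ => hμ.1) ?_ ?_
  · rintro μ ⟨hμ, hμ'⟩ ν ⟨hν, hν'⟩
    exact hμ'.exists_le_le hν' hT.linear_left
  · intro u ν hu hνu hν
    have := (hu 0).1
    refine ⟨⟨(hνu 0 Set.univ).trans_lt (measure_lt_top _ _)⟩, fun f π => ?_⟩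
    have h := hν (fun x => ENNReal.ofReal |f.1 x|)
      (ENNReal.measurable_ofReal.comp (LipB.continuous f).abs.measurable)
      (by rw [lintegral_ofReal_abs_eq (LipB.integrable f _)]; exact ENNReal.ofReal_ne_top)
    have htop : (∏ i, lipConst (π i).1) ≠ ∞ :=
      ENNReal.prod_ne_top fun i _ => lipConst_ne_top (π i).2
    rw [h, ENNReal.mul_iInf fun h => absurd h htop]
    exact le_iInf fun n => (hu n).2 f π

lemma isFiniteMeasure (hT : IsMetricCurrent T) : IsFiniteMeasure (massMeasure T) :=
  hT.massMeasure_mem.1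

lemma massBound (hT : IsMetricCurrent T) : MassBound T (massMeasure T) :=
  hT.massMeasure_mem.2

end IsMetricCurrent

lemma massMeasure_le [IsFiniteMeasure μ] (h : MassBound T μ) : massMeasure T ≤ μ :=
  sInf_le ⟨inferInstance, h⟩

end MassMeasure

end MetricCurrents

end

noncomputable section

namespace MetricCurrents

/-! ### Calculus of currents with integrable first argument; sharpened locality. -/

section LipschitzAlgebra

variable {X : Type*} [MetricSpace X]

lemma lipschitzWith_mul_of_bounded {f g : X → ℝ} {K L C D : ℝ≥0} (hf : LipschitzWith K f)
    (hg : LipschitzWith L g) (hC : ∀ x, |f x| ≤ C) (hD : ∀ x, |g x| ≤ D) :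
    LipschitzWith (C * L + D * K) fun x => f x * g x := by
  refine LipschitzWith.of_dist_le_mul fun x y => ?_
  have h1 := hf.dist_le_mul x y
  have h2 := hg.dist_le_mul x y
  rw [Real.dist_eq] at h1 h2 ⊢
  have : f x * g x - f y * g y = f x * (g x - g y) + g y * (f x - f y) := by ring
  rw [this]
  calc _ ≤ |f x| * |g x - g y| + |g y| * |f x - f y| := by
        rw [← abs_mul, ← abs_mul]; exact abs_add_le _ _
    _ ≤ C * (L * dist x y) + D * (K * dist x y) := by
        gcongr
        · exact hC x
        · exact hD y
    _ = _ := by push_cast; ring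

/-- The product of two bounded Lipschitz functions. -/
def mulB (f g : LipB X) : LipB X :=
  ⟨fun x => f.1 x * g.1 x, by
    obtain ⟨K, hK⟩ := f.2.1
    obtain ⟨L, hL⟩ := g.2.1
    obtain ⟨C, hC0, hC⟩ := LipB.exists_bound f
    obtain ⟨D, hD0, hD⟩ := LipB.exists_bound g
    exact ⟨_, lipschitzWith_mul_of_bounded (C := ⟨C, hC0⟩) (D := ⟨D, hD0⟩) hK hL hC hD⟩, by
    obtain ⟨C, hC0, hC⟩ := LipB.exists_bound f
    obtain ⟨D, hD0, hD⟩ := LipB.exists_bound g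
    exact ⟨C * D, fun x => by rw [abs_mul]; gcongr; exacts [hC x, hD x]⟩⟩

/-- A constant, as a Lipschitz function. -/
def lipConstFun (X : Type*) [MetricSpace X] (c : ℝ) : Lip X :=
  ⟨fun _ => c, 0, LipschitzWith.const c⟩

lemma abs_max_min_le (M : ℝ) (hM : 0 ≤ M) (u : ℝ) : |max (-M) (min u M)| ≤ M :=
  abs_le.2 ⟨le_max_left _ _, max_le (by linarith) (min_le_right _ _)⟩

lemma max_min_eq_self {M u : ℝ} (h : |u| ≤ M) : max (-M) (min u M) = u := by
  rw [min_eq_left (abs_le.1 h).2, max_eq_right (abs_le.1 h).1]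

lemma abs_max_min_le_abs (M : ℝ) (hM : 0 ≤ M) (u : ℝ) : |max (-M) (min u M)| ≤ |u| := by
  rcases le_total |u| M with h | h
  · rw [max_min_eq_self h]
  · exact (abs_max_min_le M hM u).trans h

/-- The truncation of a Lipschitz function to values in `[-M, M]`. -/
def truncate (M : ℝ) (p : Lip X) : LipB X :=
  ⟨fun x => max (-M) (min (p.1 x) M),
    ⟨_, ((lipschitzWith_lipReal p).min_const M).const_max (-M)⟩, |M|, fun x => by
      rw [abs_le]
      constructor
      · exact (neg_le_neg (le_abs_self M)).trans (le_max_left _ _)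
      · exact max_le (neg_le_abs M) ((min_le_right _ _).trans (le_abs_self M))⟩

lemma lipschitzWith_truncate {p : Lip X} {K : ℝ≥0} (h : LipschitzWith K p.1) (M : ℝ) :
    LipschitzWith K (truncate M p).1 := (h.min_const M).const_max (-M)

lemma exists_common_lip {k : ℕ} (π : Fin k → Lip X) :
    ∃ C : ℝ≥0, ∀ i, LipschitzWith C (π i).1 :=
  ⟨∑ i, lipReal (π i), fun i => (lipschitzWith_lipReal (π i)).weaken
    (Finset.single_le_sum (f := fun i => lipReal (π i)) (fun _ _ => zero_le)
      (Finset.mem_univ i))⟩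

lemma lipProd_le {k : ℕ} {π : Fin k → Lip X} {C : Fin k → ℝ≥0}
    (h : ∀ i, LipschitzWith (C i) (π i).1) : lipProd π ≤ ∏ i, C i :=
  Finset.prod_le_prod' fun i _ => lipReal_le (h i)

lemma lipProd_le_pow {k : ℕ} {π : Fin k → Lip X} {C : ℝ≥0}
    (h : ∀ i, LipschitzWith C (π i).1) : lipProd π ≤ C ^ k := by
  simpa using lipProd_le (C := fun _ => C) h

end LipschitzAlgebra

namespace IsMetricCurrent

variable {X : Type*} [MetricSpace X] [MeasurableSpace X] [BorelSpace X] {k : ℕ}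
  {T : MetricFunctional X k}

lemma isL1Bounded (hT : IsMetricCurrent T) (π : Fin k → Lip X) :
    IsL1Bounded (massMeasure T) (lipProd π) fun f => T f π :=
  have := hT.isFiniteMeasure
  hT.massBound.isL1Bounded hT.linear_left π

variable {g g' : X → ℝ} {π : Fin k → Lip X}

lemma extend_coe (hT : IsMetricCurrent T) (f : LipB X) (π : Fin k → Lip X) :
    extend T f.1 π = T f π :=
  have := hT.isFiniteMeasure
  (hT.isL1Bounded π).l1Extend_coe f

lemma extend_congr (hT : IsMetricCurrent T) (h : g =ᵐ[massMeasure T] g') (π : Fin k → Lip X) :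
    extend T g π = extend T g' π :=
  have := hT.isFiniteMeasure
  IsL1Bounded.l1Extend_congr h

lemma extend_add (hT : IsMetricCurrent T) (hg : Integrable g (massMeasure T))
    (hg' : Integrable g' (massMeasure T)) (π : Fin k → Lip X) :
    extend T (g + g') π = extend T g π + extend T g' π :=
  have := hT.isFiniteMeasure
  (hT.isL1Bounded π).l1Extend_add hg hg'

lemma extend_sub (hT : IsMetricCurrent T) (hg : Integrable g (massMeasure T))
    (hg' : Integrable g' (massMeasure T)) (π : Fin k → Lip X) :
    extend T (g - g') π = extend T g π - extend T g' π :=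
  have := hT.isFiniteMeasure
  (hT.isL1Bounded π).l1Extend_sub hg hg'

lemma extend_smul (hT : IsMetricCurrent T) (hg : Integrable g (massMeasure T)) (c : ℝ)
    (π : Fin k → Lip X) : extend T (c • g) π = c * extend T g π :=
  have := hT.isFiniteMeasure
  (hT.isL1Bounded π).l1Extend_smul hg c

lemma extend_zero (hT : IsMetricCurrent T) (π : Fin k → Lip X) : extend T 0 π = 0 := by
  have := hT.extend_smul (g := 0) (integrable_zero _ _ _) 0 π
  simpa using this

lemma abs_extend_le (hT : IsMetricCurrent T) (hg : Integrable g (massMeasure T))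
    (π : Fin k → Lip X) : |extend T g π| ≤ lipProd π * ∫ x, |g x| ∂(massMeasure T) :=
  have := hT.isFiniteMeasure
  (hT.isL1Bounded π).abs_l1Extend_le hg

lemma abs_extend_le_pow (hT : IsMetricCurrent T) (hg : Integrable g (massMeasure T)) {C : ℝ≥0}
    (h : ∀ i, LipschitzWith C (π i).1) :
    |extend T g π| ≤ C ^ k * ∫ x, |g x| ∂(massMeasure T) :=
  (hT.abs_extend_le hg π).trans (mul_le_mul_of_nonneg_right (by exact_mod_cast lipProd_le_pow h)
    (integral_nonneg fun _ => abs_nonneg _))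

lemma tendsto_extend_l1 (hT : IsMetricCurrent T) (hg : Integrable g (massMeasure T))
    (π : Fin k → Lip X) :
    Tendsto (fun f => T f π) (l1Filter (massMeasure T) g) (𝓝 (extend T g π)) :=
  have := hT.isFiniteMeasure
  (hT.isL1Bounded π).tendsto_l1Extend hg

lemma extend_linear_right (hT : IsMetricCurrent T) (hg : Integrable g (massMeasure T))
    (π : Fin k → Lip X) (i : Fin k) :
    IsLinearMap ℝ fun p : Lip X => extend T g (Function.update π i p) := by
  have := hT.isFiniteMeasure
  have := l1Filter_neBot hg
  constructor
  · intro p q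
    exact tendsto_nhds_unique (hT.tendsto_extend_l1 hg _)
      (((hT.tendsto_extend_l1 hg _).add (hT.tendsto_extend_l1 hg _)).congr
        fun f => ((hT.linear_right f π i).map_add p q).symm)
  · intro c p
    exact tendsto_nhds_unique (hT.tendsto_extend_l1 hg _)
      (((hT.tendsto_extend_l1 hg _).const_mul c).congr
        fun f => ((hT.linear_right f π i).map_smul c p).symm)

lemma abs_sub_extend_le (hT : IsMetricCurrent T) (hg : Integrable g (massMeasure T))
    (hg' : Integrable g' (massMeasure T)) {C : ℝ≥0} (h : ∀ i, LipschitzWith C (π i).1) :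
    |extend T g π - extend T g' π| ≤ C ^ k * ∫ x, |g x - g' x| ∂(massMeasure T) := by
  rw [← hT.extend_sub hg hg']
  exact hT.abs_extend_le_pow (hg.sub hg') h

/-- The continuity axiom passes to integrable first arguments. -/
lemma tendsto_extend_right (hT : IsMetricCurrent T) (hg : Integrable g (massMeasure T))
    {ρ : ℕ → Fin k → Lip X} {C : ℝ≥0} (hC : ∀ n i, LipschitzWith C (ρ n i).1)
    (hρ : ∀ i x, Tendsto (fun n => (ρ n i).1 x) atTop (𝓝 ((π i).1 x))) :
    Tendsto (fun n => extend T g (ρ n)) atTop (𝓝 (extend T g π)) := by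
  have := hT.isFiniteMeasure
  obtain ⟨D, hD⟩ := exists_common_lip π
  set M := max C D with hM
  rw [Metric.tendsto_atTop]
  intro ε hε
  have hK : 0 < (M : ℝ) ^ k + 1 := by positivity
  -- An ε/4 argument: extension error at `ρ n` and at `π`, plus the continuity axiom for f. The
  -- summand 1 keeps the denominator positive when M vanishes.
  obtain ⟨f, hf⟩ := exists_lipB_integral_le (massMeasure T) hg
    (show 0 < ε / (4 * ((M : ℝ) ^ k + 1)) by positivity)
  have hf' : (M : ℝ) ^ k * ∫ x, |f.1 x - g x| ∂(massMeasure T) ≤ ε / 4 := by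
    calc _ ≤ ((M : ℝ) ^ k + 1) * (ε / (4 * ((M : ℝ) ^ k + 1))) := by
          gcongr
          linarith
      _ = ε / 4 := by field_simp
  have hsub : ∀ π' : Fin k → Lip X, (∀ i, LipschitzWith M (π' i).1) →
      |T f π' - extend T g π'| ≤ ε / 4 := fun π' h' => by
    rw [← hT.extend_coe]
    exact (hT.abs_sub_extend_le (LipB.integrable f _) hg h').trans hf'
  obtain ⟨N, hN⟩ := Metric.tendsto_atTop.1 (hT.continuity f π ρ ⟨C, hC⟩ hρ) (ε / 4) (by positivity)
  refine ⟨N, fun n hn => ?_⟩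
  have h1 := hsub (ρ n) fun i => (hC n i).weaken (le_max_left _ _)
  have h2 := hsub π fun i => (hD i).weaken (le_max_right _ _)
  have h3 := hN n hn
  rw [Real.dist_eq] at h3 ⊢
  rw [abs_lt] at h3 ⊢
  rw [abs_le] at h1 h2
  constructor <;> linarith [h1.1, h1.2, h2.1, h2.2, h3.1, h3.2]

lemma tendsto_extend_of_tendsto_integral (hT : IsMetricCurrent T)
    (hg : Integrable g (massMeasure T)) {w : ℕ → X → ℝ}
    (hw : ∀ n, Integrable (w n) (massMeasure T))
    (hwg : Tendsto (fun n => ∫ x, |w n x - g x| ∂(massMeasure T)) atTop (𝓝 0))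
    {ρ : ℕ → Fin k → Lip X} {C : ℝ≥0} (hC : ∀ n i, LipschitzWith C (ρ n i).1)
    (hρ : ∀ i x, Tendsto (fun n => (ρ n i).1 x) atTop (𝓝 ((π i).1 x))) :
    Tendsto (fun n => extend T (w n) (ρ n)) atTop (𝓝 (extend T g π)) := by
  have h1 := hT.tendsto_extend_right hg hC hρ
  have h2 : Tendsto (fun n => extend T (w n) (ρ n) - extend T g (ρ n)) atTop (𝓝 0) := by
    rw [tendsto_zero_iff_abs_tendsto_zero]
    refine squeeze_zero (fun _ => abs_nonneg _)
      (fun n => hT.abs_sub_extend_le (hw n) hg (hC n)) ?_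
    simpa using hwg.const_mul ((C : ℝ) ^ k)
  simpa using h2.add h1

/-- Joint continuity for dominated sequences of first arguments. -/
lemma tendsto_extend (hT : IsMetricCurrent T) {w : ℕ → X → ℝ} {M : ℝ}
    (hw : ∀ n, AEStronglyMeasurable (w n) (massMeasure T))
    (hM : ∀ n, ∀ᵐ x ∂(massMeasure T), |w n x| ≤ M)
    (hwg : ∀ᵐ x ∂(massMeasure T), Tendsto (fun n => w n x) atTop (𝓝 (g x)))
    {ρ : ℕ → Fin k → Lip X} {C : ℝ≥0} (hC : ∀ n i, LipschitzWith C (ρ n i).1)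
    (hρ : ∀ i x, Tendsto (fun n => (ρ n i).1 x) atTop (𝓝 ((π i).1 x))) :
    Tendsto (fun n => extend T (w n) (ρ n)) atTop (𝓝 (extend T g π)) := by
  have := hT.isFiniteMeasure
  have hgm : AEStronglyMeasurable g (massMeasure T) := aestronglyMeasurable_of_tendsto_ae _ hw hwg
  have hgM : ∀ᵐ x ∂(massMeasure T), |g x| ≤ M := by
    filter_upwards [hwg, ae_all_iff.2 hM] with x hx hx'
    exact le_of_tendsto' hx.abs hx'
  have hgi : Integrable g (massMeasure T) := Integrable.of_bound hgm M hgM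
  refine hT.tendsto_extend_of_tendsto_integral hgi (fun n => Integrable.of_bound (hw n) M (hM n))
    ?_ hC hρ
  have := tendsto_integral_of_dominated_convergence (μ := massMeasure T)
    (F := fun n x => |w n x - g x|) (f := fun _ => 0) (fun _ => 2 * M)
    (fun n => ((hw n).sub hgm).norm) (integrable_const _) (fun n => ?_) ?_
  · simpa using this
  · filter_upwards [hM n, hgM] with x h1 h2
    rw [Real.norm_eq_abs, abs_abs]
    exact (abs_sub _ _).trans (by linarith)
  · filter_upwards [hwg] with x hx
    simpa using (hx.sub_const (g x)).abs

/-- Locality for integrable first arguments: it suffices that some `πᵢ` is constant on the set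
`{g ≠ 0}` itself. -/
lemma extend_eq_zero (hT : IsMetricCurrent T) (hg : Integrable g (massMeasure T))
    (π : Fin k → Lip X) (i : Fin k) (c : ℝ) (h : ∀ x, g x ≠ 0 → (π i).1 x = c) :
    extend T g π = 0 := by
  have := hT.isFiniteMeasure
  set E : Set X := {x | (π i).1 x = c} with hE
  have hEc : IsClosed E := isClosed_eq (Lip.continuous (π i)) continuous_const
  obtain ⟨K, hK⟩ := exists_common_lip π
  have key : ∀ f : LipB X, extend T (E.indicator f.1) π = 0 := by
    intro f
    obtain ⟨D, hD0, hD⟩ := LipB.exists_bound f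
    -- Subtracting the truncation flattens `π i` to the constant c where |π_i − c| ≤ ε. It moves `π
    -- i` by at most ε and keeps the Lipschitz constant below 2K.
    set p : ℝ → Lip X := fun ε =>
      π i - lipBToLip (truncate ε (π i - lipConstFun X c)) with hp
    have hpK : ∀ ε, LipschitzWith (K + K) (p ε).1 := fun ε => by
      refine (hK i).sub (lipschitzWith_truncate (K := K) ?_ ε)
      exact ((hK i).sub (LipschitzWith.const c)).weaken (by simp)
    have hupd : ∀ ε j, LipschitzWith (K + K) (Function.update π i (p ε) j).1 := fun ε j => by
      rcases eq_or_ne j i with rfl | hj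
      · simpa using hpK ε
      · simpa [hj] using (hK j).weaken (by simp)
    -- A cut-off of width 1/(m+1) around E lives where |π_i − c| ≤ K/(m+1). Once this is less than
    -- ε, the locality axiom applies to the flattened function; then m → ∞.
    have hzero : ∀ ε > 0, extend T (E.indicator f.1) (Function.update π i (p ε)) = 0 := by
      intro ε hε
      have hlim := hT.tendsto_extend (M := D) (g := E.indicator f.1)
        (w := fun m => (mulB f (cutoff E (1 / ((m : ℝ) + 1)) Nat.one_div_pos_of_nat)).1)
        (π := Function.update π i (p ε)) (ρ := fun _ => Function.update π i (p ε))
        (fun n => (LipB.continuous _).aestronglyMeasurable)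
        (fun n => ae_of_all _ fun x => ?_) (ae_of_all _ fun x => ?_) (fun _ => hupd ε)
        (fun _ _ => tendsto_const_nhds)
      · refine tendsto_nhds_unique hlim (tendsto_const_nhds.congr' ?_)
        have hK' : Tendsto (fun m : ℕ => (K : ℝ) * (1 / ((m : ℝ) + 1))) atTop (𝓝 0) := by
          simpa using tendsto_one_div_add_atTop_nhds_zero_nat.const_mul (K : ℝ)
        filter_upwards [hK'.eventually_lt_const hε] with m hm
        rw [hT.extend_coe]
        refine (hT.locality _ _ i ⟨{x | |(π i).1 x - c| < ε}, ?_, c, ?_⟩).symm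
        · refine (isOpen_lt ((Lip.continuous (π i)).sub continuous_const).abs
            continuous_const).mem_nhdsSet.2 fun x hx => ?_
          have hx' : x ∈ Metric.thickening (1 / ((m : ℝ) + 1)) E := by
            by_contra hcon
            exact hx (by simp only [mulB, cutoff_eq_zero _ hcon, mul_zero])
          obtain ⟨e, he, hxe⟩ := Metric.mem_thickening_iff.1 hx'
          have h1 := (hK i).dist_le_mul x e
          rw [show (π i).1 e = c from he, Real.dist_eq] at h1
          calc _ ≤ _ := h1
            _ ≤ K * (1 / ((m : ℝ) + 1)) := by gcongr
            _ < ε := hm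
        · intro x hx
          have : (truncate ε (π i - lipConstFun X c)).1 x = (π i).1 x - c :=
            max_min_eq_self (le_of_lt hx)
          simp [hp, lipBToLip, this]
      · simp only [mulB, abs_mul, abs_of_nonneg (cutoff_nonneg E _ x)]
        exact (mul_le_of_le_one_right (abs_nonneg _) (cutoff_le_one E _ x)).trans (hD x)
      · have := (tendsto_cutoff hEc x).const_mul (f.1 x)
        have h3 : f.1 x * E.indicator (fun _ => 1) x = E.indicator f.1 x := by
          by_cases hx : x ∈ E <;> simp [hx]
        rw [h3] at this
        exact this
    -- Now the width ε of the flattening tends to 0, with uniform Lipschitz bounds.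
    have hlim := hT.tendsto_extend_right (π := π) (C := K + K)
      (ρ := fun n : ℕ => Function.update π i (p (1 / ((n : ℝ) + 1))))
      ((LipB.integrable f _).indicator hEc.measurableSet)
      (fun n => hupd _) (fun j x => ?_)
    · refine tendsto_nhds_unique hlim (tendsto_const_nhds.congr fun n => (hzero _ ?_).symm)
      exact Nat.one_div_pos_of_nat
    · rcases eq_or_ne j i with rfl | hj
      · simp only [Function.update_self]
        rw [tendsto_iff_dist_tendsto_zero]
        refine squeeze_zero (fun _ => dist_nonneg) (fun n => ?_)
          tendsto_one_div_add_atTop_nhds_zero_nat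
        rw [Real.dist_eq]
        have h1 := abs_max_min_le (1 / ((n : ℝ) + 1)) (by positivity) ((π j).1 x - c)
        rw [← abs_neg] at h1
        refine le_trans (le_of_eq ?_) h1
        congr 1
        simp [hp, lipBToLip, truncate, lipConstFun]
      · simp [hj]
  have hgE : g = E.indicator g := by
    ext x
    by_cases hx : g x = 0
    · by_cases hxE : x ∈ E <;> simp [hxE, hx]
    · exact (Set.indicator_of_mem (show x ∈ E from h x hx) g).symm
  by_contra hne
  have hpos : 0 < |extend T g π| := abs_pos.2 hne
  obtain ⟨f, hf⟩ := exists_lipB_integral_le (massMeasure T) hg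
    (show 0 < |extend T g π| / (2 * ((K : ℝ) ^ k + 1)) by positivity)
  have h1 := hT.abs_sub_extend_le (hg.indicator hEc.measurableSet)
    ((LipB.integrable f _).indicator hEc.measurableSet) hK
  rw [key f, sub_zero, ← hgE] at h1
  -- Since g vanishes off E, restricting the approximant f to E does not increase its distance to g.
  have h2 : ∫ x, |g x - E.indicator f.1 x| ∂(massMeasure T) ≤
      ∫ x, |f.1 x - g x| ∂(massMeasure T) := by
    refine integral_mono (hg.sub ((LipB.integrable f _).indicator hEc.measurableSet)).abs
      ((LipB.integrable f _).sub hg).abs fun x => ?_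
    simp only
    rw [hgE]
    by_cases hx : x ∈ E
    · simp [hx, abs_sub_comm]
    · simp [hx]
  have h3 : |extend T g π| ≤ |extend T g π| / 2 := by
    calc _ ≤ _ := h1
      _ ≤ ((K : ℝ) ^ k + 1) * (|extend T g π| / (2 * ((K : ℝ) ^ k + 1))) := by
          gcongr
          · linarith
          · exact h2.trans hf
      _ = _ := by field_simp
  linarith

end IsMetricCurrent

end MetricCurrents

end

noncomputable section

namespace MetricCurrents

/-! ### Countable partitions and pointwise Lipschitz constants. -/

section Cells

variable {X ι : Type*} [MeasurableSpace X] {μ : Measure X} [Countable ι] [MeasurableSpace ι]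
  [MeasurableSingletonClass ι]

/-- A functional that is additive and bounded in `L¹(μ)` can be estimated on the cells of a
countable measurable partition. -/
lemma abs_le_integral_of_cells {F : (X → ℝ) → ℝ} {K : ℝ}
    (hadd : ∀ g g', Integrable g μ → Integrable g' μ → F (g + g') = F g + F g')
    (hF : ∀ g, Integrable g μ → |F g| ≤ K * ∫ x, |g x| ∂μ) {q : X → ι} (hq : Measurable q)
    {g w : X → ℝ} (hg : Integrable g μ) (hw : Integrable w μ) (hw0 : ∀ x, 0 ≤ w x)
    (hcell : ∀ c, |F ((q ⁻¹' {c}).indicator g)| ≤ ∫ x in q ⁻¹' {c}, w x ∂μ) :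
    |F g| ≤ ∫ x, w x ∂μ := by
  classical
  have hm : ∀ c, MeasurableSet (q ⁻¹' {c}) := fun c => hq (measurableSet_singleton c)
  have hd : Pairwise (Function.onFun Disjoint fun c => q ⁻¹' {c}) := fun c c' hcc =>
    Disjoint.preimage _ (by simpa using hcc)
  have hU : (⋃ c, q ⁻¹' {c}) = Set.univ := by
    ext x; simp
  have hsum : ∀ {u : X → ℝ}, Integrable u μ →
      HasSum (fun c => ∫ x in q ⁻¹' {c}, u x ∂μ) (∫ x, u x ∂μ) := fun {u} hu => by
    have := hasSum_integral_iUnion hm hd (f := u) (μ := μ) hu.integrableOn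
    rwa [hU, setIntegral_univ] at this
  -- Finite unions of cells exhaust g in `L¹`, since the integrals of |g| over the cells sum to the
  -- full one. The bound on `F (G s)` is uniform in s, so it passes to the limit.
  set G : Finset ι → X → ℝ := fun s => ∑ c ∈ s, (q ⁻¹' {c}).indicator g with hG
  have hGi : ∀ s, Integrable (G s) μ := fun s =>
    integrable_finsetSum' s fun c _ => hg.indicator (hm c)
  have hGx : ∀ s x, G s x = if q x ∈ s then g x else 0 := by
    intro s x
    simp only [hG, Finset.sum_apply, Set.indicator_apply, Set.mem_preimage, Set.mem_singleton_iff]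
    exact Finset.sum_ite_eq s (q x) fun _ => g x
  have hF0 : F 0 = 0 := by
    have := hF 0 (integrable_zero _ _ _)
    simpa using this
  have hFG : ∀ s, F (G s) = ∑ c ∈ s, F ((q ⁻¹' {c}).indicator g) := by
    intro s
    induction s using Finset.induction_on with
    | empty => simpa [hG] using hF0
    | insert a s ha ih =>
      have : G (insert a s) = (q ⁻¹' {a}).indicator g + G s := by
        simp [hG, Finset.sum_insert ha]
      rw [this, hadd _ _ (hg.indicator (hm a)) (hGi s), ih, Finset.sum_insert ha]
  have hbound : ∀ s, |F (G s)| ≤ ∫ x, w x ∂μ := fun s => by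
    rw [hFG]
    refine (Finset.abs_sum_le_sum_abs _ _).trans ((Finset.sum_le_sum fun c _ => hcell c).trans ?_)
    exact sum_le_hasSum s (fun c _ => integral_nonneg hw0) (hsum hw)
  have hdiff : ∀ s, |F g - F (G s)| ≤
      K * (∫ x, |g x| ∂μ - ∑ c ∈ s, ∫ x in q ⁻¹' {c}, |g x| ∂μ) := fun s => by
    have h1 : F g - F (G s) = F (g - G s) := by
      have := hadd (g - G s) (G s) (hg.sub (hGi s)) (hGi s)
      rw [sub_add_cancel] at this
      linarith
    rw [h1]
    refine (hF _ (hg.sub (hGi s))).trans (le_of_eq ?_)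
    congr 1
    have h2 : ∑ c ∈ s, ∫ x in q ⁻¹' {c}, |g x| ∂μ = ∫ x, |G s x| ∂μ := by
      simp_rw [← integral_indicator (hm _)]
      rw [← integral_finsetSum s fun c _ => hg.abs.indicator (hm c)]
      refine integral_congr_ae (ae_of_all _ fun x => ?_)
      simp only [hGx, Set.indicator_apply, Set.mem_preimage, Set.mem_singleton_iff]
      rw [Finset.sum_ite_eq s (q x) fun _ => |g x|]
      split_ifs <;> simp
    rw [h2, ← integral_sub hg.abs (hGi s).abs]
    refine integral_congr_ae (ae_of_all _ fun x => ?_)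
    simp only [Pi.sub_apply, hGx]
    split_ifs <;> simp
  have hlim : Tendsto (fun s : Finset ι => F (G s)) atTop (𝓝 (F g)) := by
    rw [tendsto_iff_dist_tendsto_zero]
    have h3 : Tendsto (fun s : Finset ι => K * (∫ x, |g x| ∂μ -
        ∑ c ∈ s, ∫ x in q ⁻¹' {c}, |g x| ∂μ)) atTop (𝓝 (K * (∫ x, |g x| ∂μ - ∫ x, |g x| ∂μ))) :=
      Tendsto.const_mul K (tendsto_const_nhds.sub (hsum hg.abs))
    rw [sub_self, mul_zero] at h3
    refine squeeze_zero (fun _ => dist_nonneg) (fun s => ?_) h3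
    rw [Real.dist_eq, abs_sub_comm]
    exact hdiff s
  exact le_of_tendsto' hlim.abs hbound

end Cells

namespace IsMetricCurrent

variable {X : Type*} [MetricSpace X] [MeasurableSpace X] [BorelSpace X] {k : ℕ}
  {T : MetricFunctional X k} {g : X → ℝ}

lemma extend_update_eq (hT : IsMetricCurrent T) (hg : Integrable g (massMeasure T))
    (π : Fin k → Lip X) (i : Fin k) {p p' : Lip X} (h : ∀ x, g x ≠ 0 → p.1 x = p'.1 x) :
    extend T g (Function.update π i p) = extend T g (Function.update π i p') := by
  have h1 := (hT.extend_linear_right hg π i).map_sub p p'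
  have h2 := hT.extend_eq_zero hg (Function.update π i (p - p')) i 0 fun x hx => by
    simp [h x hx]
  simp only [h2] at h1
  linarith

/-- The value on `(g, π)` depends only on the restriction of `π` to `{g ≠ 0}`. -/
lemma extend_congr_right (hT : IsMetricCurrent T) (hg : Integrable g (massMeasure T))
    {π π' : Fin k → Lip X} (h : ∀ i x, g x ≠ 0 → (π i).1 x = (π' i).1 x) :
    extend T g π = extend T g π' := by
  classical
  have key : ∀ s : Finset (Fin k), extend T g π = extend T g (s.piecewise π' π) := by
    intro s
    induction s using Finset.induction_on with
    | empty => simp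
    | insert a s ha ih =>
      rw [Finset.piecewise_insert, ih, ← hT.extend_update_eq hg _ a (h a)]
      congr 1
      ext j : 1
      rcases eq_or_ne j a with rfl | hj
      · simp [ha]
      · simp [hj]
  simpa using key Finset.univ

/-- Only the values of π on A matter, so each π_i may be replaced by the McShane extension of its
restriction to A, which keeps the constant `L i`. -/
lemma abs_extend_indicator_le (hT : IsMetricCurrent T) (hg : Integrable g (massMeasure T))
    {π : Fin k → Lip X} {A : Set X} (hA : MeasurableSet A) {L : Fin k → ℝ≥0}
    (hL : ∀ i, LipschitzOnWith (L i) (π i).1 A) :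
    |extend T (A.indicator g) π| ≤ (∏ i, (L i : ℝ)) * ∫ x in A, |g x| ∂(massMeasure T) := by
  choose p hp hpA using fun i => (hL i).extend_real
  rw [hT.extend_congr_right (hg.indicator hA) (π' := fun i => ⟨p i, L i, hp i⟩)
    fun i x hx => hpA i (Set.mem_of_indicator_ne_zero hx)]
  refine (hT.abs_extend_le (hg.indicator hA) _).trans ?_
  have h1 : ∫ x, |A.indicator g x| ∂(massMeasure T) = ∫ x in A, |g x| ∂(massMeasure T) := by
    rw [← integral_indicator hA]
    refine integral_congr_ae (ae_of_all _ fun x => ?_)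
    by_cases hx : x ∈ A <;> simp [hx]
  rw [h1]
  refine mul_le_mul_of_nonneg_right ?_ (integral_nonneg fun _ => abs_nonneg _)
  exact_mod_cast lipProd_le fun i => hp i

lemma abs_extend_le_of_cells (hT : IsMetricCurrent T) (hg : Integrable g (massMeasure T))
    {π : Fin k → Lip X} {ι : Type*} [Countable ι] [MeasurableSpace ι] [MeasurableSingletonClass ι]
    {q : X → ι} (hq : Measurable q) {L : ι → Fin k → ℝ≥0}
    (hL : ∀ c i, LipschitzOnWith (L c i) (π i).1 (q ⁻¹' {c})) {w : X → ℝ}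
    (hw : Integrable w (massMeasure T)) (h : ∀ x, (∏ i, (L (q x) i : ℝ)) * |g x| ≤ w x) :
    |extend T g π| ≤ ∫ x, w x ∂(massMeasure T) := by
  refine abs_le_integral_of_cells (F := fun g => extend T g π)
    (fun g g' hg hg' => hT.extend_add hg hg' π) (fun g hg => hT.abs_extend_le hg π) hq hg hw
    (fun x => le_trans (by positivity) (h x)) fun c => ?_
  have hm : MeasurableSet (q ⁻¹' {c}) := hq (measurableSet_singleton c)
  refine (hT.abs_extend_indicator_le hg hm (hL c)).trans ?_
  rw [← integral_const_mul]
  refine setIntegral_mono_on (hg.abs.const_mul _).integrableOn hw.integrableOn hm fun x hx => ?_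
  have := h x
  rwa [show q x = c from hx] at this

end IsMetricCurrent

section PointwiseLipschitz

variable {X Y : Type*} [MetricSpace X] [MetricSpace Y]

lemma pointLip_eq (f : X → Y) (x : X) :
    pointLip f x = ⨅ n : ℕ, ⨆ y ∈ Metric.ball x (1 / ((n : ℝ) + 1)) ∩ {x}ᶜ,
      edist (f y) (f x) / edist y x := by
  have h := nhdsWithin_hasBasis (Metric.nhds_basis_ball_inv_nat_succ (x := x)) {x}ᶜ
  rw [pointLip, h.limsup_eq_iInf_iSup]
  simp

/-- Pointwise Lipschitz constants are countable infima of suprema over punctured balls. Each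
supremum is lower semicontinuous in the centre: a point y witnessing a large quotient at x also
witnesses it at nearby points. -/
lemma measurable_pointLip [MeasurableSpace X] [OpensMeasurableSpace X] {f : X → Y}
    (hf : Continuous f) : Measurable (pointLip f) := by
  have h : pointLip f = fun x => ⨅ n : ℕ, ⨆ y ∈ Metric.ball x (1 / ((n : ℝ) + 1)) ∩ {x}ᶜ,
      edist (f y) (f x) / edist y x := funext fun x => pointLip_eq f x
  rw [h]
  refine Measurable.iInf fun n => measurable_of_Ioi fun a => IsOpen.measurableSet ?_
  have hset : ((fun x => ⨆ y ∈ Metric.ball x (1 / ((n : ℝ) + 1)) ∩ {x}ᶜ,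
      edist (f y) (f x) / edist y x) ⁻¹' Set.Ioi a) =
      ⋃ y, Metric.ball y (1 / ((n : ℝ) + 1)) ∩
        ({y}ᶜ ∩ (fun x => edist (f y) (f x) / edist y x) ⁻¹' Set.Ioi a) := by
    ext x
    simp only [Set.mem_preimage, Set.mem_Ioi, lt_iSup_iff, Set.mem_iUnion, Set.mem_inter_iff,
      Metric.mem_ball, Set.mem_compl_iff, Set.mem_singleton_iff]
    constructor
    · rintro ⟨y, ⟨h1, h2⟩, h3⟩
      exact ⟨y, by rwa [dist_comm], fun h => h2 h.symm, h3⟩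
    · rintro ⟨y, h1, h2, h3⟩
      exact ⟨y, ⟨by rwa [dist_comm], fun h => h2 h.symm⟩, h3⟩
  rw [hset]
  refine isOpen_iUnion fun y => Metric.isOpen_ball.inter ?_
  refine ContinuousOn.isOpen_inter_preimage (fun x hx => ContinuousAt.continuousWithinAt ?_)
    isOpen_compl_singleton isOpen_Ioi
  have hxy : edist y x ≠ 0 := by
    simpa [edist_eq_zero] using fun h : y = x => hx h.symm
  exact ENNReal.Tendsto.div ((continuous_const.edist hf).tendsto x) (Or.inr hxy)
    ((continuous_const.edist continuous_id).tendsto x) (Or.inl (edist_ne_top _ _))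

lemma pointLip_le {f : X → Y} {K : ℝ≥0} (h : LipschitzWith K f) (x : X) : pointLip f x ≤ K :=
  limsup_le_of_le (h := Eventually.of_forall fun y => ENNReal.div_le_of_le_mul (h y x))

lemma pointLip_ne_top {f : X → Y} (h : IsLip f) (x : X) : pointLip f x ≠ ∞ := by
  obtain ⟨K, hK⟩ := h
  exact ne_top_of_le_ne_top ENNReal.coe_ne_top (pointLip_le hK x)

/-- The points at which `f` has difference quotients at most `L` up to the scale `r`. -/
def lipAtScale (f : X → Y) (L r : ℝ) : Set X :=
  {x | ∀ y, dist y x < r → dist (f y) (f x) ≤ L * dist y x}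

lemma isClosed_lipAtScale {f : X → Y} (hf : Continuous f) (L r : ℝ) :
    IsClosed (lipAtScale f L r) := by
  have : lipAtScale f L r =
      ⋂ y, ((Metric.ball y r)ᶜ ∪ {x | dist (f y) (f x) ≤ L * dist y x}) := by
    ext x
    simp only [lipAtScale, Set.mem_ofPred_eq, Set.mem_iInter, Set.mem_union, Set.mem_compl_iff,
      Metric.mem_ball, dist_comm x]
    exact forall_congr' fun y => imp_iff_not_or
  rw [this]
  exact isClosed_iInter fun y => Metric.isOpen_ball.isClosed_compl.union
    (isClosed_le (continuous_const.dist hf)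
      (continuous_const.mul (continuous_const.dist continuous_id)))

lemma exists_mem_lipAtScale {f : X → Y} {x : X} {L : ℝ}
    (h : pointLip f x < ENNReal.ofReal L) : ∃ n : ℕ, x ∈ lipAtScale f L (1 / ((n : ℝ) + 1)) := by
  rw [pointLip_eq, iInf_lt_iff] at h
  obtain ⟨n, hn⟩ := h
  refine ⟨n, fun y hy => ?_⟩
  have hL : 0 < L := by
    by_contra hL
    simp [ENNReal.ofReal_of_nonpos (not_lt.1 hL)] at hn
  rcases eq_or_ne y x with rfl | hyx
  · simp
  have h1 : edist (f y) (f x) / edist y x ≤ ENNReal.ofReal L :=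
    (le_iSup₂_of_le (f := fun y (_ : y ∈ Metric.ball x (1 / ((n : ℝ) + 1)) ∩ {x}ᶜ) =>
      edist (f y) (f x) / edist y x) y ⟨hy, hyx⟩ le_rfl).trans hn.le
  rw [ENNReal.div_le_iff (by simpa using hyx) (edist_ne_top _ _), edist_dist, edist_dist,
    ← ENNReal.ofReal_mul hL.le, ENNReal.ofReal_le_ofReal_iff (by positivity)] at h1
  exact h1

/-- Pairs closer than r are controlled by the scale condition, distant pairs by the oscillation
bound L·r. -/
lemma lipschitzOnWith_of_lipAtScale {f : X → ℝ} {A : Set X} {L : ℝ≥0} {r : ℝ}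
    (hA : A ⊆ lipAtScale f L r) (hosc : ∀ x ∈ A, ∀ y ∈ A, |f x - f y| ≤ L * r) :
    LipschitzOnWith L f A := by
  refine LipschitzOnWith.of_dist_le_mul fun x hx y hy => ?_
  rcases lt_or_ge (dist x y) r with h | h
  · exact hA hy x h
  · exact (hosc x hx y hy).trans (by gcongr)

end PointwiseLipschitz

end MetricCurrents

end

noncomputable section

namespace MetricCurrents

/-! ### The mass bound with pointwise Lipschitz constants. -/

section PointwiseBound

variable {X : Type*} [MetricSpace X] [MeasurableSpace X] [BorelSpace X] {k : ℕ}
  {T : MetricFunctional X k} {g : X → ℝ}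

/-- `c x` is the integer part of Lip p(x)/ε, so the slope (c + 1)ε is strictly admissible at x and
exceeds the pointwise constant by at most ε. -/
lemma exists_measurable_slope (p : Lip X) {ε : ℝ} (hε : 0 < ε) :
    ∃ c : X → ℕ, Measurable c ∧ (∀ x, c x * ε ≤ (pointLip p.1 x).toReal) ∧
      ∀ x, pointLip p.1 x < ENNReal.ofReal ((c x + 1) * ε) := by
  refine ⟨fun x => ⌊(pointLip p.1 x).toReal / ε⌋₊, ?_, fun x => ?_, fun x => ?_⟩
  · exact Nat.measurable_floor.comp
      ((measurable_pointLip (Lip.continuous p)).ennreal_toReal.div_const _)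
  · have := Nat.floor_le (show 0 ≤ (pointLip p.1 x).toReal / ε by positivity)
    rwa [le_div_iff₀ hε] at this
  · have h1 := Nat.lt_floor_add_one ((pointLip p.1 x).toReal / ε)
    rw [div_lt_iff₀ hε] at h1
    rw [← ENNReal.ofReal_toReal (pointLip_ne_top p.2 x)]
    exact (ENNReal.ofReal_lt_ofReal_iff (by positivity)).2 h1

/-- The least admissible scale index is measurable because, for each of the countably many slopes,
the points admissible at a given scale form a closed set. -/
lemma exists_measurable_scale (p : Lip X) {ε : ℝ} {c : X → ℕ} (hc : Measurable c)
    (h : ∀ x, pointLip p.1 x < ENNReal.ofReal ((c x + 1) * ε)) :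
    ∃ n : X → ℕ, Measurable n ∧
      ∀ x, x ∈ lipAtScale p.1 ((c x + 1) * ε) (1 / ((n x : ℝ) + 1)) := by
  classical
  have hex := fun x => exists_mem_lipAtScale (h x)
  refine ⟨fun x => Nat.find (hex x), measurable_find hex fun m => ?_,
    fun x => Nat.find_spec (hex x)⟩
  have : {x | x ∈ lipAtScale p.1 ((c x + 1) * ε) (1 / ((m : ℝ) + 1))} =
      ⋃ j : ℕ, c ⁻¹' {j} ∩ lipAtScale p.1 ((j + 1) * ε) (1 / ((m : ℝ) + 1)) := by
    ext x
    simp only [Set.mem_ofPred_eq, Set.mem_iUnion, Set.mem_inter_iff, Set.mem_preimage,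
      Set.mem_singleton_iff]
    exact ⟨fun h => ⟨c x, rfl, h⟩, fun ⟨j, hj, h⟩ => hj ▸ h⟩
  rw [this]
  exact MeasurableSet.iUnion fun j => (hc (measurableSet_singleton j)).inter
    (isClosed_lipAtScale (Lip.continuous p) _ _).measurableSet

/-- The space decomposes into countably many pieces on each of which the global Lipschitz constant
of `p` is at most `ε` larger than its pointwise Lipschitz constant. -/
lemma exists_cells_pointLip (p : Lip X) {ε : ℝ≥0} (hε : 0 < ε) :
    ∃ q : X → ℕ × ℕ × ℤ, Measurable q ∧
      (∀ c, LipschitzOnWith ((c.1 + 1) * ε) p.1 (q ⁻¹' {c})) ∧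
      ∀ x, (q x).1 * (ε : ℝ) ≤ (pointLip p.1 x).toReal := by
  have hε' : (0 : ℝ) < ε := hε
  obtain ⟨c, hcm, hc, hc'⟩ := exists_measurable_slope p hε'
  obtain ⟨n, hnm, hn⟩ := exists_measurable_scale p hcm hc'
  have hcast : ∀ {a : X → ℕ}, Measurable a → Measurable fun x => (a x : ℝ) :=
    fun h => measurable_from_nat.comp h
  -- Besides slope and scale, a cell records the value of p up to windows of length slope × scale,
  -- exactly the oscillation allowed by `lipschitzOnWith_of_lipAtScale`.
  have hzm : Measurable fun x => ⌊p.1 x / (((c x + 1) * ε) * (1 / ((n x : ℝ) + 1)))⌋ := by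
    refine Int.measurable_floor.comp ((Lip.continuous p).measurable.div ?_)
    exact (((hcast hcm).add_const 1).mul_const _).mul
      (measurable_const.div ((hcast hnm).add_const 1))
  refine ⟨fun x => (c x, n x, ⌊p.1 x / (((c x + 1) * ε) * (1 / ((n x : ℝ) + 1)))⌋),
    hcm.prodMk (hnm.prodMk hzm), ?_, hc⟩
  rintro ⟨c₀, n₀, z₀⟩
  refine lipschitzOnWith_of_lipAtScale (r := 1 / ((n₀ : ℝ) + 1)) (fun x hx => ?_)
    fun x hx y hy => ?_
  · rw [Set.mem_preimage, Set.mem_singleton_iff, Prod.mk.injEq, Prod.mk.injEq] at hx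
    have h := hn x
    rw [hx.1, hx.2.1] at h
    push_cast
    exact h
  · rw [Set.mem_preimage, Set.mem_singleton_iff, Prod.mk.injEq, Prod.mk.injEq] at hx hy
    obtain ⟨h1, h2, h3⟩ := hx
    obtain ⟨h1', h2', h3'⟩ := hy
    rw [h1, h2] at h3
    rw [h1', h2'] at h3'
    have hW : 0 < ((c₀ + 1) * ε : ℝ) * (1 / ((n₀ : ℝ) + 1)) := by positivity
    have h4 := Int.abs_sub_lt_one_of_floor_eq_floor (h3.trans h3'.symm)
    rw [← sub_div, abs_div, abs_of_pos hW, div_lt_one hW] at h4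
    push_cast
    exact h4.le

lemma measurable_prod_pointLip (π : Fin k → Lip X) :
    Measurable fun x => ∏ i, (pointLip (π i).1 x).toReal :=
  Finset.measurable_fun_prod _ fun i _ =>
    (measurable_pointLip (Lip.continuous (π i))).ennreal_toReal

lemma toReal_pointLip_le {p : X → ℝ} {K : ℝ≥0} (h : LipschitzWith K p) (x : X) :
    (pointLip p x).toReal ≤ K :=
  ENNReal.toReal_mono ENNReal.coe_ne_top (pointLip_le h x)

/-- The mass bound with pointwise Lipschitz constants. -/
lemma IsMetricCurrent.abs_extend_le_integral_pointLip (hT : IsMetricCurrent T)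
    (hg : Integrable g (massMeasure T)) (π : Fin k → Lip X) :
    |extend T g π| ≤ ∫ x, |g x| * ∏ i, (pointLip (π i).1 x).toReal ∂(massMeasure T) := by
  have := hT.isFiniteMeasure
  obtain ⟨K, hK⟩ := exists_common_lip π
  -- The cells cost an error ε in every factor; dominated convergence removes it at the end.
  set W : ℝ → X → ℝ := fun ε x => |g x| * ∏ i, ((pointLip (π i).1 x).toReal + ε) with hW
  have hWm : ∀ ε, AEStronglyMeasurable (W ε) (massMeasure T) := fun ε =>
    hg.abs.aestronglyMeasurable.mul (Finset.measurable_fun_prod _ fun i _ =>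
      (measurable_pointLip (Lip.continuous (π i))).ennreal_toReal.add_const ε).aestronglyMeasurable
  have hWb : ∀ ε, 0 ≤ ε → ε ≤ 1 → ∀ x, ‖W ε x‖ ≤ |g x| * (K + 1) ^ k := fun ε h0 h1 x => by
    have hp : ∏ i, ((pointLip (π i).1 x).toReal + ε) ≤ (K + 1 : ℝ) ^ k := by
      refine (Finset.prod_le_prod (fun i _ => by positivity)
        fun i _ => add_le_add (toReal_pointLip_le (hK i) x) h1).trans (by simp)
    have hp0 : 0 ≤ ∏ i, ((pointLip (π i).1 x).toReal + ε) :=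
      Finset.prod_nonneg fun i _ => by positivity
    rw [Real.norm_eq_abs, abs_mul, abs_abs, abs_of_nonneg hp0]
    gcongr
  have hWi : ∀ ε, 0 ≤ ε → ε ≤ 1 → Integrable (W ε) (massMeasure T) := fun ε h0 h1 =>
    (hg.abs.mul_const ((K + 1 : ℝ) ^ k)).mono' (hWm ε) (ae_of_all _ (hWb ε h0 h1))
  have hle : ∀ ε : ℝ≥0, 0 < ε → ε ≤ 1 → |extend T g π| ≤ ∫ x, W ε x ∂(massMeasure T) := by
    intro ε h0 h1
    choose q hqm hqL hq using fun i => exists_cells_pointLip (π i) h0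
    refine hT.abs_extend_le_of_cells hg (q := fun x i => q i x) (measurable_pi_iff.2 hqm)
      (L := fun c i => ((c i).1 + 1) * ε) (fun c i => ?_) (hWi ε ε.2 (by exact_mod_cast h1))
      fun x => ?_
    · refine (hqL i (c i)).mono fun x hx => ?_
      simp only [Set.mem_preimage, Set.mem_singleton_iff] at hx ⊢
      rw [← hx]
    · rw [mul_comm]
      refine mul_le_mul_of_nonneg_left (Finset.prod_le_prod (fun i _ => by positivity)
        fun i _ => ?_) (abs_nonneg _)
      have := hq i x
      push_cast
      linarith
  have hlim : Tendsto (fun n : ℕ => ∫ x, W (1 / ((n : ℝ) + 1)) x ∂(massMeasure T)) atTop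
      (𝓝 (∫ x, W 0 x ∂(massMeasure T))) := by
    refine tendsto_integral_of_dominated_convergence (fun x => |g x| * (K + 1) ^ k)
      (fun n => hWm _) (hg.abs.mul_const _) (fun n => ae_of_all _ (hWb _ (by positivity) ?_))
      (ae_of_all _ fun x => ?_)
    · rw [div_le_one (by positivity)]
      linarith [Nat.cast_nonneg (α := ℝ) n]
    · refine Tendsto.const_mul _ (tendsto_finsetProd _ fun i _ => ?_)
      exact tendsto_const_nhds.add tendsto_one_div_add_atTop_nhds_zero_nat
  have h0 : W 0 = fun x => |g x| * ∏ i, (pointLip (π i).1 x).toReal := by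
    simp [hW]
  rw [h0] at hlim
  refine ge_of_tendsto' hlim fun n => ?_
  have h1 : (1 / ((n : ℝ≥0) + 1)) ≤ 1 := by
    rw [div_le_one (by positivity)]
    simp
  simpa using hle (1 / ((n : ℝ≥0) + 1)) (by positivity) h1

end PointwiseBound

/-! ### The product rule. -/

section Leibniz

variable {X : Type*} [MetricSpace X] [MeasurableSpace X] [BorelSpace X] {k : ℕ}
  {T : MetricFunctional X k} {g : X → ℝ}

lemma LipB.integrable_mul {μ : Measure X} (hg : Integrable g μ) (f : LipB X) :
    Integrable (fun x => g x * f.1 x) μ := by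
  obtain ⟨C, hC0, hC⟩ := LipB.exists_bound f
  exact hg.mul_bdd (c := C) (LipB.continuous f).aestronglyMeasurable (ae_of_all _ hC)

/-- The product rule. -/
theorem IsMetricCurrent.extend_leibniz (hT : IsMetricCurrent T)
    (hg : Integrable g (massMeasure T)) (f s : LipB X) (π : Fin k → Lip X) (i : Fin k) :
    extend T (fun x => g x * f.1 x) (Function.update π i (lipBToLip s)) +
      extend T (fun x => g x * s.1 x) (Function.update π i (lipBToLip f)) =
      extend T g (Function.update π i (lipBToLip (mulB f s))) := by
  have hfin := hT.isFiniteMeasure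
  set μ := massMeasure T with hμ
  -- F measures the failure of the product rule. It is additive and `L¹`-bounded in g, so it can be
  -- estimated cell by cell.
  set F : (X → ℝ) → ℝ := fun g =>
    extend T (fun x => g x * f.1 x) (Function.update π i (lipBToLip s)) +
      extend T (fun x => g x * s.1 x) (Function.update π i (lipBToLip f)) -
      extend T g (Function.update π i (lipBToLip (mulB f s))) with hF
  obtain ⟨C₁, hC₁⟩ := exists_common_lip π
  obtain ⟨C₂, hC₂⟩ := f.2.1
  obtain ⟨C₃, hC₃⟩ := s.2.1
  obtain ⟨C₄, hC₄⟩ := (lipBToLip (mulB f s)).2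
  set C := C₁ + C₂ + C₃ + C₄ with hC
  have hπ : ∀ (p : Lip X), LipschitzWith C p.1 →
      ∀ j, LipschitzWith C (Function.update π i p j).1 := by
    intro p hp j
    rcases eq_or_ne j i with rfl | hj
    · simpa using hp
    · simp only [Function.update_of_ne hj]
      exact (hC₁ j).weaken (by rw [hC, add_assoc, add_assoc]; exact le_self_add)
  have hf : LipschitzWith C f.1 := hC₂.weaken (by
    rw [hC, add_assoc, add_assoc, add_left_comm]; exact le_self_add)
  have hs : LipschitzWith C s.1 := hC₃.weaken (by
    rw [hC, add_assoc, add_left_comm]; exact le_self_add)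
  have hfs : LipschitzWith C (lipBToLip (mulB f s)).1 := hC₄.weaken le_add_self
  obtain ⟨Df, hDf0, hDf⟩ := LipB.exists_bound f
  obtain ⟨Ds, hDs0, hDs⟩ := LipB.exists_bound s
  have hadd : ∀ g g', Integrable g μ → Integrable g' μ → F (g + g') = F g + F g' := by
    intro g g' hg hg'
    have e1 : ∀ u : LipB X, (fun x => (g + g') x * u.1 x) =
        (fun x => g x * u.1 x) + fun x => g' x * u.1 x := fun u => by
      ext x; simp [add_mul]
    simp only [hF, e1]
    rw [hT.extend_add (LipB.integrable_mul hg f) (LipB.integrable_mul hg' f),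
      hT.extend_add (LipB.integrable_mul hg s) (LipB.integrable_mul hg' s), hT.extend_add hg hg']
    ring
  have hmulb : ∀ (g : X → ℝ) (u : LipB X) (D : ℝ), Integrable g μ → (∀ x, |u.1 x| ≤ D) →
      ∀ (p : Lip X), LipschitzWith C p.1 →
      |extend T (fun x => g x * u.1 x) (Function.update π i p)| ≤
        C ^ k * (D * ∫ x, |g x| ∂μ) := by
    intro g u D hg hu p hp
    refine (hT.abs_extend_le_pow (LipB.integrable_mul hg u) (hπ p hp)).trans ?_
    refine mul_le_mul_of_nonneg_left ?_ (by positivity)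
    rw [← integral_const_mul]
    refine integral_mono (LipB.integrable_mul hg u).abs (hg.abs.const_mul D) fun x => ?_
    simp only [abs_mul]
    rw [mul_comm]
    exact mul_le_mul_of_nonneg_right (hu x) (abs_nonneg _)
  have hFb : ∀ g, Integrable g μ → |F g| ≤ (C ^ k * (Df + Ds + 1)) * ∫ x, |g x| ∂μ := by
    intro g hg
    have h1 := hmulb g f Df hg hDf (lipBToLip s) hs
    have h2 := hmulb g s Ds hg hDs (lipBToLip f) hf
    have h3 := hT.abs_extend_le_pow hg (hπ _ hfs)
    refine (abs_sub _ _).trans ?_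
    refine (add_le_add (abs_add_le _ _) le_rfl).trans ?_
    calc _ ≤ C ^ k * (Df * ∫ x, |g x| ∂μ) + C ^ k * (Ds * ∫ x, |g x| ∂μ) +
          C ^ k * ∫ x, |g x| ∂μ := add_le_add (add_le_add h1 h2) h3
      _ = _ := by ring
  -- D is the contribution of the slots other than i to the product of Lipschitz constants.
  set D : ℝ := ∏ j ∈ Finset.univ \ {i}, (C : ℝ) with hD
  have hD0 : 0 ≤ D := Finset.prod_nonneg fun _ _ => C.2
  have hcell : ∀ (ε : ℝ≥0) (A : Set X), MeasurableSet A →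
      (∀ x ∈ A, ∀ y ∈ A, |f.1 x - f.1 y| ≤ ε ∧ |s.1 x - s.1 y| ≤ ε) →
      |F (A.indicator g)| ≤ ∫ x in A, (C ^ k + C ^ k + 2 * C * D) * ε * |g x| ∂μ := by
    intro ε A hA hosc
    rcases A.eq_empty_or_nonempty with rfl | ⟨x₀, hx₀⟩
    · have : F 0 = 0 := by
        have := hFb 0 (integrable_zero _ _ _)
        simpa using this
      rw [Set.indicator_empty', this]
      simp
    have hgA : Integrable (A.indicator g) μ := hg.indicator hA
    have hshift : ∀ (u v : LipB X), LipschitzWith C v.1 →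
        (∀ x ∈ A, |u.1 x - u.1 x₀| ≤ ε) →
        |extend T (fun x => A.indicator g x * u.1 x) (Function.update π i (lipBToLip v)) -
          u.1 x₀ * extend T (A.indicator g) (Function.update π i (lipBToLip v))| ≤
          C ^ k * ∫ x in A, ε * |g x| ∂μ := by
      intro u v hv hu
      rw [← hT.extend_smul hgA, ← hT.extend_sub (LipB.integrable_mul hgA u) (hgA.smul _)]
      refine (hT.abs_extend_le_pow ((LipB.integrable_mul hgA u).sub (hgA.smul _))
        (hπ _ hv)).trans ?_
      refine mul_le_mul_of_nonneg_left ?_ (by positivity)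
      rw [← integral_indicator hA]
      refine integral_mono ((LipB.integrable_mul hgA u).sub (hgA.smul _)).abs
        ((hg.abs.const_mul _).indicator hA) fun x => ?_
      by_cases hx : x ∈ A
      · simp only [Pi.sub_apply, Pi.smul_apply, Set.indicator_of_mem hx, smul_eq_mul]
        rw [show g x * u.1 x - u.1 x₀ * g x = (u.1 x - u.1 x₀) * g x by ring, abs_mul]
        exact mul_le_mul_of_nonneg_right (hu x hx) (abs_nonneg _)
      · simp [hx]
    have h1 := hshift f s hs fun x hx => (hosc x hx x₀ hx₀).1
    have h2 := hshift s f hf fun x hx => (hosc x hx x₀ hx₀).2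
    -- P equals f(x₀)s(x₀) − (f − f(x₀))(s − s(x₀)). On A, where f and s oscillate by at most ε, the
    -- product has Lipschitz constant at most 2Cε. Hence freezing the coefficients f and s at x₀
    -- makes the product rule exact up to O(ε).
    set P : Lip X := f.1 x₀ • lipBToLip s + s.1 x₀ • lipBToLip f - lipBToLip (mulB f s) with hP
    have h3 : extend T (A.indicator g) (Function.update π i P) =
        f.1 x₀ * extend T (A.indicator g) (Function.update π i (lipBToLip s)) +
        s.1 x₀ * extend T (A.indicator g) (Function.update π i (lipBToLip f)) -
        extend T (A.indicator g) (Function.update π i (lipBToLip (mulB f s))) := by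
      have hl := hT.extend_linear_right hgA π i
      have e1 := hl.map_sub (f.1 x₀ • lipBToLip s + s.1 x₀ • lipBToLip f) (lipBToLip (mulB f s))
      have e2 := hl.map_add (f.1 x₀ • lipBToLip s) (s.1 x₀ • lipBToLip f)
      have e3 := hl.map_smul (f.1 x₀) (lipBToLip s)
      have e4 := hl.map_smul (s.1 x₀) (lipBToLip f)
      simp only [smul_eq_mul] at e1 e2 e3 e4
      rw [hP, e1, e2, e3, e4]
    have h4 : |extend T (A.indicator g) (Function.update π i P)| ≤
        (2 * C * ε * D) * ∫ x in A, |g x| ∂μ := by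
      have hPL : LipschitzOnWith (2 * C * ε) P.1 A := by
        refine LipschitzOnWith.of_dist_le_mul fun x hx y hy => ?_
        have hfd := hf.dist_le_mul x y
        have hsd := hs.dist_le_mul x y
        have hf0 := (hosc x hx x₀ hx₀).1
        have hs0 := (hosc y hy x₀ hx₀).2
        rw [Real.dist_eq] at hfd hsd ⊢
        have : P.1 x - P.1 y = -((f.1 x - f.1 x₀) * (s.1 x - s.1 y) +
            (s.1 y - s.1 x₀) * (f.1 x - f.1 y)) := by
          simp [hP, lipBToLip, mulB]
          ring
        rw [this, abs_neg]
        refine (abs_add_le _ _).trans ?_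
        rw [abs_mul, abs_mul]
        calc _ ≤ (ε : ℝ) * (C * dist x y) + ε * (C * dist x y) := by gcongr
          _ = _ := by push_cast; ring
      have := hT.abs_extend_indicator_le hg hA (π := Function.update π i P)
        (L := Function.update (fun _ => C) i (2 * C * ε)) fun j => ?_
      · refine this.trans (le_of_eq ?_)
        have hprod : ∏ j, (Function.update (fun _ : Fin k => C) i (2 * C * ε) j : ℝ) =
            2 * C * ε * D := by
          have := Finset.prod_update_of_mem (Finset.mem_univ i) (fun _ : Fin k => C) (2 * C * ε)
          rw [← NNReal.coe_prod, this, hD]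
          push_cast
          rfl
        rw [hprod]
      · rcases eq_or_ne j i with rfl | hj
        · simpa using hPL
        · simp only [Function.update_of_ne hj]
          exact ((hC₁ j).weaken (by
            rw [hC, add_assoc, add_assoc]; exact le_self_add)).lipschitzOnWith
    have hsplit : F (A.indicator g) =
        (extend T (fun x => A.indicator g x * f.1 x) (Function.update π i (lipBToLip s)) -
          f.1 x₀ * extend T (A.indicator g) (Function.update π i (lipBToLip s))) +
        (extend T (fun x => A.indicator g x * s.1 x) (Function.update π i (lipBToLip f)) -
          s.1 x₀ * extend T (A.indicator g) (Function.update π i (lipBToLip f))) +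
        extend T (A.indicator g) (Function.update π i P) := by
      rw [h3]
      simp only [hF]
      ring
    rw [hsplit]
    rw [integral_const_mul] at h1 h2 ⊢
    calc _ ≤ _ := (abs_add_le _ _).trans (add_le_add (abs_add_le _ _) le_rfl)
      _ ≤ _ := add_le_add (add_le_add h1 h2) h4
      _ = _ := by ring
  set M : ℝ := C ^ k + C ^ k + 2 * C * D with hM
  have hM0 : 0 ≤ M := by positivity
  -- The cells are obtained by rounding the values of f and s to multiples of ε.
  have hε : ∀ ε : ℝ≥0, 0 < ε → |F g| ≤ ∫ x, M * ε * |g x| ∂μ := by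
    intro ε hε
    have hε' : (0 : ℝ) < ε := hε
    refine abs_le_integral_of_cells hadd hFb
      (q := fun x => (⌊f.1 x / ε⌋, ⌊s.1 x / ε⌋)) ?_ hg (hg.abs.const_mul _)
      (fun x => by positivity) fun c => hcell ε _ ?_ fun x hx y hy => ?_
    · exact (Int.measurable_floor.comp ((LipB.continuous f).measurable.div_const _)).prodMk
        (Int.measurable_floor.comp ((LipB.continuous s).measurable.div_const _))
    · exact ((Int.measurable_floor.comp ((LipB.continuous f).measurable.div_const _)).prodMk
        (Int.measurable_floor.comp ((LipB.continuous s).measurable.div_const _)))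
        (measurableSet_singleton c)
    · have hx' := (Set.mem_singleton_iff.1 hx).trans (Set.mem_singleton_iff.1 hy).symm
      rw [Prod.mk.injEq] at hx'
      have h1 := Int.abs_sub_lt_one_of_floor_eq_floor hx'.1
      have h2 := Int.abs_sub_lt_one_of_floor_eq_floor hx'.2
      rw [← sub_div, abs_div, abs_of_pos hε', div_lt_one hε'] at h1 h2
      exact ⟨h1.le, h2.le⟩
  have hzero : F g = 0 := by
    by_contra hne
    have hpos : 0 < |F g| := abs_pos.2 hne
    have hI : 0 ≤ ∫ x, |g x| ∂μ := integral_nonneg fun _ => abs_nonneg _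
    have hlim : Tendsto (fun n : ℕ => M * (1 / ((n : ℝ) + 1)) * ∫ x, |g x| ∂μ) atTop (𝓝 0) := by
      simpa using (tendsto_one_div_add_atTop_nhds_zero_nat.const_mul M).mul_const
        (∫ x, |g x| ∂μ)
    obtain ⟨n, hn⟩ := (hlim.eventually_lt_const hpos).exists
    have := hε (1 / ((n : ℝ≥0) + 1)) (by positivity)
    rw [integral_const_mul] at this
    push_cast at this
    linarith
  exact sub_eq_zero.1 hzero

end Leibniz

end MetricCurrents

end

noncomputable section

namespace MetricCurrents

/-! ### Alternation. -/

section Staircase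

/-- The distance to the even integers. -/
def evenDist (u : ℝ) : ℝ := Metric.infDist u (Set.range fun m : ℤ => 2 * (m : ℝ))

lemma lipschitzWith_evenDist : LipschitzWith 1 evenDist := Metric.lipschitz_infDist_pt _

lemma evenDist_nonneg (u : ℝ) : 0 ≤ evenDist u := Metric.infDist_nonneg

lemma evenDist_of_mem_left {u : ℝ} {m : ℤ} (h1 : 2 * (m : ℝ) ≤ u) (h2 : u ≤ 2 * m + 1) :
    evenDist u = u - 2 * m := by
  refine le_antisymm ?_ ((Metric.le_infDist (Set.range_nonempty _)).2 ?_)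
  · refine (Metric.infDist_le_dist_of_mem (Set.mem_range_self m)).trans (le_of_eq ?_)
    rw [Real.dist_eq, abs_of_nonneg (by linarith)]
  · rintro _ ⟨j, rfl⟩
    rw [Real.dist_eq]
    rcases le_or_gt j m with h | h
    · have : (j : ℝ) ≤ m := by exact_mod_cast h
      exact le_trans (by linarith) (le_abs_self _)
    · have : (m : ℝ) + 1 ≤ j := by exact_mod_cast h
      exact le_trans (by linarith) (neg_le_abs _)

lemma evenDist_of_mem_right {u : ℝ} {m : ℤ} (h1 : 2 * (m : ℝ) + 1 ≤ u) (h2 : u ≤ 2 * m + 2) :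
    evenDist u = 2 * m + 2 - u := by
  refine le_antisymm ?_ ((Metric.le_infDist (Set.range_nonempty _)).2 ?_)
  · refine (Metric.infDist_le_dist_of_mem (Set.mem_range_self (m + 1))).trans (le_of_eq ?_)
    rw [Real.dist_eq, abs_of_nonpos (by push_cast; linarith)]
    push_cast
    ring
  · rintro _ ⟨j, rfl⟩
    rw [Real.dist_eq]
    rcases le_or_gt j m with h | h
    · have : (j : ℝ) ≤ m := by exact_mod_cast h
      exact le_trans (by linarith) (le_abs_self _)
    · have : (m : ℝ) + 1 ≤ j := by exact_mod_cast h
      exact le_trans (by linarith) (neg_le_abs _)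

lemma evenDist_le_one (u : ℝ) : evenDist u ≤ 1 := by
  have h1 := Int.floor_le u
  have h2 := (Int.lt_floor_add_one u).le
  rcases Int.even_or_odd' ⌊u⌋ with ⟨m, hm | hm⟩ <;> rw [hm] at h1 h2 <;> push_cast at h1 h2
  · rw [evenDist_of_mem_left h1 h2]; linarith
  · rw [evenDist_of_mem_right h1 (by linarith)]; linarith

variable {X : Type*} [MetricSpace X]

lemma lipschitzWith_scaled_evenDist {p : X → ℝ} {K : ℝ≥0} (hp : LipschitzWith K p) {δ : ℝ}
    (hδ : 0 < δ) : LipschitzWith K fun x => δ * evenDist (p x / δ) := by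
  refine LipschitzWith.of_dist_le_mul fun x y => ?_
  have h := lipschitzWith_evenDist.dist_le_mul (p x / δ) (p y / δ)
  rw [Real.dist_eq, Real.dist_eq, ← sub_div, abs_div, abs_of_pos hδ, NNReal.coe_one, one_mul,
    le_div_iff₀ hδ] at h
  rw [Real.dist_eq, ← mul_sub, abs_mul, abs_of_pos hδ, mul_comm]
  exact h.trans (hp.dist_le_mul x y)

/-- The difference of `p` and a zigzag of amplitude `δ`, locally constant on the even cells. -/
def stairEven (p : Lip X) (δ : ℝ) (hδ : 0 < δ) : Lip X :=
  ⟨fun x => p.1 x - δ * evenDist (p.1 x / δ),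
    ⟨_, (lipschitzWith_lipReal p).sub (lipschitzWith_scaled_evenDist (lipschitzWith_lipReal p) hδ)⟩⟩

/-- The sum of `p` and a zigzag of amplitude `δ`, locally constant on the odd cells. -/
def stairOdd (p : Lip X) (δ : ℝ) (hδ : 0 < δ) : Lip X :=
  ⟨fun x => p.1 x + δ * evenDist (p.1 x / δ),
    ⟨_, (lipschitzWith_lipReal p).add (lipschitzWith_scaled_evenDist (lipschitzWith_lipReal p) hδ)⟩⟩

lemma stairEven_eq (p : Lip X) {δ : ℝ} (hδ : 0 < δ) {x : X} {m : ℤ}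
    (h : ⌊p.1 x / δ⌋ = 2 * m) : (stairEven p δ hδ).1 x = δ * (2 * m) := by
  have h1 := Int.floor_le (p.1 x / δ)
  have h2 := (Int.lt_floor_add_one (p.1 x / δ)).le
  rw [h] at h1 h2
  push_cast at h1 h2
  simp only [stairEven, evenDist_of_mem_left h1 h2]
  field_simp
  ring

lemma stairOdd_eq (p : Lip X) {δ : ℝ} (hδ : 0 < δ) {x : X} {m : ℤ}
    (h : ⌊p.1 x / δ⌋ = 2 * m + 1) : (stairOdd p δ hδ).1 x = δ * (2 * m + 2) := by
  have h1 := Int.floor_le (p.1 x / δ)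
  have h2 := (Int.lt_floor_add_one (p.1 x / δ)).le
  rw [h] at h1 h2
  push_cast at h1 h2
  simp only [stairOdd, evenDist_of_mem_right h1 (by linarith)]
  field_simp
  ring

lemma tendsto_stairEven (p : Lip X) (x : X) :
    Tendsto (fun n : ℕ => (stairEven p (1 / ((n : ℝ) + 1)) Nat.one_div_pos_of_nat).1 x) atTop
      (𝓝 (p.1 x)) := by
  rw [tendsto_iff_dist_tendsto_zero]
  refine squeeze_zero (fun _ => dist_nonneg) (fun n => ?_) tendsto_one_div_add_atTop_nhds_zero_nat
  have hδ : (0 : ℝ) < 1 / ((n : ℝ) + 1) := Nat.one_div_pos_of_nat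
  rw [Real.dist_eq, stairEven, sub_sub_cancel_left, abs_neg, abs_mul, abs_of_pos hδ,
    abs_of_nonneg (evenDist_nonneg _)]
  exact mul_le_of_le_one_right hδ.le (evenDist_le_one _)

lemma tendsto_stairOdd (p : Lip X) (x : X) :
    Tendsto (fun n : ℕ => (stairOdd p (1 / ((n : ℝ) + 1)) Nat.one_div_pos_of_nat).1 x) atTop
      (𝓝 (p.1 x)) := by
  rw [tendsto_iff_dist_tendsto_zero]
  refine squeeze_zero (fun _ => dist_nonneg) (fun n => ?_) tendsto_one_div_add_atTop_nhds_zero_nat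
  have hδ : (0 : ℝ) < 1 / ((n : ℝ) + 1) := Nat.one_div_pos_of_nat
  rw [Real.dist_eq, stairOdd, add_sub_cancel_left, abs_mul, abs_of_pos hδ,
    abs_of_nonneg (evenDist_nonneg _)]
  exact mul_le_of_le_one_right hδ.le (evenDist_le_one _)

end Staircase

namespace IsMetricCurrent

variable {X : Type*} [MetricSpace X] [MeasurableSpace X] [BorelSpace X] {k : ℕ}
  {T : MetricFunctional X k} {g : X → ℝ}

/-- On the cell ⌊p/δ⌋ = c the function in slot i is constant if c is even, and the one in slot j is
constant if c is odd. Either way one Lipschitz constant in the product is 0. -/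
lemma extend_stair_eq_zero (hT : IsMetricCurrent T) (hg : Integrable g (massMeasure T))
    (π : Fin k → Lip X) {i j : Fin k} (hij : i ≠ j) (p : Lip X) {δ : ℝ} (hδ : 0 < δ) :
    extend T g (Function.update (Function.update π i (stairEven p δ hδ)) j (stairOdd p δ hδ)) =
      0 := by
  set ρ := Function.update (Function.update π i (stairEven p δ hδ)) j (stairOdd p δ hδ) with hρ
  obtain ⟨C, hC⟩ := exists_common_lip ρ
  have hρi : ρ i = stairEven p δ hδ := by simp [hρ, hij]
  have hρj : ρ j = stairOdd p δ hδ := by simp [hρ]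
  have h := hT.abs_extend_le_of_cells hg (π := ρ) (q := fun x => ⌊p.1 x / δ⌋)
    (Int.measurable_floor.comp ((Lip.continuous p).measurable.div_const _))
    (L := fun c => if Even c then Function.update (fun _ => C) i 0
      else Function.update (fun _ => C) j 0) (fun c l => ?_) (w := 0) (integrable_zero _ _ _)
      (fun x => ?_)
  · simpa using h
  · split_ifs with hc
    · rcases eq_or_ne l i with rfl | hl
      · obtain ⟨m, hm⟩ := hc.exists_two_nsmul
        rw [hρi, Function.update_self]
        refine LipschitzOnWith.of_dist_le_mul fun x hx y hy => ?_
        have hx' : ⌊p.1 x / δ⌋ = 2 * m := by simpa [hm] using hx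
        have hy' : ⌊p.1 y / δ⌋ = 2 * m := by simpa [hm] using hy
        simp [stairEven_eq p hδ hx', stairEven_eq p hδ hy']
      · rw [Function.update_of_ne hl]
        exact (hC l).lipschitzOnWith
    · rcases eq_or_ne l j with rfl | hl
      · obtain ⟨m, hm⟩ := Int.not_even_iff_odd.1 hc
        rw [hρj, Function.update_self]
        refine LipschitzOnWith.of_dist_le_mul fun x hx y hy => ?_
        have hx' : ⌊p.1 x / δ⌋ = 2 * m + 1 := by simpa [hm] using hx
        have hy' : ⌊p.1 y / δ⌋ = 2 * m + 1 := by simpa [hm] using hy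
        simp [stairOdd_eq p hδ hx', stairOdd_eq p hδ hy']
      · rw [Function.update_of_ne hl]
        exact (hC l).lipschitzOnWith
  · simp only [Pi.zero_apply]
    refine le_of_eq (mul_eq_zero_of_left ?_ _)
    split_ifs
    · exact Finset.prod_eq_zero (Finset.mem_univ i) (by simp)
    · exact Finset.prod_eq_zero (Finset.mem_univ j) (by simp)

/-- Perturb the two equal entries by opposite zigzags of amplitude δ. The perturbed value is 0 by
`extend_stair_eq_zero`, Lipschitz constants at most double, and δ → 0 recovers π by continuity. -/
lemma extend_eq_zero_of_eq (hT : IsMetricCurrent T) (hg : Integrable g (massMeasure T))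
    (π : Fin k → Lip X) {i j : Fin k} (hπ : π i = π j) (hij : i ≠ j) : extend T g π = 0 := by
  obtain ⟨C, hC⟩ := exists_common_lip π
  have hlip : ∀ l, LipschitzWith (C + C) (π l).1 := fun l => (hC l).weaken le_self_add
  have hr := (lipReal_le (hC i))
  refine tendsto_nhds_unique (hT.tendsto_extend_right hg (π := π) (C := C + C)
    (ρ := fun n : ℕ => Function.update (Function.update π i
      (stairEven (π i) (1 / ((n : ℝ) + 1)) Nat.one_div_pos_of_nat)) j
      (stairOdd (π i) (1 / ((n : ℝ) + 1)) Nat.one_div_pos_of_nat)) (fun n l => ?_)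
    fun l x => ?_) ?_
  · rcases eq_or_ne l j with rfl | hlj
    · rw [Function.update_self]
      exact (hC i).add (lipschitzWith_scaled_evenDist (hC i) Nat.one_div_pos_of_nat)
    · rw [Function.update_of_ne hlj]
      rcases eq_or_ne l i with rfl | hli
      · rw [Function.update_self]
        exact (hC l).sub (lipschitzWith_scaled_evenDist (hC l) Nat.one_div_pos_of_nat)
      · rw [Function.update_of_ne hli]
        exact hlip l
  · rcases eq_or_ne l j with rfl | hlj
    · simp only [Function.update_self]
      rw [← hπ]
      exact tendsto_stairOdd _ x
    · simp only [Function.update_of_ne hlj]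
      rcases eq_or_ne l i with rfl | hli
      · simp only [Function.update_self]
        exact tendsto_stairEven _ x
      · simp only [Function.update_of_ne hli]
        exact tendsto_const_nhds
  · exact tendsto_const_nhds.congr fun n => (hT.extend_stair_eq_zero hg π hij _ _).symm

/-- The alternating map `π ↦ T(g, π)`. -/
def extendAlt (hT : IsMetricCurrent T) (hg : Integrable g (massMeasure T)) :
    Lip X [⋀^Fin k]→ₗ[ℝ] ℝ where
  toFun π := extend T g π
  map_update_add' π i p q := by
    convert (hT.extend_linear_right hg π i).map_add p q
  map_update_smul' π i c p := by
    convert (hT.extend_linear_right hg π i).map_smul c p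
  map_eq_zero_of_eq' π i j h hij := hT.extend_eq_zero_of_eq hg π h hij

end IsMetricCurrent

/-! ### The boundary and integration by parts. -/

section Boundary

variable {X : Type*} [MetricSpace X] [MeasurableSpace X] [BorelSpace X] {k : ℕ}
  {T : MetricFunctional X (k + 1)}

lemma IsMetricCurrent.boundary_eq_extend (hT : IsMetricCurrent T) (f : LipB X)
    (π : Fin k → Lip X) :
    boundary T f π = extend T (fun _ => 1) (Fin.cons (lipBToLip f) π) :=
  (hT.extend_coe lipBOne _).symm

/-- The boundary of a metric current is a metric current as soon as it has finite mass. -/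
lemma IsMetricCurrent.boundary (hT : IsMetricCurrent T)
    (h : ∃ μ : Measure X, IsFiniteMeasure μ ∧ MassBound (boundary T) μ) :
    IsMetricCurrent (boundary T) where
  linear_left π := by
    have h0 : ∀ p : Lip X, Function.update (Fin.cons 0 π : Fin (k + 1) → Lip X) 0 p =
      Fin.cons p π := fun p => Fin.update_cons_zero _ _ _
    constructor
    · intro f f'
      have := (hT.linear_right lipBOne (Fin.cons 0 π) 0).map_add (lipBToLip f) (lipBToLip f')
      simp only [h0] at this
      exact this
    · intro c f
      have := (hT.linear_right lipBOne (Fin.cons 0 π) 0).map_smul c (lipBToLip f)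
      simp only [h0] at this
      exact this
  linear_right f π i := by
    have := hT.linear_right lipBOne (Fin.cons (lipBToLip f) π) i.succ
    simpa only [MetricCurrents.boundary, Fin.cons_update] using this
  locality f π i := by
    rintro ⟨U, hU, c, hc⟩
    have hfin := hT.isFiniteMeasure
    set A : Set X := {x | f.1 x ≠ 0}
    have hA : MeasurableSet A := (isOpen_ne_fun (LipB.continuous f) continuous_const).measurableSet
    have hone : Integrable (fun _ : X => (1 : ℝ)) (massMeasure T) := integrable_const _
    -- On {f ≠ 0} the entry π_i is constant; on the complement the entry f in slot 0 is constantly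
    -- 0. Sharpened locality kills both parts.
    have hsplit : (fun _ : X => (1 : ℝ)) = A.indicator (fun _ => 1) + Aᶜ.indicator fun _ => 1 :=
      (Set.indicator_self_add_compl A _).symm
    rw [hT.boundary_eq_extend, hsplit, hT.extend_add (hone.indicator hA) (hone.indicator hA.compl),
      hT.extend_eq_zero (hone.indicator hA) _ i.succ c fun x hx => ?_,
      hT.extend_eq_zero (hone.indicator hA.compl) _ 0 0 fun x hx => ?_, add_zero]
    · by_contra hne
      exact Set.mem_of_indicator_ne_zero hx hne
    · exact hc x (subset_of_mem_nhdsSet hU (Set.mem_of_indicator_ne_zero hx))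
  continuity f π ρ := by
    rintro ⟨C, hC⟩ hρ
    refine hT.continuity lipBOne _ (fun n => Fin.cons (lipBToLip f) (ρ n))
      ⟨max C (lipReal (lipBToLip f)), fun n i => ?_⟩ fun i x => ?_
    · refine Fin.cases ?_ (fun i => ?_) i
      · exact (lipschitzWith_lipReal (lipBToLip f)).weaken (le_max_right _ _)
      · exact (hC n i).weaken (le_max_left _ _)
    · refine Fin.cases ?_ (fun i => ?_) i
      · exact tendsto_const_nhds
      · exact hρ i x
  finite_mass := h

/-- In T(1, f, π) the first argument 1 may be replaced by the indicator of F, on which slot 0 is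
constant. -/
lemma IsMetricCurrent.boundary_eq_zero (hT : IsMetricCurrent T) {F : Set X} (hF : MeasurableSet F)
    (hFT : massMeasure T Fᶜ = 0) {f : LipB X} (hf : ∀ x ∈ F, f.1 x = 0) (π : Fin k → Lip X) :
    MetricCurrents.boundary T f π = 0 := by
  have hfin := hT.isFiniteMeasure
  have hae : (fun _ : X => (1 : ℝ)) =ᵐ[massMeasure T] F.indicator fun _ => 1 := by
    filter_upwards [compl_mem_ae_iff.2 hFT] with x hx
    rw [compl_compl] at hx
    simp [hx]
  rw [hT.boundary_eq_extend, hT.extend_congr hae]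
  exact hT.extend_eq_zero ((integrable_const _).indicator hF) _ 0 0
    fun x hx => hf x (Set.mem_of_indicator_ne_zero hx)

/-- Replacing f by fη, with a cut-off η equal to 1 on a carrier of ‖T‖, does not change ∂T(f, π). So
the restriction of ‖∂T‖ to a bounded neighbourhood still has the mass bound, and by minimality ‖∂T‖
lives there. -/
lemma HasBoundedSupport.boundary (hsupp : HasBoundedSupport T) (hT : IsMetricCurrent T)
    (hT' : IsMetricCurrent (boundary T)) : HasBoundedSupport (boundary T) := by
  obtain ⟨C, hCb, hC⟩ := hsupp
  have hfin := hT'.isFiniteMeasure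
  set F := closure C
  have hF : massMeasure T Fᶜ = 0 :=
    measure_mono_null (Set.compl_subset_compl.2 subset_closure) hC
  set η : LipB X := cutoff F 1 one_pos
  set V := Metric.thickening 1 F
  have hV : MeasurableSet V := Metric.isOpen_thickening.measurableSet
  refine ⟨V, hCb.closure.thickening, ?_⟩
  have hle : massMeasure (MetricCurrents.boundary T) ≤
      (massMeasure (MetricCurrents.boundary T)).restrict V := by
    refine massMeasure_le (massBound_iff.2 fun f π => ?_)
    have h1 : MetricCurrents.boundary T f π = MetricCurrents.boundary T (mulB f η) π := by
      have h3 : ∀ x ∈ F, (f - mulB f η).1 x = 0 := fun x hx => by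
        have : (f - mulB f η).1 x = f.1 x - f.1 x * η.1 x := rfl
        rw [this, cutoff_eq_one one_pos hx, mul_one, sub_self]
      have h2 := (hT'.linear_left π).map_sub f (mulB f η)
      rw [hT.boundary_eq_zero isClosed_closure.measurableSet hF h3] at h2
      linarith
    rw [h1]
    refine (massBound_iff.1 hT'.massBound _ π).trans ?_
    refine mul_le_mul_of_nonneg_left ?_ (NNReal.coe_nonneg _)
    rw [← integral_indicator hV]
    refine integral_mono (LipB.integrable _ _).abs ((LipB.integrable f _).abs.indicator hV)
      fun x => ?_
    by_cases hx : x ∈ V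
    · simp only [mulB, Set.indicator_of_mem hx, abs_mul, η, abs_of_nonneg (cutoff_nonneg F _ x)]
      exact mul_le_of_le_one_right (abs_nonneg _) (cutoff_le_one F _ x)
    · simp only [mulB, η, cutoff_eq_zero one_pos hx, Set.indicator_of_notMem hx]
      simp
  refine le_antisymm ((hle _).trans (le_of_eq ?_)) zero_le
  rw [Measure.restrict_apply hV.compl]
  simp

/-- Integration by parts for normal currents. -/
lemma IsNormalCurrent.apply_cons (hT : IsNormalCurrent T) (f : LipB X) (σ : Lip X) {M : ℝ}
    (hM : ∀ᵐ x ∂(massMeasure T), |σ.1 x| ≤ M)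
    (hM' : ∀ᵐ x ∂(massMeasure (boundary T)), |σ.1 x| ≤ M) (ρ : Fin k → Lip X) :
    T f (Fin.cons σ ρ) = extend (boundary T) (fun x => f.1 x * σ.1 x) ρ -
      extend T σ.1 (Fin.cons (lipBToLip f) ρ) := by
  obtain ⟨hT, hT'⟩ := hT
  have hfin := hT.isFiniteMeasure
  -- The product rule needs bounded functions. Truncating σ at M is invisible to both T and ∂T,
  -- since |σ| ≤ M almost everywhere for both mass measures.
  set σ' : LipB X := truncate M σ with hσ'
  have htr : ∀ x, |σ.1 x| ≤ M → σ'.1 x = σ.1 x := fun x hx => max_min_eq_self hx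
  set A : Set X := {x | |σ.1 x| ≤ M}
  have hA : MeasurableSet A :=
    (isClosed_le (Lip.continuous σ).abs continuous_const).measurableSet
  have hfA : f.1 =ᵐ[massMeasure T] A.indicator f.1 := by
    filter_upwards [hM] with x hx
    exact (Set.indicator_of_mem (show x ∈ A from hx) _).symm
  have h1 : T f (Fin.cons σ ρ) = T f (Fin.cons (lipBToLip σ') ρ) := by
    rw [← hT.extend_coe, ← hT.extend_coe, hT.extend_congr hfA, hT.extend_congr hfA]
    refine hT.extend_congr_right ((LipB.integrable f _).indicator hA) fun i x hx => ?_
    have hxA : x ∈ A := Set.mem_of_indicator_ne_zero hx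
    refine Fin.cases ?_ (fun i => ?_) i
    · exact (htr x hxA).symm
    · rfl
  -- With first argument 1, the right-hand side of the product rule is ∂T(fσ', ρ).
  have h2 := hT.extend_leibniz (g := fun _ => 1) (integrable_const _) f σ'
    (Fin.cons (lipBToLip f) ρ) 0
  simp only [Fin.update_cons_zero, one_mul] at h2
  rw [← hT.boundary_eq_extend, hT.extend_coe, ← hT'.extend_coe] at h2
  have h3 : extend (boundary T) (mulB f σ').1 ρ =
      extend (boundary T) (fun x => f.1 x * σ.1 x) ρ := by
    refine hT'.extend_congr ?_ ρ
    filter_upwards [hM'] with x hx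
    simp only [mulB, htr x hx]
  have h4 : extend T (fun x => σ'.1 x) (Fin.cons (lipBToLip f) ρ) =
      extend T σ.1 (Fin.cons (lipBToLip f) ρ) := by
    refine hT.extend_congr ?_ _
    filter_upwards [hM] with x hx
    exact htr x hx
  rw [h1, ← h3, ← h4, ← h2]
  ring

end Boundary

end MetricCurrents

end

noncomputable section

namespace MetricCurrents

/-! ### The affine homotopy and its time difference quotients. -/

section AffineHomotopy

variable {B : Type*} [NormedAddCommGroup B] [NormedSpace ℝ B] {φ ψ : B → B}

lemma IsLip.continuous {X Y : Type*} [PseudoEMetricSpace X] [PseudoEMetricSpace Y] {f : X → Y}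
    (h : IsLip f) : Continuous f := by
  obtain ⟨K, hK⟩ := h
  exact hK.continuous

lemma affineHomotopy_sub (φ ψ : B → B) (s t : ℝ) (x : B) :
    affineHomotopy φ ψ s x - affineHomotopy φ ψ t x = (s - t) • (φ x - ψ x) := by
  simp only [affineHomotopy]
  module

lemma continuous_affineHomotopy (hφ : IsLip φ) (hψ : IsLip ψ) :
    Continuous fun q : ℝ × B => affineHomotopy φ ψ q.1 q.2 := by
  have h1 := hφ.continuous
  have h2 := hψ.continuous
  unfold affineHomotopy
  fun_prop

/-- The constant comes from |t| + |1 − t| ≤ 1 + 2b. Times outside [0,1] are admitted because forward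
difference quotients reach beyond t = 1. -/
lemma lipschitzWith_affineHomotopy {K b : ℝ≥0} (hφ : LipschitzWith K φ) (hψ : LipschitzWith K ψ)
    {t : ℝ} (ht : |t| ≤ b) : LipschitzWith ((1 + 2 * b) * K) (affineHomotopy φ ψ t) := by
  refine LipschitzWith.of_dist_le_mul fun x y => ?_
  have h1 := hφ.dist_le_mul x y
  have h2 := hψ.dist_le_mul x y
  have h3 : affineHomotopy φ ψ t x - affineHomotopy φ ψ t y =
      t • (φ x - φ y) + (1 - t) • (ψ x - ψ y) := by
    simp only [affineHomotopy]
    module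
  have h4 : |1 - t| ≤ 1 + b := (abs_sub _ _).trans (by simpa using ht)
  rw [dist_eq_norm] at h1 h2 ⊢
  rw [h3]
  refine (norm_add_le _ _).trans ?_
  rw [norm_smul, norm_smul, Real.norm_eq_abs, Real.norm_eq_abs]
  calc _ ≤ (b : ℝ) * (K * dist x y) + (1 + b) * (K * dist x y) := by gcongr
    _ = _ := by push_cast; ring

lemma lipschitzWith_comp_affineHomotopy (p : Lip B) (φ ψ : B → B) (x : B) :
    LipschitzWith (lipReal p * ‖φ x - ψ x‖₊) fun s => p.1 (affineHomotopy φ ψ s x) := by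
  refine LipschitzWith.of_dist_le_mul fun s t => ?_
  refine ((lipschitzWith_lipReal p).dist_le_mul _ _).trans (le_of_eq ?_)
  rw [dist_eq_norm, affineHomotopy_sub, norm_smul, Real.dist_eq, Real.norm_eq_abs]
  push_cast
  ring

lemma abs_deriv_comp_affineHomotopy_le (p : Lip B) (φ ψ : B → B) (t : ℝ) (x : B) :
    |deriv (fun s => p.1 (affineHomotopy φ ψ s x)) t| ≤ lipReal p * ‖φ x - ψ x‖ := by
  simpa using norm_deriv_le_of_lipschitz (x₀ := t) (lipschitzWith_comp_affineHomotopy p φ ψ x)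

lemma abs_homotopyWeight_le (φ ψ : B → B) (f : B → ℝ) (p : Lip B) (t : ℝ) (x : B) :
    |homotopyWeight φ ψ f p.1 t x| ≤
      |f (affineHomotopy φ ψ t x)| * (lipReal p * ‖φ x - ψ x‖) := by
  rw [homotopyWeight, abs_mul]
  exact mul_le_mul_of_nonneg_left (abs_deriv_comp_affineHomotopy_le p φ ψ t x) (abs_nonneg _)

/-- The composition `p ∘ h(t, ·)` with the homotopy at time `t`. -/
def slice (hφ : IsLip φ) (hψ : IsLip ψ) (t : ℝ) (p : Lip B) : Lip B :=
  lipComp p (affineHomotopy φ ψ t) (isLip_affineHomotopy hφ hψ t)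

lemma slice_apply (hφ : IsLip φ) (hψ : IsLip ψ) (t : ℝ) (p : Lip B) (x : B) :
    (slice hφ hψ t p).1 x = p.1 (affineHomotopy φ ψ t x) := rfl

/-- The composition `p ↦ p ∘ h(t, ·)` as a linear map. -/
def sliceLM (hφ : IsLip φ) (hψ : IsLip ψ) (t : ℝ) : Lip B →ₗ[ℝ] Lip B where
  toFun := slice hφ hψ t
  map_add' _ _ := rfl
  map_smul' _ _ := rfl

lemma exists_lipschitzWith_slice (hφ : IsLip φ) (hψ : IsLip ψ) {k : ℕ} (π : Fin k → Lip B)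
    (b : ℝ) : ∃ C : ℝ≥0, ∀ t, |t| ≤ b → ∀ j, LipschitzWith C (slice hφ hψ t (π j)).1 := by
  obtain ⟨K, hK⟩ := id hφ
  obtain ⟨L, hL⟩ := id hψ
  obtain ⟨C, hC⟩ := exists_common_lip π
  refine ⟨C * ((1 + 2 * b.toNNReal) * max K L), fun t ht j => (hC j).comp ?_⟩
  exact lipschitzWith_affineHomotopy (hK.weaken (le_max_left _ _)) (hL.weaken (le_max_right _ _))
    (ht.trans (Real.le_coe_toNNReal b))

lemma continuous_slice (hφ : IsLip φ) (hψ : IsLip ψ) (p : Lip B) (x : B) :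
    Continuous fun t => (slice hφ hψ t p).1 x :=
  (lipschitzWith_comp_affineHomotopy p φ ψ x).continuous

/-- The forward difference quotient in time of `p ∘ h`, with time step `1 / (n + 1)`. -/
def diffQuot (hφ : IsLip φ) (hψ : IsLip ψ) (p : Lip B) (n : ℕ) (t : ℝ) : Lip B :=
  ((n : ℝ) + 1) • (slice hφ hψ (t + 1 / ((n : ℝ) + 1)) p - slice hφ hψ t p)

lemma diffQuot_apply (hφ : IsLip φ) (hψ : IsLip ψ) (p : Lip B) (n : ℕ) (t : ℝ) (x : B) :
    (diffQuot hφ hψ p n t).1 x = ((n : ℝ) + 1) *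
      (p.1 (affineHomotopy φ ψ (t + 1 / ((n : ℝ) + 1)) x) - p.1 (affineHomotopy φ ψ t x)) := rfl

lemma abs_diffQuot_le (hφ : IsLip φ) (hψ : IsLip ψ) (p : Lip B) (n : ℕ) (t : ℝ) (x : B) :
    |(diffQuot hφ hψ p n t).1 x| ≤ lipReal p * ‖φ x - ψ x‖ := by
  have h := (lipschitzWith_comp_affineHomotopy p φ ψ x).dist_le_mul (t + 1 / ((n : ℝ) + 1)) t
  have hn : (0 : ℝ) < (n : ℝ) + 1 := by positivity
  rw [Real.dist_eq, Real.dist_eq, add_sub_cancel_left,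
    abs_of_pos (by positivity : (0 : ℝ) < 1 / ((n : ℝ) + 1))] at h
  rw [diffQuot_apply, abs_mul, abs_of_pos hn]
  calc _ ≤ ((n : ℝ) + 1) * _ := mul_le_mul_of_nonneg_left h hn.le
    _ = _ := by push_cast; field_simp

lemma continuous_diffQuot (hφ : IsLip φ) (hψ : IsLip ψ) (p : Lip B) (n : ℕ) (x : B) :
    Continuous fun t => (diffQuot hφ hψ p n t).1 x := by
  have h := continuous_slice hφ hψ p x
  simp only [slice_apply] at h
  simp only [diffQuot_apply]
  exact continuous_const.mul ((h.comp (continuous_add_const _)).sub h)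

lemma tendsto_diffQuot (hφ : IsLip φ) (hψ : IsLip ψ) (p : Lip B) {t : ℝ} {x : B}
    (h : DifferentiableAt ℝ (fun s => p.1 (affineHomotopy φ ψ s x)) t) :
    Tendsto (fun n => (diffQuot hφ hψ p n t).1 x) atTop
      (𝓝 (deriv (fun s => p.1 (affineHomotopy φ ψ s x)) t)) := by
  have h1 := h.hasDerivAt.tendsto_slope_zero
  have h2 : Tendsto (fun n : ℕ => 1 / ((n : ℝ) + 1)) atTop (𝓝[≠] 0) :=
    tendsto_nhdsWithin_iff.2 ⟨tendsto_one_div_add_atTop_nhds_zero_nat,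
      Eventually.of_forall fun n => (Nat.one_div_pos_of_nat (α := ℝ)).ne'⟩
  refine (h1.comp h2).congr fun n => ?_
  simp [diffQuot_apply]

variable [MeasurableSpace B] [BorelSpace B]

lemma continuous_uncurry_comp (hφ : IsLip φ) (hψ : IsLip ψ) (p : Lip B) :
    Continuous (Function.uncurry fun (x : B) (s : ℝ) => p.1 (affineHomotopy φ ψ s x)) :=
  (Lip.continuous p).comp ((continuous_affineHomotopy hφ hψ).comp continuous_swap)

lemma measurable_homotopyWeight (hφ : IsLip φ) (hψ : IsLip ψ) (f p : Lip B) (t : ℝ) :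
    Measurable (homotopyWeight φ ψ f.1 p.1 t) := by
  have h := (measurable_deriv_with_param (continuous_uncurry_comp hφ hψ p)).comp
    (measurable_prodMk_right (y := t))
  exact (Lip.continuous (slice hφ hψ t f)).measurable.mul h

/-- For almost every time, `p ∘ h` is differentiable in time almost everywhere. -/
lemma ae_ae_differentiableAt (hφ : IsLip φ) (hψ : IsLip ψ) (p : Lip B) (μ : Measure B)
    [SFinite μ] : ∀ᵐ t : ℝ, ∀ᵐ x ∂μ,
      DifferentiableAt ℝ (fun s => p.1 (affineHomotopy φ ψ s x)) t := by
  -- For each fixed x the function is Lipschitz in time, so Rademacher's theorem on ℝ applies;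
  -- Fubini exchanges the quantifiers.
  refine (Measure.ae_ae_comm (measurableSet_of_differentiableAt_with_param ℝ
    (continuous_uncurry_comp hφ hψ p))).1 ?_
  exact ae_of_all _ fun x => (lipschitzWith_comp_affineHomotopy p φ ψ x).ae_differentiableAt_real

end AffineHomotopy

/-! ### Convergence of the integrals defining H. -/

section HomotopyTerm

variable {B : Type*} [NormedAddCommGroup B] [NormedSpace ℝ B] [MeasurableSpace B] [BorelSpace B]
  {φ ψ : B → B} {k : ℕ} {S : MetricFunctional B k}

lemma HasBoundedSupport.exists_ae_norm_le (hsupp : HasBoundedSupport S) :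
    ∃ R : ℝ, 0 ≤ R ∧ ∀ᵐ x ∂(massMeasure S), ‖x‖ ≤ R := by
  obtain ⟨C, hC, hCS⟩ := hsupp
  obtain ⟨R, hR⟩ := isBounded_iff_forall_norm_le.1 hC
  refine ⟨max R 0, le_max_right _ _, ?_⟩
  rw [← compl_compl C] at hR
  filter_upwards [compl_mem_ae_iff.2 hCS] with x hx
  exact (hR x hx).trans (le_max_left _ _)

lemma exists_displacement_le (hφ : IsLip φ) (hψ : IsLip ψ) (R : ℝ) :
    ∃ D : ℝ, 0 ≤ D ∧ ∀ x, ‖x‖ ≤ R → ‖φ x - ψ x‖ ≤ D := by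
  obtain ⟨K, hK⟩ := hφ
  obtain ⟨L, hL⟩ := hψ
  refine ⟨‖φ 0 - ψ 0‖ + (K + L) * |R|, by positivity, fun x hx => ?_⟩
  have h1 := (hK.sub hL).dist_le_mul x 0
  rw [dist_eq_norm, dist_zero_right] at h1
  have h2 : φ x - ψ x = (φ 0 - ψ 0) + ((φ x - ψ x) - (φ 0 - ψ 0)) := by abel
  rw [h2]
  refine (norm_add_le _ _).trans (add_le_add le_rfl (h1.trans ?_))
  push_cast
  have := hx.trans (le_abs_self R)
  gcongr

lemma HasBoundedSupport.exists_ae_displacement_le (hsupp : HasBoundedSupport S) (hφ : IsLip φ)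
    (hψ : IsLip ψ) : ∃ D : ℝ, 0 ≤ D ∧ ∀ᵐ x ∂(massMeasure S), ‖φ x - ψ x‖ ≤ D := by
  obtain ⟨R, -, hR⟩ := hsupp.exists_ae_norm_le
  obtain ⟨D, hD0, hD⟩ := exists_displacement_le hφ hψ R
  exact ⟨D, hD0, hR.mono hD⟩

/-- The value `S(f ∘ h ∂(p ∘ h)/∂t, ρ ∘ h)` at time `t`. -/
def timeTerm (S : MetricFunctional B k) (hφ : IsLip φ) (hψ : IsLip ψ) (f : LipB B) (p : Lip B)
    (ρ : Fin k → Lip B) (t : ℝ) : ℝ :=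
  extend S (homotopyWeight φ ψ f.1 p.1 t) fun j => slice hφ hψ t (ρ j)

lemma homotopyTerm_eq (S : MetricFunctional B k) (hφ : IsLip φ) (hψ : IsLip ψ) (f : LipB B)
    (π : Fin (k + 1) → Lip B) (i : Fin (k + 1)) :
    homotopyTerm φ ψ hφ hψ S f π i = timeTerm S hφ hψ f (π i) (i.removeNth π) := rfl

/-- The weight is bounded by LIP(p)|f ∘ h|‖φ − ψ‖. The displacement may grow linearly, and it is
bounded support that makes it essentially bounded. -/
lemma integrable_homotopyWeight (hS : IsMetricCurrent S) (hsupp : HasBoundedSupport S)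
    (hφ : IsLip φ) (hψ : IsLip ψ) (f : LipB B) (p : Lip B) (t : ℝ) :
    Integrable (homotopyWeight φ ψ f.1 p.1 t) (massMeasure S) := by
  have := hS.isFiniteMeasure
  obtain ⟨D, hD0, hD⟩ := hsupp.exists_ae_displacement_le hφ hψ
  obtain ⟨C, hC0, hC⟩ := LipB.exists_bound f
  refine Integrable.of_bound
    (measurable_homotopyWeight hφ hψ (lipBToLip f) p t).aestronglyMeasurable
    (C * (lipReal p * D)) ?_
  filter_upwards [hD] with x hx
  refine (abs_homotopyWeight_le φ ψ f.1 p t x).trans ?_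
  gcongr
  exact hC _

/-- For almost every time, evaluations on difference quotients converge to the time term. -/
lemma ae_tendsto_timeTerm (hS : IsMetricCurrent S) (hsupp : HasBoundedSupport S)
    (hφ : IsLip φ) (hψ : IsLip ψ) (f : LipB B) (p : Lip B) :
    ∀ᵐ t : ℝ, ∀ (ρ : Fin k → Lip B) (σ : ℕ → Fin k → Lip B) (C : ℝ≥0),
      (∀ n j, LipschitzWith C (σ n j).1) →
      (∀ j x, Tendsto (fun n => (σ n j).1 x) atTop (𝓝 ((slice hφ hψ t (ρ j)).1 x))) →
      Tendsto (fun n => extend S (fun x => f.1 (affineHomotopy φ ψ t x) *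
        (diffQuot hφ hψ p n t).1 x) (σ n)) atTop (𝓝 (timeTerm S hφ hψ f p ρ t)) := by
  have := hS.isFiniteMeasure
  obtain ⟨D, hD0, hD⟩ := hsupp.exists_ae_displacement_le hφ hψ
  obtain ⟨M, hM0, hM⟩ := LipB.exists_bound f
  filter_upwards [ae_ae_differentiableAt hφ hψ p (massMeasure S)] with t ht ρ σ C hC hσ
  refine hS.tendsto_extend (M := M * (lipReal p * D)) (fun n => ?_) (fun n => ?_) ?_ hC hσ
  · exact ((Lip.continuous (slice hφ hψ t (lipBToLip f))).mul
      (Lip.continuous (diffQuot hφ hψ p n t))).aestronglyMeasurable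
  · filter_upwards [hD] with x hx
    rw [abs_mul]
    have h1 := abs_diffQuot_le hφ hψ p n t x
    exact mul_le_mul (hM _) (h1.trans (by gcongr)) (abs_nonneg _) hM0
  · filter_upwards [ht] with x hx
    exact (tendsto_diffQuot hφ hψ p hx).const_mul _

lemma continuous_extend_diffQuot (hS : IsMetricCurrent S) (hsupp : HasBoundedSupport S)
    (hφ : IsLip φ) (hψ : IsLip ψ) (f : LipB B) (p : Lip B) (ρ : Fin k → Lip B) (n : ℕ) :
    Continuous fun t => extend S (fun x => f.1 (affineHomotopy φ ψ t x) *
        (diffQuot hφ hψ p n t).1 x) fun j => slice hφ hψ t (ρ j) := by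
  obtain ⟨D, hD0, hD⟩ := hsupp.exists_ae_displacement_le hφ hψ
  obtain ⟨M, hM0, hM⟩ := LipB.exists_bound f
  rw [continuous_iff_seqContinuous]
  intro u t hu
  obtain ⟨b, hb⟩ := (Metric.isBounded_range_of_tendsto u hu).exists_norm_le
  obtain ⟨C, hC⟩ := exists_lipschitzWith_slice hφ hψ ρ b
  refine hS.tendsto_extend (M := M * (lipReal p * D)) (fun m => ?_) (fun m => ?_) ?_
    (C := C) (fun m j => hC _ (hb _ (Set.mem_range_self m)) j) fun j x => ?_
  · exact ((Lip.continuous (slice hφ hψ _ (lipBToLip f))).mul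
      (Lip.continuous (diffQuot hφ hψ p n _))).aestronglyMeasurable
  · filter_upwards [hD] with x hx
    rw [abs_mul]
    have h1 := abs_diffQuot_le hφ hψ p n (u m) x
    exact mul_le_mul (hM _) (h1.trans (by gcongr)) (abs_nonneg _) hM0
  · refine ae_of_all _ fun x => ?_
    have h1 := ((continuous_slice hφ hψ (lipBToLip f) x).tendsto t).comp hu
    have h2 := ((continuous_diffQuot hφ hψ p n x).tendsto t).comp hu
    exact h1.mul h2
  · exact ((continuous_slice hφ hψ (ρ j) x).tendsto t).comp hu

/-- The time derivative need not depend continuously on t. With a difference quotient of fixed step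
in its place the term is continuous in t, and these converge for almost every t. -/
lemma aestronglyMeasurable_timeTerm (hS : IsMetricCurrent S) (hsupp : HasBoundedSupport S)
    (hφ : IsLip φ) (hψ : IsLip ψ) (f : LipB B) (p : Lip B) (ρ : Fin k → Lip B) :
    AEStronglyMeasurable (timeTerm S hφ hψ f p ρ) volume := by
  refine aestronglyMeasurable_of_tendsto_ae atTop (fun n =>
    (continuous_extend_diffQuot hS hsupp hφ hψ f p ρ n).aestronglyMeasurable) ?_
  filter_upwards [ae_tendsto_timeTerm hS hsupp hφ hψ f p] with t ht
  obtain ⟨C, hC⟩ := exists_lipschitzWith_slice hφ hψ ρ |t|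
  exact ht ρ _ C (fun _ => hC t le_rfl) fun _ _ => tendsto_const_nhds

lemma exists_abs_timeTerm_le (hS : IsMetricCurrent S) (hsupp : HasBoundedSupport S)
    (hφ : IsLip φ) (hψ : IsLip ψ) (f : LipB B) (p : Lip B) (ρ : Fin k → Lip B) :
    ∃ A : ℝ, ∀ t ∈ Set.Icc (0 : ℝ) 1, |timeTerm S hφ hψ f p ρ t| ≤ A := by
  have := hS.isFiniteMeasure
  obtain ⟨D, hD0, hD⟩ := hsupp.exists_ae_displacement_le hφ hψ
  obtain ⟨M, hM0, hM⟩ := LipB.exists_bound f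
  obtain ⟨C, hC⟩ := exists_lipschitzWith_slice hφ hψ ρ 1
  refine ⟨C ^ k * ∫ _, M * (lipReal p * D) ∂(massMeasure S), fun t ht => ?_⟩
  refine (hS.abs_extend_le_pow (integrable_homotopyWeight hS hsupp hφ hψ f p t)
    (hC t (abs_le.2 ⟨by linarith [ht.1], ht.2⟩))).trans ?_
  refine mul_le_mul_of_nonneg_left (integral_mono_ae
    (integrable_homotopyWeight hS hsupp hφ hψ f p t).abs (integrable_const _) ?_) (by positivity)
  filter_upwards [hD] with x hx
  refine (abs_homotopyWeight_le φ ψ f.1 p t x).trans ?_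
  gcongr
  exact hM _

lemma intervalIntegrable_timeTerm (hS : IsMetricCurrent S) (hsupp : HasBoundedSupport S)
    (hφ : IsLip φ) (hψ : IsLip ψ) (f : LipB B) (p : Lip B) (ρ : Fin k → Lip B) :
    IntervalIntegrable (timeTerm S hφ hψ f p ρ) volume 0 1 := by
  obtain ⟨A, hA⟩ := exists_abs_timeTerm_le hS hsupp hφ hψ f p ρ
  rw [intervalIntegrable_iff_integrableOn_Ioc_of_le zero_le_one]
  refine Integrable.of_bound
    (aestronglyMeasurable_timeTerm hS hsupp hφ hψ f p ρ).restrict A ?_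
  filter_upwards [ae_restrict_mem measurableSet_Ioc] with t ht
  exact hA t ⟨ht.1.le, ht.2⟩

theorem homotopyConverges (hS : IsMetricCurrent S) (hsupp : HasBoundedSupport S)
    (hφ : IsLip φ) (hψ : IsLip ψ) : HomotopyConverges φ ψ hφ hψ S := fun f π i =>
  ⟨fun t _ => integrable_homotopyWeight hS hsupp hφ hψ f (π i) t,
    intervalIntegrable_timeTerm hS hsupp hφ hψ f (π i) (i.removeNth π)⟩

end HomotopyTerm

end MetricCurrents

end

noncomputable section

namespace MetricCurrents

/-! ### Multilinearity, alternation and locality of H. -/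

section HomotopyFunctional

variable {B : Type*} [NormedAddCommGroup B] [NormedSpace ℝ B] [MeasurableSpace B] [BorelSpace B]
  {φ ψ : B → B} {k : ℕ} {S : MetricFunctional B k}

lemma timeTerm_add_left (hS : IsMetricCurrent S) (hsupp : HasBoundedSupport S) (hφ : IsLip φ)
    (hψ : IsLip ψ) (f f' : LipB B) (p : Lip B) (ρ : Fin k → Lip B) (t : ℝ) :
    timeTerm S hφ hψ (f + f') p ρ t = timeTerm S hφ hψ f p ρ t + timeTerm S hφ hψ f' p ρ t := by
  unfold timeTerm
  rw [← hS.extend_add (integrable_homotopyWeight hS hsupp hφ hψ f p t)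
    (integrable_homotopyWeight hS hsupp hφ hψ f' p t)]
  congr 1
  ext x
  simp [homotopyWeight, add_mul]

lemma timeTerm_smul_left (hS : IsMetricCurrent S) (hsupp : HasBoundedSupport S) (hφ : IsLip φ)
    (hψ : IsLip ψ) (c : ℝ) (f : LipB B) (p : Lip B) (ρ : Fin k → Lip B) (t : ℝ) :
    timeTerm S hφ hψ (c • f) p ρ t = c * timeTerm S hφ hψ f p ρ t := by
  unfold timeTerm
  rw [← hS.extend_smul (integrable_homotopyWeight hS hsupp hφ hψ f p t)]
  congr 1
  ext x
  simp [homotopyWeight, mul_assoc]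

/-- Additivity in p can fail at times where a derivative is missing and takes the default value 0.
Such times are negligible, so the time integral is additive. -/
lemma ae_timeTerm_add (hS : IsMetricCurrent S) (hsupp : HasBoundedSupport S) (hφ : IsLip φ)
    (hψ : IsLip ψ) (f : LipB B) (p q : Lip B) (ρ : Fin k → Lip B) :
    ∀ᵐ t : ℝ, timeTerm S hφ hψ f (p + q) ρ t =
      timeTerm S hφ hψ f p ρ t + timeTerm S hφ hψ f q ρ t := by
  have hfin := hS.isFiniteMeasure
  filter_upwards [ae_ae_differentiableAt hφ hψ p (massMeasure S),
    ae_ae_differentiableAt hφ hψ q (massMeasure S)] with t h1 h2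
  unfold timeTerm
  rw [← hS.extend_add (integrable_homotopyWeight hS hsupp hφ hψ f p t)
    (integrable_homotopyWeight hS hsupp hφ hψ f q t)]
  refine hS.extend_congr ?_ _
  filter_upwards [h1, h2] with x h1 h2
  have h3 := deriv_fun_add h1 h2
  simp only [homotopyWeight, Pi.add_apply, Submodule.coe_add]
  rw [h3]
  ring

lemma ae_timeTerm_smul (hS : IsMetricCurrent S) (hsupp : HasBoundedSupport S) (hφ : IsLip φ)
    (hψ : IsLip ψ) (f : LipB B) (c : ℝ) (p : Lip B) (ρ : Fin k → Lip B) :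
    ∀ᵐ t : ℝ, timeTerm S hφ hψ f (c • p) ρ t = c * timeTerm S hφ hψ f p ρ t := by
  have hfin := hS.isFiniteMeasure
  filter_upwards [ae_ae_differentiableAt hφ hψ p (massMeasure S)] with t h1
  unfold timeTerm
  rw [← hS.extend_smul (integrable_homotopyWeight hS hsupp hφ hψ f p t)]
  refine hS.extend_congr ?_ _
  filter_upwards [h1] with x h1
  have h3 := deriv_const_mul c h1
  simp only [homotopyWeight, Pi.smul_apply, smul_eq_mul, Submodule.coe_smul]
  rw [h3]
  ring

/-- The alternating map `ρ ↦ S(f ∘ h ∂(p ∘ h)/∂t, ρ ∘ h)` at time `t`. -/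
def timeTermAlt (hS : IsMetricCurrent S) (hsupp : HasBoundedSupport S) (hφ : IsLip φ)
    (hψ : IsLip ψ) (f : LipB B) (p : Lip B) (t : ℝ) : Lip B [⋀^Fin k]→ₗ[ℝ] ℝ :=
  (hS.extendAlt (integrable_homotopyWeight hS hsupp hφ hψ f p t)).compLinearMap (sliceLM hφ hψ t)

lemma timeTermAlt_apply (hS : IsMetricCurrent S) (hsupp : HasBoundedSupport S) (hφ : IsLip φ)
    (hψ : IsLip ψ) (f : LipB B) (p : Lip B) (t : ℝ) (ρ : Fin k → Lip B) :
    timeTermAlt hS hsupp hφ hψ f p t ρ = timeTerm S hφ hψ f p ρ t := rfl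

/-- The time integral of the time terms, as an alternating map. -/
def timeIntegralAlt (hS : IsMetricCurrent S) (hsupp : HasBoundedSupport S) (hφ : IsLip φ)
    (hψ : IsLip ψ) (f : LipB B) (p : Lip B) : Lip B [⋀^Fin k]→ₗ[ℝ] ℝ where
  toFun ρ := ∫ t in (0 : ℝ)..1, timeTerm S hφ hψ f p ρ t
  map_update_add' ρ i a b := by
    rw [← intervalIntegral.integral_add (intervalIntegrable_timeTerm hS hsupp hφ hψ f p _)
      (intervalIntegrable_timeTerm hS hsupp hφ hψ f p _)]
    simp only [← timeTermAlt_apply hS hsupp]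
    exact intervalIntegral.integral_congr fun t _ =>
      (timeTermAlt hS hsupp hφ hψ f p t).map_update_add ρ i a b
  map_update_smul' ρ i c a := by
    rw [← intervalIntegral.integral_smul]
    simp only [← timeTermAlt_apply hS hsupp]
    exact intervalIntegral.integral_congr fun t _ =>
      (timeTermAlt hS hsupp hφ hψ f p t).map_update_smul ρ i c a
  map_eq_zero_of_eq' ρ i j h hij := by
    simp only [← timeTermAlt_apply hS hsupp]
    simp only [AlternatingMap.map_eq_zero_of_eq _ ρ h hij, intervalIntegral.integral_zero]

lemma timeIntegralAlt_apply (hS : IsMetricCurrent S) (hsupp : HasBoundedSupport S) (hφ : IsLip φ)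
    (hψ : IsLip ψ) (f : LipB B) (p : Lip B) (ρ : Fin k → Lip B) :
    timeIntegralAlt hS hsupp hφ hψ f p ρ = ∫ t in (0 : ℝ)..1, timeTerm S hφ hψ f p ρ t := rfl

/-- The functional `π ↦ H(S)(f, π)` as an alternating map. -/
def homotopyAlt (hS : IsMetricCurrent S) (hsupp : HasBoundedSupport S) (hφ : IsLip φ)
    (hψ : IsLip ψ) (f : LipB B) : Lip B [⋀^Fin (k + 1)]→ₗ[ℝ] ℝ :=
  AlternatingMap.alternatizeUncurryFin
    { toFun := timeIntegralAlt hS hsupp hφ hψ f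
      map_add' := fun p q => by
        ext ρ
        simp only [AlternatingMap.add_apply, timeIntegralAlt_apply]
        rw [← intervalIntegral.integral_add (intervalIntegrable_timeTerm hS hsupp hφ hψ f p _)
          (intervalIntegrable_timeTerm hS hsupp hφ hψ f q _)]
        refine intervalIntegral.integral_congr_ae ?_
        filter_upwards [ae_timeTerm_add hS hsupp hφ hψ f p q ρ] with t ht _ using ht
      map_smul' := fun c p => by
        ext ρ
        simp only [AlternatingMap.smul_apply, timeIntegralAlt_apply, RingHom.id_apply, smul_eq_mul]
        rw [← intervalIntegral.integral_const_mul]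
        refine intervalIntegral.integral_congr_ae ?_
        filter_upwards [ae_timeTerm_smul hS hsupp hφ hψ f c p ρ] with t ht _ using ht }

/-- The sum with signs defining H(S) is precisely the alternatization of a linear map with values in
alternating maps, so H(S) is alternating and multilinear at once. -/
lemma homotopyAlt_apply (hS : IsMetricCurrent S) (hsupp : HasBoundedSupport S) (hφ : IsLip φ)
    (hψ : IsLip ψ) (f : LipB B) (π : Fin (k + 1) → Lip B) :
    homotopyAlt hS hsupp hφ hψ f π = homotopyFunctional φ ψ hφ hψ S f π := by
  rw [homotopyAlt, AlternatingMap.alternatizeUncurryFin_apply]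
  refine Finset.sum_congr rfl fun i _ => ?_
  rw [zsmul_eq_mul]
  push_cast
  rfl

lemma homotopyFunctional_linear_left (hS : IsMetricCurrent S) (hsupp : HasBoundedSupport S)
    (hφ : IsLip φ) (hψ : IsLip ψ) (π : Fin (k + 1) → Lip B) :
    IsLinearMap ℝ fun f : LipB B => homotopyFunctional φ ψ hφ hψ S f π := by
  constructor
  · intro f f'
    simp only [homotopyFunctional, homotopyTerm_eq]
    rw [← Finset.sum_add_distrib]
    refine Finset.sum_congr rfl fun i _ => ?_
    rw [← mul_add, ← intervalIntegral.integral_add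
      (intervalIntegrable_timeTerm hS hsupp hφ hψ f _ _)
      (intervalIntegrable_timeTerm hS hsupp hφ hψ f' _ _)]
    simp only [timeTerm_add_left hS hsupp]
  · intro c f
    simp only [homotopyFunctional, homotopyTerm_eq, smul_eq_mul, Finset.mul_sum]
    refine Finset.sum_congr rfl fun i _ => ?_
    simp only [timeTerm_smul_left hS hsupp, intervalIntegral.integral_const_mul]
    ring

lemma homotopyFunctional_linear_right (hS : IsMetricCurrent S) (hsupp : HasBoundedSupport S)
    (hφ : IsLip φ) (hψ : IsLip ψ) (f : LipB B) (π : Fin (k + 1) → Lip B) (i : Fin (k + 1)) :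
    IsLinearMap ℝ fun p : Lip B =>
      homotopyFunctional φ ψ hφ hψ S f (Function.update π i p) := by
  simp only [← homotopyAlt_apply hS hsupp]
  exact ⟨(homotopyAlt hS hsupp hφ hψ f).map_update_add π i,
    (homotopyAlt hS hsupp hφ hψ f).map_update_smul π i⟩

lemma homotopyFunctional_locality (hS : IsMetricCurrent S) (hsupp : HasBoundedSupport S)
    (hφ : IsLip φ) (hψ : IsLip ψ) (f : LipB B) (π : Fin (k + 1) → Lip B) (i : Fin (k + 1))
    (h : ∃ U ∈ 𝓝ˢ {x | f.1 x ≠ 0}, ∃ c : ℝ, ∀ x ∈ U, (π i).1 x = c) :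
    homotopyFunctional φ ψ hφ hψ S f π = 0 := by
  obtain ⟨U, hU, c, hc⟩ := h
  refine Finset.sum_eq_zero fun j _ => mul_eq_zero_of_right _ ?_
  have hzero : ∀ t, homotopyTerm φ ψ hφ hψ S f π j t = 0 := by
    intro t
    rcases eq_or_ne i j with rfl | hij
    -- If the constant entry is the differentiated one, its time derivative vanishes wherever f ∘ h
    -- does not: h(s, x) stays in the open region of constancy for s near t. Otherwise it remains in
    -- a differential slot and sharpened locality applies.
    · have hw : homotopyWeight φ ψ f.1 (π i).1 t = 0 := by
        ext x
        by_cases hfx : f.1 (affineHomotopy φ ψ t x) = 0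
        · simp [homotopyWeight, hfx]
        · have hmem : U ∈ 𝓝 (affineHomotopy φ ψ t x) := mem_nhdsSet_iff_forall.1 hU _ hfx
          have hcont : Continuous fun s => affineHomotopy φ ψ s x :=
            (continuous_affineHomotopy hφ hψ).comp (continuous_id.prodMk continuous_const)
          have hev : (fun s => (π i).1 (affineHomotopy φ ψ s x)) =ᶠ[𝓝 t] fun _ => c :=
            (hcont.tendsto t).eventually hmem |>.mono fun s hs => hc _ hs
          simp [homotopyWeight, hev.deriv_eq]
      rw [homotopyTerm, hw, hS.extend_zero]
    · obtain ⟨l, hl⟩ := Fin.exists_succAbove_eq hij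
      refine hS.extend_eq_zero (integrable_homotopyWeight hS hsupp hφ hψ f (π j) t) _ l c
        fun x hx => ?_
      rw [hl]
      exact hc _ (subset_of_mem_nhdsSet hU (left_ne_zero_of_mul hx))
  simp [hzero]

end HomotopyFunctional

/-! ### The mass estimate. -/

section MassEstimate

variable {B : Type*} [NormedAddCommGroup B] [NormedSpace ℝ B] {φ ψ : B → B}

lemma pointLip_comp_le {X Y : Type*} [MetricSpace X] [MetricSpace Y] (p : Lip Y) (h : X → Y)
    (x : X) : pointLip (fun y => p.1 (h y)) x ≤ lipConst p.1 * pointLip h x := by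
  rw [pointLip, pointLip, ← ENNReal.limsup_const_mul_of_ne_top (lipConst_ne_top p.2)]
  refine limsup_le_limsup (Eventually.of_forall fun y => ?_)
  simp only
  rw [← mul_div_assoc]
  refine ENNReal.div_le_div_right ?_ _
  rw [← coe_lipReal]
  exact lipschitzWith_lipReal p _ _

/-- For t in [0,1] the weights t and 1 − t are nonnegative with sum 1, so any c exceeding both
pointwise constants bounds the quotients of h_t near x. -/
lemma pointLip_affineHomotopy_le (φ ψ : B → B) {t : ℝ} (ht : t ∈ Set.Icc (0 : ℝ) 1) (x : B) :
    pointLip (affineHomotopy φ ψ t) x ≤ max (pointLip φ x) (pointLip ψ x) := by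
  refine le_of_forall_gt_imp_ge_of_dense fun c hc => ?_
  rw [max_lt_iff] at hc
  refine limsup_le_of_le (h := ?_)
  filter_upwards [eventually_lt_of_limsup_lt hc.1, eventually_lt_of_limsup_lt hc.2,
    self_mem_nhdsWithin] with y h1 h2 hy
  have hne : edist y x ≠ 0 := by simpa using hy
  rw [ENNReal.div_lt_iff (Or.inl hne) (Or.inl (edist_ne_top _ _))] at h1 h2
  refine ENNReal.div_le_of_le_mul ?_
  calc edist (affineHomotopy φ ψ t y) (affineHomotopy φ ψ t x)
      ≤ edist (t • φ y) (t • φ x) + edist ((1 - t) • ψ y) ((1 - t) • ψ x) :=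
        edist_add_add_le _ _ _ _
    _ = ‖t‖₊ * edist (φ y) (φ x) + ‖1 - t‖₊ * edist (ψ y) (ψ x) := by
        rw [edist_smul₀, edist_smul₀]; rfl
    _ ≤ ‖t‖₊ * (c * edist y x) + ‖1 - t‖₊ * (c * edist y x) := by gcongr
    _ = ((‖t‖₊ + ‖1 - t‖₊ : ℝ≥0) : ℝ≥0∞) * (c * edist y x) := by push_cast; ring
    _ = c * edist y x := by
        have : ‖t‖₊ + ‖1 - t‖₊ = 1 := by
          ext
          push_cast
          rw [Real.norm_of_nonneg ht.1, Real.norm_of_nonneg (by linarith [ht.2])]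
          ring
        rw [this]; simp

variable [MeasurableSpace B] [BorelSpace B] {k : ℕ} {S : MetricFunctional B k}

lemma IsMetricCurrent.ofReal_abs_extend_le (hS : IsMetricCurrent S) {g : B → ℝ}
    (hg : Integrable g (massMeasure S)) (π : Fin k → Lip B) :
    ENNReal.ofReal |extend S g π| ≤
      ∫⁻ x, ENNReal.ofReal |g x| * ∏ i, pointLip (π i).1 x ∂(massMeasure S) := by
  obtain ⟨K, hK⟩ := exists_common_lip π
  have hint : Integrable (fun x => |g x| * ∏ i, (pointLip (π i).1 x).toReal) (massMeasure S) := by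
    refine hg.abs.mul_bdd (c := (K : ℝ) ^ k) (measurable_prod_pointLip π).aestronglyMeasurable
      (ae_of_all _ fun x => ?_)
    rw [Real.norm_of_nonneg (Finset.prod_nonneg fun i _ => ENNReal.toReal_nonneg)]
    exact (Finset.prod_le_prod (fun i _ => ENNReal.toReal_nonneg)
      fun i _ => toReal_pointLip_le (hK i) x).trans (by simp)
  refine (ENNReal.ofReal_le_ofReal (hS.abs_extend_le_integral_pointLip hg π)).trans ?_
  rw [ofReal_integral_eq_lintegral_ofReal hint (ae_of_all _ fun x =>
    mul_nonneg (abs_nonneg _) (Finset.prod_nonneg fun i _ => ENNReal.toReal_nonneg))]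
  refine lintegral_mono fun x => ?_
  rw [ENNReal.ofReal_mul (abs_nonneg _),
    ENNReal.ofReal_prod_of_nonneg fun i _ => ENNReal.toReal_nonneg]
  simp only [ENNReal.ofReal_toReal (pointLip_ne_top (π _).2 x), le_refl]

/-- The density of the mass estimate for the homotopy. -/
def homotopyDensity (φ ψ : B → B) (k : ℕ) (x : B) : ℝ≥0∞ :=
  ENNReal.ofReal ‖φ x - ψ x‖ * max (pointLip φ x) (pointLip ψ x) ^ k

lemma measurable_homotopyDensity (hφ : IsLip φ) (hψ : IsLip ψ) (k : ℕ) :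
    Measurable (homotopyDensity φ ψ k) :=
  (ENNReal.measurable_ofReal.comp (hφ.continuous.sub hψ.continuous).norm.measurable).mul
    (((measurable_pointLip hφ.continuous).max (measurable_pointLip hψ.continuous)).pow_const k)

lemma lintegral_homotopyDensity_ne_top (hS : IsMetricCurrent S) (hsupp : HasBoundedSupport S)
    (hφ : IsLip φ) (hψ : IsLip ψ) :
    ∫⁻ x, homotopyDensity φ ψ k x ∂(massMeasure S) ≠ ∞ := by
  have := hS.isFiniteMeasure
  obtain ⟨D, hD0, hD⟩ := hsupp.exists_ae_displacement_le hφ hψ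
  obtain ⟨K, hK⟩ := hφ
  obtain ⟨L, hL⟩ := hψ
  have h : ∫⁻ x, homotopyDensity φ ψ k x ∂(massMeasure S) ≤
      ∫⁻ _, ENNReal.ofReal D * (max K L : ℝ≥0) ^ k ∂(massMeasure S) := by
    refine lintegral_mono_ae ?_
    filter_upwards [hD] with x hx
    unfold homotopyDensity
    gcongr
    exact max_le ((pointLip_le hK x).trans (by simp)) ((pointLip_le hL x).trans (by simp))
  refine ne_top_of_le_ne_top ?_ h
  rw [lintegral_const]
  exact ENNReal.mul_ne_top (ENNReal.mul_ne_top ENNReal.ofReal_ne_top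
    (ENNReal.pow_ne_top ENNReal.coe_ne_top)) (measure_ne_top _ _)

/-- The measure that bounds the mass of the homotopy functional. -/
def homotopyMeasure (φ ψ : B → B) (S : MetricFunctional B k) : Measure B :=
  ((k + 1 : ℕ) : ℝ≥0∞) • (((volume.restrict (Set.Ioc (0 : ℝ) 1)).prod
    ((massMeasure S).withDensity (homotopyDensity φ ψ k))).map
      fun q : ℝ × B => affineHomotopy φ ψ q.1 q.2)

lemma isFiniteMeasure_withDensity_homotopyDensity (hS : IsMetricCurrent S)
    (hsupp : HasBoundedSupport S) (hφ : IsLip φ) (hψ : IsLip ψ) :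
    IsFiniteMeasure ((massMeasure S).withDensity (homotopyDensity φ ψ k)) :=
  isFiniteMeasure_withDensity (lintegral_homotopyDensity_ne_top hS hsupp hφ hψ)

lemma lintegral_homotopyMeasure (hS : IsMetricCurrent S) (hsupp : HasBoundedSupport S)
    (hφ : IsLip φ) (hψ : IsLip ψ) {u : B → ℝ≥0∞} (hu : Measurable u) :
    ∫⁻ y, u y ∂(homotopyMeasure φ ψ S) = ((k + 1 : ℕ) : ℝ≥0∞) * ∫⁻ t in Set.Ioc (0 : ℝ) 1,
      ∫⁻ x, homotopyDensity φ ψ k x * u (affineHomotopy φ ψ t x) ∂(massMeasure S) := by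
  have := isFiniteMeasure_withDensity_homotopyDensity hS hsupp hφ hψ
  have hh : Measurable fun q : ℝ × B => affineHomotopy φ ψ q.1 q.2 :=
    (continuous_affineHomotopy hφ hψ).measurable
  rw [homotopyMeasure, lintegral_smul_measure, smul_eq_mul, lintegral_map hu hh,
    lintegral_prod (fun q : ℝ × B => u (affineHomotopy φ ψ q.1 q.2)) (hu.comp hh).aemeasurable]
  congr 1
  refine lintegral_congr fun t => ?_
  rw [lintegral_withDensity_eq_lintegral_mul _ (measurable_homotopyDensity hφ hψ k)
    (g := fun x => u (affineHomotopy φ ψ t x)) (hu.comp (hh.comp measurable_prodMk_left))]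
  rfl

lemma homotopyMeasure_univ (hS : IsMetricCurrent S) (hsupp : HasBoundedSupport S)
    (hφ : IsLip φ) (hψ : IsLip ψ) :
    homotopyMeasure φ ψ S Set.univ =
      ((k + 1 : ℕ) : ℝ≥0∞) * ∫⁻ x, homotopyDensity φ ψ k x ∂(massMeasure S) := by
  have h := lintegral_homotopyMeasure hS hsupp hφ hψ (u := fun _ => 1) measurable_const
  rw [lintegral_one] at h
  simp [h]

lemma isFiniteMeasure_homotopyMeasure (hS : IsMetricCurrent S) (hsupp : HasBoundedSupport S)
    (hφ : IsLip φ) (hψ : IsLip ψ) : IsFiniteMeasure (homotopyMeasure φ ψ S) := by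
  refine ⟨?_⟩
  rw [homotopyMeasure_univ hS hsupp hφ hψ]
  exact ENNReal.mul_lt_top (ENNReal.natCast_lt_top _)
    (lintegral_homotopyDensity_ne_top hS hsupp hφ hψ).lt_top

/-- The pointwise form of the mass bound is essential here: it keeps the factor max(Lip φ, Lip ψ)^k
under the integral. -/
lemma ofReal_abs_timeTerm_le (hS : IsMetricCurrent S) (hsupp : HasBoundedSupport S)
    (hφ : IsLip φ) (hψ : IsLip ψ) (f : LipB B) (p : Lip B) (ρ : Fin k → Lip B) {t : ℝ}
    (ht : t ∈ Set.Icc (0 : ℝ) 1) :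
    ENNReal.ofReal |timeTerm S hφ hψ f p ρ t| ≤
      (lipConst p.1 * ∏ j, lipConst (ρ j).1) * ∫⁻ x, homotopyDensity φ ψ k x *
        ENNReal.ofReal |f.1 (affineHomotopy φ ψ t x)| ∂(massMeasure S) := by
  refine (hS.ofReal_abs_extend_le
    (integrable_homotopyWeight hS hsupp hφ hψ f p t) _).trans ?_
  have hne : lipConst p.1 * ∏ j, lipConst (ρ j).1 ≠ ∞ := ENNReal.mul_ne_top (lipConst_ne_top p.2)
    (ENNReal.prod_ne_top fun i _ => lipConst_ne_top (ρ i).2)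
  rw [← lintegral_const_mul' _ _ hne]
  refine lintegral_mono fun x => ?_
  have h1 : ENNReal.ofReal |homotopyWeight φ ψ f.1 p.1 t x| ≤
      ENNReal.ofReal |f.1 (affineHomotopy φ ψ t x)| *
        (lipConst p.1 * ENNReal.ofReal ‖φ x - ψ x‖) := by
    refine (ENNReal.ofReal_le_ofReal (abs_homotopyWeight_le φ ψ f.1 p t x)).trans (le_of_eq ?_)
    rw [ENNReal.ofReal_mul (abs_nonneg _), ENNReal.ofReal_mul (NNReal.coe_nonneg _),
      ENNReal.ofReal_coe_nnreal, coe_lipReal]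
  have h2 : ∏ j, pointLip (slice hφ hψ t (ρ j)).1 x ≤
      ∏ j, (lipConst (ρ j).1 * max (pointLip φ x) (pointLip ψ x)) :=
    Finset.prod_le_prod' fun j _ => (pointLip_comp_le (ρ j) _ x).trans
      (mul_le_mul_right (pointLip_affineHomotopy_le φ ψ ht x) _)
  refine (mul_le_mul' h1 h2).trans (le_of_eq ?_)
  rw [Finset.prod_mul_distrib, Finset.prod_const, Finset.card_univ, Fintype.card_fin,
    homotopyDensity]
  ring

/-- Each of the k + 1 summands has the same bound, because LIP(π_i) from the weight completes the
product over the other slots. This is the source of the factor k + 1. -/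
lemma massBound_homotopyFunctional (hS : IsMetricCurrent S) (hsupp : HasBoundedSupport S)
    (hφ : IsLip φ) (hψ : IsLip ψ) :
    MassBound (homotopyFunctional φ ψ hφ hψ S) (homotopyMeasure φ ψ S) := by
  intro f π
  have hm : Measurable fun y => ENNReal.ofReal |f.1 y| :=
    ENNReal.measurable_ofReal.comp (LipB.continuous f).abs.measurable
  rw [lintegral_homotopyMeasure hS hsupp hφ hψ hm]
  set I := ∫⁻ t in Set.Ioc (0 : ℝ) 1, ∫⁻ x, homotopyDensity φ ψ k x *
    ENNReal.ofReal |f.1 (affineHomotopy φ ψ t x)| ∂(massMeasure S) with hI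
  have hterm : ∀ i : Fin (k + 1), ENNReal.ofReal |(-1 : ℝ) ^ (i : ℕ) *
      ∫ t in (0 : ℝ)..1, homotopyTerm φ ψ hφ hψ S f π i t| ≤ (∏ j, lipConst (π j).1) * I := by
    intro i
    have hne : (∏ j, lipConst (π j).1) ≠ ∞ :=
      ENNReal.prod_ne_top fun i _ => lipConst_ne_top (π i).2
    rw [abs_mul, abs_pow, abs_neg, abs_one, one_pow, one_mul,
      intervalIntegral.integral_of_le zero_le_one, ← Real.enorm_eq_ofReal_abs]
    refine (enorm_integral_le_lintegral_enorm _).trans ?_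
    rw [hI, ← lintegral_const_mul' _ _ hne]
    refine setLIntegral_mono' measurableSet_Ioc fun t ht => ?_
    rw [Real.enorm_eq_ofReal_abs, homotopyTerm_eq, Fin.prod_univ_succAbove _ i]
    exact ofReal_abs_timeTerm_le hS hsupp hφ hψ f (π i) (i.removeNth π) ⟨ht.1.le, ht.2⟩
  calc ENNReal.ofReal |homotopyFunctional φ ψ hφ hψ S f π|
      ≤ ENNReal.ofReal (∑ i : Fin (k + 1), |(-1 : ℝ) ^ (i : ℕ) *
          ∫ t in (0 : ℝ)..1, homotopyTerm φ ψ hφ hψ S f π i t|) :=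
        ENNReal.ofReal_le_ofReal (Finset.abs_sum_le_sum_abs _ _)
    _ = ∑ i : Fin (k + 1), ENNReal.ofReal |(-1 : ℝ) ^ (i : ℕ) *
          ∫ t in (0 : ℝ)..1, homotopyTerm φ ψ hφ hψ S f π i t| :=
        ENNReal.ofReal_sum_of_nonneg fun _ _ => abs_nonneg _
    _ ≤ ∑ _i : Fin (k + 1), (∏ j, lipConst (π j).1) * I := Finset.sum_le_sum fun i _ => hterm i
    _ = _ := by
        rw [Finset.sum_const, Finset.card_univ, Fintype.card_fin, nsmul_eq_mul]
        ring

end MassEstimate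

end MetricCurrents

end

noncomputable section

namespace MetricCurrents

/-! ### Telescoping of alternating maps. -/

section Telescoping

/-- The tuple that agrees with `b` before the index `i` and with `a` from there on. -/
def mixTuple {V : Type*} {n : ℕ} (a b : Fin n → V) (m : ℕ) (j : Fin n) : V :=
  if j.1 < m then b j else a j

lemma removeNth_succ_cons {V : Type*} {n : ℕ} (i : Fin (n + 1)) (x : V) (v : Fin (n + 1) → V) :
    i.succ.removeNth (Fin.cons x v : Fin (n + 2) → V) = Fin.cons x (i.removeNth v) := by
  ext j
  refine Fin.cases ?_ (fun j => ?_) j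
  · simp [Fin.removeNth]
  · simp [Fin.removeNth]

/-- Exchange a for b one entry at a time. The i-th step has a_i − b_i in slot i, and moving it to
slot 0 costs (−1)^i. -/
lemma alternating_sub_eq_sum {V : Type*} [AddCommGroup V] [Module ℝ V] {n : ℕ}
    (M : V [⋀^Fin (n + 1)]→ₗ[ℝ] ℝ) (a b : Fin (n + 1) → V) :
    M a - M b = ∑ i : Fin (n + 1), (-1 : ℝ) ^ (i : ℕ) *
      M (Fin.cons (a i - b i) (i.removeNth (mixTuple a b i))) := by
  have h1 : M a - M b = ∑ i : Fin (n + 1), (M (mixTuple a b i) - M (mixTuple a b (i + 1))) := by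
    have e0 : mixTuple a b 0 = a := by ext j; simp [mixTuple]
    have e1 : mixTuple a b (n + 1) = b := by ext j; simp [mixTuple, j.2]
    rw [Fin.sum_univ_eq_sum_range (fun m => M (mixTuple a b m) - M (mixTuple a b (m + 1))),
      Finset.sum_range_sub', e0, e1]
  rw [h1]
  refine Finset.sum_congr rfl fun i _ => ?_
  have ha : mixTuple a b i = Function.update (mixTuple a b i) i (a i) := by
    rw [eq_comm, Function.update_eq_self_iff]
    simp [mixTuple]
  have hb : mixTuple a b (i + 1) = Function.update (mixTuple a b i) i (b i) := by
    ext j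
    rcases eq_or_ne j i with rfl | hj
    · simp [mixTuple]
    · have : (j : ℕ) < i + 1 ↔ (j : ℕ) < i := by
        have : (j : ℕ) ≠ i := fun h => hj (Fin.ext h)
        omega
      simp [mixTuple, hj, this]
  have hsub : M (mixTuple a b i) - M (mixTuple a b (i + 1)) =
      M (Function.update (mixTuple a b i) i (a i - b i)) := by
    rw [M.map_update_sub, ← ha, ← hb]
  rw [hsub, ← Fin.insertNth_removeNth, M.map_insertNth, zsmul_eq_mul]
  push_cast
  rfl

end Telescoping

/-! ### The homotopy formula. -/

section HomotopyFormula

variable {B : Type*} [NormedAddCommGroup B] [NormedSpace ℝ B] [MeasurableSpace B] [BorelSpace B]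
  {φ ψ : B → B} {k : ℕ}

/-- Supplies the dominating constant for the limit in the time step: the bound is uniform in n, in t
and in all tuples with a common Lipschitz constant. -/
lemma exists_abs_extend_diffQuot_le {S : MetricFunctional B k} (hS : IsMetricCurrent S)
    (hsupp : HasBoundedSupport S) (hφ : IsLip φ) (hψ : IsLip ψ) (f : LipB B) (p : Lip B)
    (C : ℝ≥0) : ∃ A : ℝ, ∀ n t (σ : Fin k → Lip B), (∀ j, LipschitzWith C (σ j).1) →
      |extend S (fun x => f.1 (affineHomotopy φ ψ t x) * (diffQuot hφ hψ p n t).1 x) σ| ≤ A := by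
  have := hS.isFiniteMeasure
  obtain ⟨D, hD0, hD⟩ := hsupp.exists_ae_displacement_le hφ hψ
  obtain ⟨M, hM0, hM⟩ := LipB.exists_bound f
  refine ⟨C ^ k * ∫ _, M * (lipReal p * D) ∂(massMeasure S), fun n t σ hσ => ?_⟩
  have hb : ∀ᵐ x ∂(massMeasure S),
      |f.1 (affineHomotopy φ ψ t x) * (diffQuot hφ hψ p n t).1 x| ≤ M * (lipReal p * D) := by
    filter_upwards [hD] with x hx
    rw [abs_mul]
    have h1 := abs_diffQuot_le hφ hψ p n t x
    exact mul_le_mul (hM _) (h1.trans (by gcongr)) (abs_nonneg _) hM0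
  have hi : Integrable (fun x => f.1 (affineHomotopy φ ψ t x) * (diffQuot hφ hψ p n t).1 x)
      (massMeasure S) := Integrable.of_bound
    ((Lip.continuous (slice hφ hψ t (lipBToLip f))).mul
      (Lip.continuous (diffQuot hφ hψ p n t))).aestronglyMeasurable _ hb
  refine (hS.abs_extend_le_pow hi hσ).trans ?_
  exact mul_le_mul_of_nonneg_left (integral_mono_ae hi.abs (integrable_const _) hb) (by positivity)

/-- The composition `f ∘ h(t, ·)` for bounded `f`. -/
def sliceB (hφ : IsLip φ) (hψ : IsLip ψ) (t : ℝ) (f : LipB B) : LipB B :=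
  lipBComp f (affineHomotopy φ ψ t) (isLip_affineHomotopy hφ hψ t)

/-- The value at time `t` of the pushforward of `T` under the homotopy. -/
def pushforwardAt (T : MetricFunctional B k) (hφ : IsLip φ) (hψ : IsLip ψ) (f : LipB B)
    (π : Fin k → Lip B) (t : ℝ) : ℝ :=
  T (sliceB hφ hψ t f) fun j => slice hφ hψ t (π j)

lemma pushforwardAt_one (T : MetricFunctional B k) (hφ : IsLip φ) (hψ : IsLip ψ) (f : LipB B)
    (π : Fin k → Lip B) : pushforwardAt T hφ hψ f π 1 = pushforward φ hφ T f π := by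
  have h : affineHomotopy φ ψ 1 = φ := by ext x; simp [affineHomotopy]
  have h1 : sliceB hφ hψ 1 f = lipBComp f φ hφ := by
    ext x; simp [sliceB, lipBComp, h]
  have h2 : ∀ p : Lip B, slice hφ hψ 1 p = lipComp p φ hφ := fun p => by
    ext x; simp [slice, lipComp, h]
  simp only [pushforwardAt, pushforward, h1, h2]

lemma pushforwardAt_zero (T : MetricFunctional B k) (hφ : IsLip φ) (hψ : IsLip ψ) (f : LipB B)
    (π : Fin k → Lip B) : pushforwardAt T hφ hψ f π 0 = pushforward ψ hψ T f π := by
  have h : affineHomotopy φ ψ 0 = ψ := by ext x; simp [affineHomotopy]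
  have h1 : sliceB hφ hψ 0 f = lipBComp f ψ hψ := by
    ext x; simp [sliceB, lipBComp, h]
  have h2 : ∀ p : Lip B, slice hφ hψ 0 p = lipComp p ψ hψ := fun p => by
    ext x; simp [slice, lipComp, h]
  simp only [pushforwardAt, pushforward, h1, h2]

lemma continuous_pushforwardAt {T : MetricFunctional B k} (hT : IsMetricCurrent T)
    (hφ : IsLip φ) (hψ : IsLip ψ) (f : LipB B) (π : Fin k → Lip B) :
    Continuous (pushforwardAt T hφ hψ f π) := by
  obtain ⟨M, hM0, hM⟩ := LipB.exists_bound f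
  rw [continuous_iff_seqContinuous]
  intro u t hu
  obtain ⟨b, hb⟩ := (Metric.isBounded_range_of_tendsto u hu).exists_norm_le
  obtain ⟨C, hC⟩ := exists_lipschitzWith_slice hφ hψ π b
  have h : ∀ s, pushforwardAt T hφ hψ f π s =
      extend T (sliceB hφ hψ s f).1 fun j => slice hφ hψ s (π j) :=
    fun s => (hT.extend_coe (sliceB hφ hψ s f) _).symm
  rw [h]
  refine Tendsto.congr (fun m => (h (u m)).symm) ?_
  refine hT.tendsto_extend (w := fun m => (sliceB hφ hψ (u m) f).1) (M := M)
    (fun m => (LipB.continuous _).aestronglyMeasurable)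
    (fun m => ae_of_all _ fun x => hM (affineHomotopy φ ψ (u m) x)) (ae_of_all _ fun x => ?_)
    (ρ := fun m j => slice hφ hψ (u m) (π j))
    (C := C) (fun m j => hC _ (hb _ (Set.mem_range_self m)) j) fun j x => ?_
  · exact ((continuous_slice hφ hψ (lipBToLip f) x).tendsto t).comp hu
  · exact ((continuous_slice hφ hψ (π j) x).tendsto t).comp hu

/-- The integrals of the difference quotients of a continuous function converge to the
difference of its boundary values. -/
lemma tendsto_integral_diffQuot {F : ℝ → ℝ} (hF : Continuous F) :
    Tendsto (fun n : ℕ => ∫ t in (0 : ℝ)..1, ((n : ℝ) + 1) * (F (t + 1 / ((n : ℝ) + 1)) - F t))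
      atTop (𝓝 (F 1 - F 0)) := by
  have hi : ∀ a b, IntervalIntegrable F volume a b := fun a b => hF.intervalIntegrable a b
  have h2 : Tendsto (fun n : ℕ => 1 / ((n : ℝ) + 1)) atTop (𝓝[≠] 0) :=
    tendsto_nhdsWithin_iff.2 ⟨tendsto_one_div_add_atTop_nhds_zero_nat,
      Eventually.of_forall fun n => (Nat.one_div_pos_of_nat (α := ℝ)).ne'⟩
  have h3 : ∀ a : ℝ, Tendsto (fun n : ℕ => ((n : ℝ) + 1) *
      ((∫ t in (0 : ℝ)..(a + 1 / ((n : ℝ) + 1)), F t) - ∫ t in (0 : ℝ)..a, F t)) atTop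
      (𝓝 (F a)) := fun a => by
    have h := (hF.integral_hasStrictDerivAt 0 a).hasDerivAt.tendsto_slope_zero
    refine (h.comp h2).congr fun n => ?_
    simp
  -- After a shift of variables the integral is the mean of F over [1, 1 + δ] minus its mean over
  -- [0, δ], with δ = 1/(n+1).
  refine ((h3 1).sub (h3 0)).congr fun n => ?_
  have hi' : IntervalIntegrable (fun t => F (t + 1 / ((n : ℝ) + 1))) volume 0 1 :=
    (hF.comp (continuous_add_const _)).intervalIntegrable _ _
  rw [intervalIntegral.integral_const_mul, intervalIntegral.integral_sub hi' (hi _ _),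
    intervalIntegral.integral_comp_add_right]
  have e1 := intervalIntegral.integral_add_adjacent_intervals
    (hi 0 (0 + 1 / ((n : ℝ) + 1))) (hi (0 + 1 / ((n : ℝ) + 1)) (1 + 1 / ((n : ℝ) + 1)))
  rw [← e1]
  simp
  ring

variable {T : MetricFunctional B (k + 1)}

/-- The time derivative of the pushforward under the homotopy. -/
def homotopyIntegrand (T : MetricFunctional B (k + 1)) (hφ : IsLip φ) (hψ : IsLip ψ)
    (f : LipB B) (π : Fin (k + 1) → Lip B) (t : ℝ) : ℝ :=
  timeTerm T hφ hψ lipBOne (lipBToLip f) π t + ∑ i : Fin (k + 1), (-1 : ℝ) ^ (i : ℕ) *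
    (timeTerm (boundary T) hφ hψ f (π i) (i.removeNth π) t -
      timeTerm T hφ hψ lipBOne (π i) (Fin.cons (lipBToLip f) (i.removeNth π)) t)

lemma slice_cons (hφ : IsLip φ) (hψ : IsLip ψ) (t : ℝ) (p : Lip B) (ρ : Fin k → Lip B) :
    (fun j => slice hφ hψ t ((Fin.cons p ρ : Fin (k + 1) → Lip B) j)) =
      Fin.cons (slice hφ hψ t p) fun j => slice hφ hψ t (ρ j) := by
  ext j : 1
  exact Fin.cases rfl (fun _ => rfl) j

lemma homotopyFunctional_cons (T : MetricFunctional B (k + 1)) (hφ : IsLip φ) (hψ : IsLip ψ)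
    (f : LipB B) (p : Lip B) (ρ : Fin (k + 1) → Lip B) :
    homotopyFunctional φ ψ hφ hψ T f (Fin.cons p ρ) =
      (∫ t in (0 : ℝ)..1, timeTerm T hφ hψ f p ρ t) +
      ∑ i : Fin (k + 1), (-1 : ℝ) ^ ((i : ℕ) + 1) * ∫ t in (0 : ℝ)..1,
        timeTerm T hφ hψ f (ρ i) (Fin.cons p (i.removeNth ρ)) t := by
  refine (Fin.sum_univ_succ _).trans ?_
  congr 1
  · rw [homotopyTerm_eq]
    simp
  · refine Finset.sum_congr rfl fun i _ => ?_
    rw [homotopyTerm_eq, removeNth_succ_cons, Fin.cons_succ, Fin.val_succ]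

/-- ∂H(T)(f, π) is H(T) on the first argument 1 and the tuple (f, π). Differentiating f gives the
leading term; differentiating π_i, now in slot i + 1, gives the opposite sign to H(∂T). -/
lemma integral_homotopyIntegrand (hT : IsNormalCurrent T) (hsupp : HasBoundedSupport T)
    (hφ : IsLip φ) (hψ : IsLip ψ) (f : LipB B) (π : Fin (k + 1) → Lip B) :
    ∫ t in (0 : ℝ)..1, homotopyIntegrand T hφ hψ f π t =
      boundary (homotopyFunctional φ ψ hφ hψ T) f π +
        homotopyFunctional φ ψ hφ hψ (boundary T) f π := by
  have hsupp' := hsupp.boundary hT.1 hT.2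
  have hi : ∀ p ρ, IntervalIntegrable (timeTerm T hφ hψ lipBOne p ρ) volume 0 1 :=
    intervalIntegrable_timeTerm hT.1 hsupp hφ hψ lipBOne
  have hi' : ∀ p ρ, IntervalIntegrable (timeTerm (boundary T) hφ hψ f p ρ) volume 0 1 :=
    intervalIntegrable_timeTerm hT.2 hsupp' hφ hψ f
  have hterm : ∀ i ∈ (Finset.univ : Finset (Fin (k + 1))), IntervalIntegrable (fun t =>
      (-1 : ℝ) ^ (i : ℕ) * (timeTerm (boundary T) hφ hψ f (π i) (i.removeNth π) t -
      timeTerm T hφ hψ lipBOne (π i) (Fin.cons (lipBToLip f) (i.removeNth π)) t)) volume 0 1 :=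
    fun i _ => ((hi' _ _).sub (hi _ _)).const_mul _
  have hsum : IntervalIntegrable (fun t => ∑ i : Fin (k + 1), (-1 : ℝ) ^ (i : ℕ) *
      (timeTerm (boundary T) hφ hψ f (π i) (i.removeNth π) t -
      timeTerm T hφ hψ lipBOne (π i) (Fin.cons (lipBToLip f) (i.removeNth π)) t)) volume 0 1 := by
    have h := IntervalIntegrable.sum Finset.univ hterm
    rwa [Finset.sum_fn] at h
  simp only [homotopyIntegrand]
  rw [intervalIntegral.integral_add (hi _ _) hsum, intervalIntegral.integral_finsetSum hterm,
    boundary, homotopyFunctional_cons, homotopyFunctional, add_assoc, ← Finset.sum_add_distrib]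
  congr 1
  refine Finset.sum_congr rfl fun i _ => ?_
  rw [intervalIntegral.integral_const_mul, intervalIntegral.integral_sub (hi' _ _) (hi _ _),
    homotopyTerm_eq]
  ring

/-- The difference quotient of the pushforward, decomposed by telescoping and integration by
parts. -/
lemma diffQuot_pushforwardAt (hT : IsNormalCurrent T) (hsupp : HasBoundedSupport T)
    (hφ : IsLip φ) (hψ : IsLip ψ) (f : LipB B) (π : Fin (k + 1) → Lip B) (n : ℕ) (t : ℝ) :
    ((n : ℝ) + 1) * (pushforwardAt T hφ hψ f π (t + 1 / ((n : ℝ) + 1)) -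
      pushforwardAt T hφ hψ f π t) =
    extend T (fun x => lipBOne.1 (affineHomotopy φ ψ t x) *
      (diffQuot hφ hψ (lipBToLip f) n t).1 x)
      (fun j => slice hφ hψ (t + 1 / ((n : ℝ) + 1)) (π j)) +
    ∑ i : Fin (k + 1), (-1 : ℝ) ^ (i : ℕ) *
      (extend (boundary T) (fun x => f.1 (affineHomotopy φ ψ t x) *
        (diffQuot hφ hψ (π i) n t).1 x)
        (i.removeNth (mixTuple (fun j => slice hφ hψ (t + 1 / ((n : ℝ) + 1)) (π j))
          (fun j => slice hφ hψ t (π j)) i)) -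
      extend T (fun x => lipBOne.1 (affineHomotopy φ ψ t x) * (diffQuot hφ hψ (π i) n t).1 x)
        (Fin.cons (slice hφ hψ t (lipBToLip f))
          (i.removeNth (mixTuple (fun j => slice hφ hψ (t + 1 / ((n : ℝ) + 1)) (π j))
          (fun j => slice hφ hψ t (π j)) i)))) := by
  have hfin := hT.1.isFiniteMeasure
  have hsupp' := hsupp.boundary hT.1 hT.2
  obtain ⟨D, hD0, hD⟩ := hsupp.exists_ae_displacement_le hφ hψ
  obtain ⟨D', hD0', hD'⟩ := hsupp'.exists_ae_displacement_le hφ hψ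
  set N : ℝ := (n : ℝ) + 1 with hN
  set a : Fin (k + 1) → Lip B := fun j => slice hφ hψ (t + 1 / N) (π j) with ha
  set b : Fin (k + 1) → Lip B := fun j => slice hφ hψ t (π j) with hb
  have hone : ∀ p : Lip B, (fun x => lipBOne.1 (affineHomotopy φ ψ t x) *
      (diffQuot hφ hψ p n t).1 x) = (diffQuot hφ hψ p n t).1 := fun p => by
    ext x; simp [lipBOne]
  simp only [hone]
  set M := hT.1.extendAlt (LipB.integrable (sliceB hφ hψ t f) _) with hM
  have hMT : ∀ ρ, M ρ = T (sliceB hφ hψ t f) ρ := fun ρ => hT.1.extend_coe _ _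
  -- The change of the first argument is taken with the tuple already at the later time; the change
  -- of the tuple is then taken with f at time t.
  have hfirst : N * (T (sliceB hφ hψ (t + 1 / N) f) a - T (sliceB hφ hψ t f) a) =
      extend T (diffQuot hφ hψ (lipBToLip f) n t).1 a := by
    have h1 := (hT.1.linear_left a).map_smul N
      (sliceB hφ hψ (t + 1 / N) f - sliceB hφ hψ t f)
    have h2 := (hT.1.linear_left a).map_sub (sliceB hφ hψ (t + 1 / N) f) (sliceB hφ hψ t f)
    rw [h2, smul_eq_mul] at h1
    rw [← h1]
    exact (hT.1.extend_coe (N • (sliceB hφ hψ (t + 1 / N) f - sliceB hφ hψ t f)) a).symm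
  have hsecond : N * (T (sliceB hφ hψ t f) a - T (sliceB hφ hψ t f) b) =
      ∑ i : Fin (k + 1), (-1 : ℝ) ^ (i : ℕ) *
        T (sliceB hφ hψ t f) (Fin.cons (diffQuot hφ hψ (π i) n t)
          (i.removeNth (mixTuple a b i))) := by
    rw [← hMT, ← hMT, alternating_sub_eq_sum, Finset.mul_sum]
    refine Finset.sum_congr rfl fun i _ => ?_
    have h1 := M.map_update_smul (Fin.cons 0 (i.removeNth (mixTuple a b i))) 0 N (a i - b i)
    simp only [Fin.update_cons_zero, smul_eq_mul] at h1
    rw [← hMT, mul_left_comm, ← h1]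
    rfl
  -- The Lipschitz constants in x of the difference quotients need not be bounded in n, so the
  -- continuity axiom is useless in this slot. Integration by parts moves them to the first slot,
  -- where a sup bound is enough.
  have hparts : ∀ i : Fin (k + 1), T (sliceB hφ hψ t f) (Fin.cons (diffQuot hφ hψ (π i) n t)
      (i.removeNth (mixTuple a b i))) =
      extend (boundary T) (fun x => f.1 (affineHomotopy φ ψ t x) *
        (diffQuot hφ hψ (π i) n t).1 x) (i.removeNth (mixTuple a b i)) -
      extend T (diffQuot hφ hψ (π i) n t).1 (Fin.cons (slice hφ hψ t (lipBToLip f))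
          (i.removeNth (mixTuple a b i))) := fun i => by
    refine hT.apply_cons (sliceB hφ hψ t f) (diffQuot hφ hψ (π i) n t)
      (M := lipReal (π i) * max D D') ?_ ?_ _
    · filter_upwards [hD] with x hx
      refine (abs_diffQuot_le hφ hψ (π i) n t x).trans ?_
      gcongr
      exact hx.trans (le_max_left _ _)
    · filter_upwards [hD'] with x hx
      refine (abs_diffQuot_le hφ hψ (π i) n t x).trans ?_
      gcongr
      exact hx.trans (le_max_right _ _)
  simp only [← hparts]
  rw [← hfirst, ← hsecond]
  simp only [pushforwardAt]
  ring

theorem homotopy_formula (hT : IsNormalCurrent T) (hsupp : HasBoundedSupport T)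
    (hφ : IsLip φ) (hψ : IsLip ψ) :
    pushforward φ hφ T - pushforward ψ hψ T =
      boundary (homotopyFunctional φ ψ hφ hψ T) +
        homotopyFunctional φ ψ hφ hψ (boundary T) := by
  have hsupp' := hsupp.boundary hT.1 hT.2
  funext f π
  simp only [Pi.sub_apply, Pi.add_apply]
  rw [← integral_homotopyIntegrand hT hsupp, ← pushforwardAt_one T hφ hψ,
    ← pushforwardAt_zero T hφ hψ]
  have hF := continuous_pushforwardAt hT.1 hφ hψ f π
  refine tendsto_nhds_unique (tendsto_integral_diffQuot hF) ?_
  set δ : ℕ → ℝ := fun n => 1 / ((n : ℝ) + 1) with hδ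
  have hδ0 : ∀ n, 0 < δ n := fun n => Nat.one_div_pos_of_nat
  have hδ1 : ∀ n, δ n ≤ 1 := fun n => by
    rw [hδ]
    simp only
    rw [div_le_one (by positivity)]
    linarith [Nat.cast_nonneg (α := ℝ) n]
  have hδlim : Tendsto δ atTop (𝓝 0) := tendsto_one_div_add_atTop_nhds_zero_nat
  -- All times that occur, t and t + δ with t in [0,1] and δ ≤ 1, lie in [0,2].
  obtain ⟨C₁, hC₁⟩ := exists_lipschitzWith_slice hφ hψ π 2
  obtain ⟨C₂, hC₂⟩ := exists_lipschitzWith_slice hφ hψ (fun _ : Fin 1 => lipBToLip f) 2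
  set C := max C₁ C₂
  have habs : ∀ n, ∀ t ∈ Set.Icc (0 : ℝ) 1, |t| ≤ 2 ∧ |t + δ n| ≤ 2 := fun n t ht => by
    have h0 := hδ0 n
    have h1 := hδ1 n
    rw [abs_of_nonneg ht.1, abs_of_nonneg (add_nonneg ht.1 h0.le)]
    constructor <;> linarith [ht.2]
  have hmix : ∀ n, ∀ t ∈ Set.Icc (0 : ℝ) 1, ∀ m j,
      LipschitzWith C (mixTuple (fun j => slice hφ hψ (t + δ n) (π j))
        (fun j => slice hφ hψ t (π j)) m j).1 := fun n t ht m j => by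
    rw [mixTuple]
    split_ifs
    · exact (hC₁ t (habs n t ht).1 j).weaken (le_max_left _ _)
    · exact (hC₁ _ (habs n t ht).2 j).weaken (le_max_left _ _)
  have hcons : ∀ n, ∀ t ∈ Set.Icc (0 : ℝ) 1, ∀ (i : Fin (k + 1)) (j : Fin (k + 1)),
      LipschitzWith C ((Fin.cons (slice hφ hψ t (lipBToLip f))
        (i.removeNth (mixTuple (fun j => slice hφ hψ (t + δ n) (π j))
          (fun j => slice hφ hψ t (π j)) i)) : Fin (k + 1) → Lip B) j).1 := fun n t ht i j => by
    refine Fin.cases ?_ (fun j => ?_) j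
    · exact (hC₂ t (habs n t ht).1 0).weaken (le_max_right _ _)
    · exact hmix n t ht i _
  have hlimslice : ∀ (p : Lip B) t x,
      Tendsto (fun n => (slice hφ hψ (t + δ n) p).1 x) atTop (𝓝 ((slice hφ hψ t p).1 x)) :=
    fun p t x => by
      have h := (continuous_slice hφ hψ p x).tendsto t
      refine h.comp ?_
      simpa using hδlim.const_add t
  have hlimmix : ∀ t m j x, Tendsto (fun n => (mixTuple (fun j => slice hφ hψ (t + δ n) (π j))
        (fun j => slice hφ hψ t (π j)) m j).1 x) atTop (𝓝 ((slice hφ hψ t (π j)).1 x)) := by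
    intro t m j x
    simp only [mixTuple]
    split_ifs
    · exact tendsto_const_nhds
    · exact hlimslice _ _ _
  obtain ⟨A₀, hA₀⟩ := exists_abs_extend_diffQuot_le hT.1 hsupp hφ hψ lipBOne (lipBToLip f) C
  choose A₁ hA₁ using fun i => exists_abs_extend_diffQuot_le hT.2 hsupp' hφ hψ f (π i) C
  choose A₂ hA₂ using fun i => exists_abs_extend_diffQuot_le hT.1 hsupp hφ hψ lipBOne (π i) C
  refine intervalIntegral.tendsto_integral_filter_of_dominated_convergence
    (fun _ => A₀ + ∑ i, (A₁ i + A₂ i)) (Eventually.of_forall fun n => ?_)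
    (Eventually.of_forall fun n => ae_of_all _ fun t ht => ?_) intervalIntegrable_const ?_
  · exact (continuous_const.mul
      ((hF.comp (continuous_add_const _)).sub hF)).aestronglyMeasurable
  · rw [Set.uIoc_of_le zero_le_one] at ht
    have ht' : t ∈ Set.Icc (0 : ℝ) 1 := ⟨ht.1.le, ht.2⟩
    rw [diffQuot_pushforwardAt hT hsupp, Real.norm_eq_abs]
    refine (abs_add_le _ _).trans (add_le_add (hA₀ n t _ fun j => ?_)
      ((Finset.abs_sum_le_sum_abs _ _).trans (Finset.sum_le_sum fun i _ => ?_)))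
    · exact (hC₁ _ (habs n t ht').2 j).weaken (le_max_left _ _)
    · rw [abs_mul, abs_pow, abs_neg, abs_one, one_pow, one_mul]
      exact (abs_sub _ _).trans (add_le_add (hA₁ i n t _ fun j => hmix n t ht' i _)
        (hA₂ i n t _ (hcons n t ht' i)))
  · have h1 := ae_all_iff.2 fun i => ae_tendsto_timeTerm hT.2 hsupp' hφ hψ f (π i)
    have h2 := ae_all_iff.2 fun i => ae_tendsto_timeTerm hT.1 hsupp hφ hψ lipBOne (π i)
    filter_upwards [ae_tendsto_timeTerm hT.1 hsupp hφ hψ lipBOne (lipBToLip f), h1, h2]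
      with t h0 h1 h2 ht
    rw [Set.uIoc_of_le zero_le_one] at ht
    have ht' : t ∈ Set.Icc (0 : ℝ) 1 := ⟨ht.1.le, ht.2⟩
    refine Tendsto.congr (fun n => (diffQuot_pushforwardAt hT hsupp hφ hψ f π n t).symm) ?_
    have l0 := h0 π (fun n j => slice hφ hψ (t + δ n) (π j)) C
      (fun n j => (hC₁ _ (habs n t ht').2 j).weaken (le_max_left _ _))
      fun j x => hlimslice _ _ _
    have l1 := fun i : Fin (k + 1) => h1 i (i.removeNth π)
      (fun n => i.removeNth (mixTuple (fun j => slice hφ hψ (t + δ n) (π j))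
        (fun j => slice hφ hψ t (π j)) i)) C
      (fun n j => hmix n t ht' i _) fun j x => hlimmix t i _ x
    have l2 := fun i : Fin (k + 1) => h2 i (Fin.cons (lipBToLip f) (i.removeNth π))
      (fun n => Fin.cons (slice hφ hψ t (lipBToLip f))
        (i.removeNth (mixTuple (fun j => slice hφ hψ (t + δ n) (π j))
        (fun j => slice hφ hψ t (π j)) i))) C
      (fun n => hcons n t ht' i) fun j x => by
        refine Fin.cases ?_ (fun j => ?_) j
        · exact tendsto_const_nhds
        · exact hlimmix t i _ x
    exact l0.add (tendsto_finsetSum _ fun i _ => ((l1 i).sub (l2 i)).const_mul _)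

end HomotopyFormula

end MetricCurrents

end

noncomputable section

namespace MetricCurrents

/-! ### Joint continuity from finite boundary mass. -/

section Continuity

variable {X : Type*} [MetricSpace X] [MeasurableSpace X] [BorelSpace X] {k : ℕ}
  {S : MetricFunctional X (k + 1)} {μ ν : Measure X}

lemma MassBound.apply_congr_left [IsFiniteMeasure μ] (hS : MassBound S μ)
    {π : Fin (k + 1) → Lip X} (hlin : IsLinearMap ℝ fun f : LipB X => S f π) {f g : LipB X}
    (h : f.1 =ᵐ[μ] g.1) : S f π = S g π := by
  have h1 := massBound_iff.1 hS (f - g) π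
  have h2 : ∫ x, |(f - g).1 x| ∂μ = 0 := by
    refine integral_eq_zero_of_ae ?_
    filter_upwards [h] with x hx
    simp [hx]
  rw [h2, mul_zero] at h1
  have h3 : S (f - g) π = S f π - S g π := hlin.map_sub f g
  rw [h3] at h1
  exact sub_eq_zero.1 (abs_nonpos_iff.1 h1)

/-- A local functional of finite mass depends on its arguments only near a set that carries the
mass. -/
lemma MassBound.apply_cons_congr [IsFiniteMeasure μ] (hS : MassBound S μ)
    (hlin : ∀ π, IsLinearMap ℝ fun f : LipB X => S f π)
    (A : LipB X → Lip X [⋀^Fin (k + 1)]→ₗ[ℝ] ℝ) (hA : ∀ f π, A f π = S f π)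
    (hloc : ∀ (f : LipB X) (π : Fin (k + 1) → Lip X) (i : Fin (k + 1)),
      (∃ U ∈ 𝓝ˢ {x | f.1 x ≠ 0}, ∃ c : ℝ, ∀ x ∈ U, (π i).1 x = c) → S f π = 0)
    {F : Set X} (hF : ∀ᵐ x ∂μ, x ∈ F) (f : LipB X) {σ τ : Lip X}
    (h : ∀ x ∈ Metric.thickening 1 F, σ.1 x = τ.1 x) (ρ : Fin k → Lip X) :
    S f (Fin.cons σ ρ) = S f (Fin.cons τ ρ) := by
  set g := mulB f (cutoff F 1 one_pos) with hg
  have hfg : f.1 =ᵐ[μ] g.1 := by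
    filter_upwards [hF] with x hx
    simp [hg, mulB, cutoff_eq_one one_pos hx]
  rw [hS.apply_congr_left (hlin _) hfg, hS.apply_congr_left (hlin _) hfg, ← sub_eq_zero]
  have h1 := (A g).map_update_sub (Fin.cons 0 ρ) 0 σ τ
  simp only [Fin.update_cons_zero, hA] at h1
  rw [← h1]
  refine hloc g _ 0 ⟨Metric.thickening 1 F, ?_, 0, fun x hx => ?_⟩
  · rw [Metric.isOpen_thickening.mem_nhdsSet]
    intro x hx
    by_contra hx'
    exact hx (mul_eq_zero_of_right _ (cutoff_eq_zero one_pos hx'))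
  · simp [h x hx]

lemma tendsto_integral_mul_truncate [IsFiniteMeasure μ] (f : LipB X) {M : ℝ} (hM : 0 ≤ M)
    {σ : ℕ → Lip X} (hσ : ∀ x, Tendsto (fun n => (σ n).1 x) atTop (𝓝 0)) :
    Tendsto (fun n => ∫ x, |(mulB f (truncate M (σ n))).1 x| ∂μ) atTop (𝓝 0) := by
  obtain ⟨D, hD0, hD⟩ := LipB.exists_bound f
  have h := tendsto_integral_of_dominated_convergence (μ := μ)
    (F := fun n x => |(mulB f (truncate M (σ n))).1 x|) (f := fun _ => (0 : ℝ))
    (fun _ => D * M) (fun n => (LipB.continuous _).abs.aestronglyMeasurable) (integrable_const _)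
    (fun n => ae_of_all _ fun x => ?_) (ae_of_all _ fun x => ?_)
  · simpa using h
  · rw [Real.norm_eq_abs, abs_abs]
    change |f.1 x * _| ≤ _
    rw [abs_mul]
    exact mul_le_mul (hD x) (abs_max_min_le M hM _) (abs_nonneg _) hD0
  · refine squeeze_zero (fun _ => abs_nonneg _) (fun n => ?_)
      (by simpa using (hσ x).abs.const_mul D)
    change |f.1 x * _| ≤ _
    rw [abs_mul]
    exact mul_le_mul (hD x) (abs_max_min_le_abs M hM _) (abs_nonneg _) hD0

/-- A local alternating functional with bounded support that satisfies the product rule and has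
finite mass together with its boundary is jointly continuous. -/
theorem tendsto_of_massBound_boundary [IsFiniteMeasure μ] [IsFiniteMeasure ν]
    (hS : MassBound S μ) (hS' : MassBound (boundary S) ν)
    (hlin : ∀ π, IsLinearMap ℝ fun f : LipB X => S f π)
    (A : LipB X → Lip X [⋀^Fin (k + 1)]→ₗ[ℝ] ℝ) (hA : ∀ f π, A f π = S f π)
    (hloc : ∀ (f : LipB X) (π : Fin (k + 1) → Lip X) (i : Fin (k + 1)),
      (∃ U ∈ 𝓝ˢ {x | f.1 x ≠ 0}, ∃ c : ℝ, ∀ x ∈ U, (π i).1 x = c) → S f π = 0)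
    (hleib : ∀ (f g : LipB X) (ρ : Fin k → Lip X), S f (Fin.cons (lipBToLip g) ρ) +
      S g (Fin.cons (lipBToLip f) ρ) = boundary S (mulB f g) ρ)
    {x₀ : X} {R : ℝ} (hR : ∀ᵐ x ∂μ, x ∈ Metric.closedBall x₀ R)
    (f : LipB X) (π : Fin (k + 1) → Lip X) (ρ : ℕ → Fin (k + 1) → Lip X)
    (hρ : ∃ C : ℝ≥0, ∀ n i, LipschitzWith C (ρ n i).1)
    (hlim : ∀ i x, Tendsto (fun n => (ρ n i).1 x) atTop (𝓝 ((π i).1 x))) :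
    Tendsto (fun n => S f (ρ n)) atTop (𝓝 (S f π)) := by
  -- By multilinearity and alternation it suffices to treat one entry σ_n that tends to 0 pointwise,
  -- the other entries being uniformly Lipschitz but not required to converge.
  have key : ∀ (C : ℝ≥0) (σ : ℕ → Lip X) (r : ℕ → Fin k → Lip X),
      (∀ n, LipschitzWith C (σ n).1) → (∀ n j, LipschitzWith C (r n j).1) →
      (∀ x, Tendsto (fun n => (σ n).1 x) atTop (𝓝 0)) →
      Tendsto (fun n => S f (Fin.cons (σ n) (r n))) atTop (𝓝 0) := by
    intro C σ r hσ hr hσ0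
    obtain ⟨b, hb⟩ := (Metric.isBounded_range_of_tendsto _ (hσ0 x₀)).exists_norm_le
    have hb0 : 0 ≤ b := (norm_nonneg _).trans (hb _ (Set.mem_range_self 0))
    -- M bounds every σ_n on the 1-neighbourhood of the ball carrying μ: b bounds σ_n(x₀), and
    -- points there are within 1 + |R| of x₀. Hence truncation at M does not affect S.
    set M : ℝ := b + C * (1 + |R|) with hM
    have hM0 : 0 ≤ M := by positivity
    have hball : ∀ n, ∀ x ∈ Metric.thickening 1 (Metric.closedBall x₀ R), |(σ n).1 x| ≤ M := by
      intro n x hx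
      obtain ⟨y, hy, hxy⟩ := Metric.mem_thickening_iff.1 hx
      have h1 := (hσ n).dist_le_mul x x₀
      have h2 : dist x x₀ ≤ 1 + |R| := (dist_triangle x y x₀).trans
        (add_le_add hxy.le ((Metric.mem_closedBall.1 hy).trans (le_abs_self R)))
      have h3 : |(σ n).1 x₀| ≤ b := hb _ (Set.mem_range_self n)
      rw [Real.dist_eq] at h1
      calc |(σ n).1 x| = |(σ n).1 x₀ + ((σ n).1 x - (σ n).1 x₀)| := by congr 1; ring
        _ ≤ b + C * (1 + |R|) := (abs_add_le _ _).trans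
          (add_le_add h3 (h1.trans (by gcongr)))
    obtain ⟨D, hD⟩ := f.2.1
    have hrf : ∀ n j, LipschitzWith (max C D)
        ((Fin.cons (lipBToLip f) (r n) : Fin (k + 1) → Lip X) j).1 := fun n j => by
      refine Fin.cases ?_ (fun j => ?_) j
      · exact hD.weaken (le_max_right _ _)
      · exact (hr n j).weaken (le_max_left _ _)
    -- Integration by parts puts σ_n into the first slot of both S and ∂S, where the mass bounds and
    -- dominated convergence give the limit 0.
    have heq : ∀ n, S f (Fin.cons (σ n) (r n)) =
        boundary S (mulB f (truncate M (σ n))) (r n) -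
          S (truncate M (σ n)) (Fin.cons (lipBToLip f) (r n)) := fun n => by
      rw [← hleib, add_sub_cancel_right]
      exact hS.apply_cons_congr hlin A hA hloc hR f
        (fun x hx => (max_min_eq_self (hball n x hx)).symm) (r n)
    have hone : ∀ g : LipB X, mulB lipBOne g = g := fun g => by
      ext x
      exact one_mul _
    have h1 := (tendsto_integral_mul_truncate (μ := ν) f hM0 hσ0).const_mul ((C : ℝ) ^ k)
    have h2 := (tendsto_integral_mul_truncate (μ := μ) lipBOne hM0 hσ0).const_mul
      (((max C D : ℝ≥0) : ℝ) ^ (k + 1))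
    simp only [hone] at h2
    refine squeeze_zero_norm (fun n => ?_) (by simpa using h1.add h2)
    rw [heq, Real.norm_eq_abs]
    refine (abs_sub _ _).trans (add_le_add ?_ ?_)
    · refine (massBound_iff.1 hS' _ _).trans (mul_le_mul_of_nonneg_right ?_
        (integral_nonneg fun _ => abs_nonneg _))
      exact_mod_cast lipProd_le_pow (hr n)
    · refine (massBound_iff.1 hS _ _).trans (mul_le_mul_of_nonneg_right ?_
        (integral_nonneg fun _ => abs_nonneg _))
      exact_mod_cast lipProd_le_pow (hrf n)
  obtain ⟨C, hC⟩ := hρ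
  obtain ⟨D, hD⟩ := exists_common_lip π
  rw [← tendsto_sub_nhds_zero_iff]
  simp only [← hA, alternating_sub_eq_sum]
  have hterm : ∀ i : Fin (k + 1), Tendsto (fun n => (-1 : ℝ) ^ (i : ℕ) *
      A f (Fin.cons (ρ n i - π i) (i.removeNth (mixTuple (ρ n) π i)))) atTop (𝓝 0) := fun i => by
    simp only [hA]
    have h := key (C + D) (fun n => ρ n i - π i) (fun n => i.removeNth (mixTuple (ρ n) π i))
      (fun n => (hC n i).sub (hD i)) (fun n j => ?_) fun x => ?_
    · simpa using h.const_mul ((-1 : ℝ) ^ (i : ℕ))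
    · simp only [Fin.removeNth, mixTuple]
      split_ifs
      · exact (hD _).weaken le_add_self
      · exact (hC _ _).weaken le_self_add
    · exact tendsto_sub_nhds_zero_iff.2 (hlim i x)
  simpa using tendsto_finsetSum Finset.univ fun i _ => hterm i

end Continuity

/-! ### Finite mass of push-forwards, and normality of H(T). -/

section Pushforward

variable {X Y : Type*} [MetricSpace X] [MetricSpace Y] [MeasurableSpace X] [BorelSpace X]
  [MeasurableSpace Y] [BorelSpace Y] {k : ℕ}

lemma MassBound.sub {S S' : MetricFunctional X k} {μ ν : Measure X} (h : MassBound S μ)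
    (h' : MassBound S' ν) : MassBound (S - S') (μ + ν) := fun f π => by
  rw [lintegral_add_measure, mul_add]
  exact (ENNReal.ofReal_le_ofReal (abs_sub _ _)).trans
    (ENNReal.ofReal_add_le.trans (add_le_add (h f π) (h' f π)))

lemma MassBound.pushforward {T : MetricFunctional X k} {μ : Measure X} (h : MassBound T μ)
    {φ : X → Y} {K : ℝ≥0} (hK : LipschitzWith K φ) :
    MassBound (MetricCurrents.pushforward φ ⟨K, hK⟩ T) ((K : ℝ≥0∞) ^ k • μ.map φ) := fun f π => by
  have hm : Measurable fun y => ENNReal.ofReal |f.1 y| :=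
    ENNReal.measurable_ofReal.comp (LipB.continuous f).abs.measurable
  rw [lintegral_smul_measure, lintegral_map hm hK.continuous.measurable, smul_eq_mul, ← mul_assoc]
  refine (h _ _).trans (mul_le_mul_left ?_ _)
  have h1 : ∏ i, lipConst (lipComp (π i) φ ⟨K, hK⟩).1 ≤ ∏ i, (lipConst (π i).1 * K) :=
    Finset.prod_le_prod' fun i _ => by
      rw [← coe_lipReal (π i), ← ENNReal.coe_mul]
      exact lipConst_le ((lipschitzWith_lipReal (π i)).comp hK)
  refine h1.trans (le_of_eq ?_)
  rw [Finset.prod_mul_distrib, Finset.prod_const, Finset.card_univ, Fintype.card_fin]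

end Pushforward

section HomotopyCurrent

variable {B : Type*} [NormedAddCommGroup B] [NormedSpace ℝ B] [MeasurableSpace B] [BorelSpace B]
  {φ ψ : B → B} {k : ℕ}

/-- φ and ψ are bounded on a bounded carrier of ‖S‖, hence so are their convex combinations. -/
lemma exists_ae_homotopyMeasure_mem_closedBall {S : MetricFunctional B k}
    (hS : IsMetricCurrent S) (hsupp : HasBoundedSupport S) (hφ : IsLip φ) (hψ : IsLip ψ) :
    ∃ R : ℝ, ∀ᵐ y ∂(homotopyMeasure φ ψ S), y ∈ Metric.closedBall 0 R := by
  obtain ⟨r, -, hr⟩ := hsupp.exists_ae_norm_le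
  have h0 : IsLip fun _ : B => (0 : B) := ⟨0, LipschitzWith.const 0⟩
  obtain ⟨D, hD0, hD⟩ := exists_displacement_le hφ h0 r
  obtain ⟨E, hE0, hE⟩ := exists_displacement_le hψ h0 r
  simp only [sub_zero] at hD hE
  refine ⟨D + E, ?_⟩
  have hmeas : MeasurableSet (Metric.closedBall (0 : B) (D + E))ᶜ :=
    Metric.isClosed_closedBall.measurableSet.compl
  rw [ae_iff]
  change homotopyMeasure φ ψ S (Metric.closedBall (0 : B) (D + E))ᶜ = 0
  rw [← lintegral_indicator_one hmeas,
    lintegral_homotopyMeasure hS hsupp hφ hψ (measurable_one.indicator hmeas)]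
  refine mul_eq_zero_of_right _ ?_
  rw [setLIntegral_congr_fun (g := fun _ => 0) measurableSet_Ioc fun t ht => ?_, lintegral_zero]
  refine lintegral_eq_zero_of_ae_eq_zero ?_
  filter_upwards [hr] with x hx
  refine mul_eq_zero_of_right _ (Set.indicator_of_notMem (Set.notMem_compl_iff.2 ?_) _)
  rw [mem_closedBall_zero_iff, affineHomotopy]
  refine (norm_add_le _ _).trans (add_le_add ?_ ?_)
  · rw [norm_smul, Real.norm_of_nonneg ht.1.le]
    exact (mul_le_of_le_one_left (norm_nonneg _) ht.2).trans (hD x hx)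
  · rw [norm_smul, Real.norm_of_nonneg (by linarith [ht.2])]
    exact (mul_le_of_le_one_left (norm_nonneg _) (by linarith [ht.1])).trans (hE x hx)

variable {T : MetricFunctional B (k + 1)}

lemma timeTerm_leibniz (hT : IsMetricCurrent T) (hsupp : HasBoundedSupport T) (hφ : IsLip φ)
    (hψ : IsLip ψ) (f g : LipB B) (p : Lip B) (ρ : Fin k → Lip B) (t : ℝ) :
    timeTerm T hφ hψ f p (Fin.cons (lipBToLip g) ρ) t +
      timeTerm T hφ hψ g p (Fin.cons (lipBToLip f) ρ) t =
      timeTerm T hφ hψ lipBOne p (Fin.cons (lipBToLip (mulB f g)) ρ) t := by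
  have h := hT.extend_leibniz (integrable_homotopyWeight hT hsupp hφ hψ lipBOne p t)
    (sliceB hφ hψ t f) (sliceB hφ hψ t g) (Fin.cons 0 fun j => slice hφ hψ t (ρ j)) 0
  simp only [Fin.update_cons_zero] at h
  have e : ∀ u : LipB B, homotopyWeight φ ψ u.1 p.1 t =
      fun x => homotopyWeight φ ψ lipBOne.1 p.1 t x * (sliceB hφ hψ t u).1 x := fun u => by
    ext x
    simp only [homotopyWeight, sliceB, lipBComp, lipBOne]
    ring
  unfold timeTerm
  rw [slice_cons, slice_cons, slice_cons, e f, e g]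
  exact h

lemma ae_timeTerm_mulB (hT : IsMetricCurrent T) (hsupp : HasBoundedSupport T) (hφ : IsLip φ)
    (hψ : IsLip ψ) (f g : LipB B) (ρ : Fin (k + 1) → Lip B) :
    ∀ᵐ t : ℝ, timeTerm T hφ hψ f (lipBToLip g) ρ t + timeTerm T hφ hψ g (lipBToLip f) ρ t =
      timeTerm T hφ hψ lipBOne (lipBToLip (mulB f g)) ρ t := by
  have hfin := hT.isFiniteMeasure
  filter_upwards [ae_ae_differentiableAt hφ hψ (lipBToLip f) (massMeasure T),
    ae_ae_differentiableAt hφ hψ (lipBToLip g) (massMeasure T)] with t h1 h2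
  unfold timeTerm
  rw [← hT.extend_add (integrable_homotopyWeight hT hsupp hφ hψ f _ t)
    (integrable_homotopyWeight hT hsupp hφ hψ g _ t)]
  refine hT.extend_congr ?_ _
  filter_upwards [h1, h2] with x h1 h2
  have h3 := deriv_fun_mul h1 h2
  simp only [Pi.add_apply, homotopyWeight, lipBToLip, mulB, lipBOne] at h3 ⊢
  rw [h3]
  ring

/-- When slot 0 is the differentiated one, this is the product rule for time derivatives, valid for
almost every t. In the other summands slot 0 stays inside T, and it is the product rule of T. -/
lemma homotopyFunctional_leibniz (hT : IsMetricCurrent T) (hsupp : HasBoundedSupport T)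
    (hφ : IsLip φ) (hψ : IsLip ψ) (f g : LipB B) (ρ : Fin (k + 1) → Lip B) :
    homotopyFunctional φ ψ hφ hψ T f (Fin.cons (lipBToLip g) ρ) +
      homotopyFunctional φ ψ hφ hψ T g (Fin.cons (lipBToLip f) ρ) =
      boundary (homotopyFunctional φ ψ hφ hψ T) (mulB f g) ρ := by
  have hi := fun f : LipB B => intervalIntegrable_timeTerm hT hsupp hφ hψ f
  rw [boundary, homotopyFunctional_cons, homotopyFunctional_cons, homotopyFunctional_cons,
    add_add_add_comm, ← Finset.sum_add_distrib,
    ← intervalIntegral.integral_add (hi f _ _) (hi g _ _)]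
  congr 1
  · refine intervalIntegral.integral_congr_ae ?_
    filter_upwards [ae_timeTerm_mulB hT hsupp hφ hψ f g ρ] with t ht _ using ht
  · refine Finset.sum_congr rfl fun i _ => ?_
    rw [← mul_add, ← intervalIntegral.integral_add (hi f _ _) (hi g _ _)]
    simp only [timeTerm_leibniz hT hsupp]

/-- The homotopy formula writes ∂H(T) as φ_#T − ψ_#T − H(∂T), and each of the three has finite mass.
H(∂T) does because `massBound_homotopyFunctional` needs only a current with bounded support. -/
lemma exists_massBound_boundary_homotopyFunctional (hT : IsNormalCurrent T)
    (hsupp : HasBoundedSupport T) (hφ : IsLip φ) (hψ : IsLip ψ) :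
    ∃ μ : Measure B, IsFiniteMeasure μ ∧
      MassBound (boundary (homotopyFunctional φ ψ hφ hψ T)) μ := by
  have hfin := hT.1.isFiniteMeasure
  have hsupp' := hsupp.boundary hT.1 hT.2
  have hfin' := isFiniteMeasure_homotopyMeasure hT.2 hsupp' hφ hψ
  obtain ⟨K, hK⟩ := id hφ
  obtain ⟨L, hL⟩ := id hψ
  have h := ((hT.1.massBound.pushforward hK).sub (hT.1.massBound.pushforward hL)).sub
    (massBound_homotopyFunctional hT.2 hsupp' hφ hψ)
  rw [homotopy_formula hT hsupp hφ hψ, add_sub_cancel_right] at h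
  have hK' := Measure.smul_finite ((massMeasure T).map φ)
    (ENNReal.pow_ne_top (n := k + 1) (ENNReal.coe_ne_top (r := K)))
  have hL' := Measure.smul_finite ((massMeasure T).map ψ)
    (ENNReal.pow_ne_top (n := k + 1) (ENNReal.coe_ne_top (r := L)))
  exact ⟨_, inferInstance, h⟩

theorem isMetricCurrent_homotopyFunctional (hT : IsNormalCurrent T)
    (hsupp : HasBoundedSupport T) (hφ : IsLip φ) (hψ : IsLip ψ) :
    IsMetricCurrent (homotopyFunctional φ ψ hφ hψ T) where
  linear_left := homotopyFunctional_linear_left hT.1 hsupp hφ hψ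
  linear_right := homotopyFunctional_linear_right hT.1 hsupp hφ hψ
  locality := homotopyFunctional_locality hT.1 hsupp hφ hψ
  continuity := by
    obtain ⟨ν, hν, hνb⟩ := exists_massBound_boundary_homotopyFunctional hT hsupp hφ hψ
    obtain ⟨R, hR⟩ := exists_ae_homotopyMeasure_mem_closedBall hT.1 hsupp hφ hψ
    have hfin := isFiniteMeasure_homotopyMeasure hT.1 hsupp hφ hψ
    exact tendsto_of_massBound_boundary (massBound_homotopyFunctional hT.1 hsupp hφ hψ) hνb
      (homotopyFunctional_linear_left hT.1 hsupp hφ hψ) (homotopyAlt hT.1 hsupp hφ hψ)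
      (homotopyAlt_apply hT.1 hsupp hφ hψ) (homotopyFunctional_locality hT.1 hsupp hφ hψ)
      (homotopyFunctional_leibniz hT.1 hsupp hφ hψ) hR
  finite_mass := ⟨_, isFiniteMeasure_homotopyMeasure hT.1 hsupp hφ hψ,
    massBound_homotopyFunctional hT.1 hsupp hφ hψ⟩

theorem mass_homotopyFunctional_le {S : MetricFunctional B k} (hS : IsMetricCurrent S)
    (hsupp : HasBoundedSupport S) (hφ : IsLip φ) (hψ : IsLip ψ) :
    mass (homotopyFunctional φ ψ hφ hψ S) ≤ ((k + 1 : ℕ) : ℝ≥0∞) *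
      ∫⁻ x, ENNReal.ofReal ‖φ x - ψ x‖ * max (pointLip φ x) (pointLip ψ x) ^ k
        ∂(massMeasure S) := by
  have := isFiniteMeasure_homotopyMeasure hS hsupp hφ hψ
  refine (massMeasure_le (massBound_homotopyFunctional hS hsupp hφ hψ) Set.univ).trans ?_
  exact (homotopyMeasure_univ hS hsupp hφ hψ).le

end HomotopyCurrent

end MetricCurrents

end


/-- The current `T` has dimension `k + 1`, that is, an arbitrary dimension at least one. -/
theorem proposition4p6 {B : Type*} [NormedAddCommGroup B] [NormedSpace ℝ B] [CompleteSpace B]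
    [MeasurableSpace B] [BorelSpace B] (k : ℕ)
    (T : MetricCurrents.MetricFunctional B (k + 1))
    (hT : MetricCurrents.IsNormalCurrent T)
    (hsupp : MetricCurrents.HasBoundedSupport T)
    (φ ψ : B → B) (hφ : MetricCurrents.IsLip φ) (hψ : MetricCurrents.IsLip ψ) :
    MetricCurrents.HomotopyConverges φ ψ hφ hψ T ∧
    MetricCurrents.HomotopyConverges φ ψ hφ hψ (MetricCurrents.boundary T) ∧
    MetricCurrents.mass (MetricCurrents.homotopyFunctional φ ψ hφ hψ T) ≤
      (((k + 1) + 1 : ℕ) : ℝ≥0∞) *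
        ∫⁻ x, ENNReal.ofReal ‖φ x - ψ x‖ *
          max (MetricCurrents.pointLip φ x) (MetricCurrents.pointLip ψ x) ^ (k + 1)
          ∂(MetricCurrents.massMeasure T) ∧
    MetricCurrents.IsNormalCurrent (MetricCurrents.homotopyFunctional φ ψ hφ hψ T) ∧
    MetricCurrents.pushforward φ hφ T - MetricCurrents.pushforward ψ hψ T =
      MetricCurrents.boundary (MetricCurrents.homotopyFunctional φ ψ hφ hψ T) +
        MetricCurrents.homotopyFunctional φ ψ hφ hψ (MetricCurrents.boundary T) := by
  exact ⟨MetricCurrents.homotopyConverges hT.1 hsupp hφ hψ,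
    MetricCurrents.homotopyConverges hT.2 (hsupp.boundary hT.1 hT.2) hφ hψ,
    MetricCurrents.mass_homotopyFunctional_le hT.1 hsupp hφ hψ,
    ⟨MetricCurrents.isMetricCurrent_homotopyFunctional hT hsupp hφ hψ,
      (MetricCurrents.isMetricCurrent_homotopyFunctional hT hsupp hφ hψ).boundary
        (MetricCurrents.exists_massBound_boundary_homotopyFunctional hT hsupp hφ hψ)⟩,
    MetricCurrents.homotopy_formula hT hsupp hφ hψ⟩
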